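/- Let $n,p\ge 0$ and $d\ge 1$ be integers, let $X$ be an $n\times p$ real matrix with rows $x_i^T$, $y$ an $n\times d$ real matrix with rows $y_i^T$, and $a\in\mathbb R$. Assume that the $n\times(p+d)$ matrix $(X:y)$ has rank $p+d$ and that $n>p+2d-2a$. Let $h$ be a probability density on $(0,\infty)$ with $\int_1^\infty u^{d/2}h(u)\,du<\infty$. Let $\mathcal S_d$ be the set of positive definite $d\times d$ matrices, with Lebesgue measure $d\Sigma$ on the $d(d+1)/2$ entries on and above the diagonal, and put, for $(\beta,\Sigma)\in\mathsf X:=\mathbb R^{p\times d}\times\mathcal S_d$, $r_i(\beta,\Sigma)=(y_i-\beta^Tx_i)^T\Sigma^{-1}(y_i-\beta^Tx_i)$. Consider the multivariate regression model with likelihood $$f(y|\beta,\Sigma)=\prod_{i=1}^n\int_0^\infty\frac{u^{d/2}}{(2\pi)^{d/2}|\Sigma|^{1/2}}e^{-\frac u2 r_i(\beta,\Sigma)}h(u)\,du$$ and improper prior $\omega(\beta,\Sigma)=|\Sigma|^{-a}$ on $\mathsf X$, let $m(y)=\int_{\mathcal S_d}\int_{\mathbb R^{p\times d}}f(y|\beta,\Sigma)\,\omega(\beta,\Sigma)\,d\beta\,d\Sigma$,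 and let $\pi(\beta,\Sigma|y)=f(y|\beta,\Sigma)\,\omega(\beta,\Sigma)/m(y)$ be the posterior density. The data augmentation (DA) Markov chain on $\mathsf X$ moves from $(\beta,\Sigma)$ to $(\beta',\Sigma')$ as follows. 1. Draw $z_1,\dots,z_n>0$ independently, $z_i$ from the density proportional to $u^{d/2}e^{-r_i(\beta,\Sigma)u/2}h(u)$. Put $Q^{-1}=\mathrm{diag}(z_1,\dots,z_n)$, $\Omega=(X^TQ^{-1}X)^{-1}$ and $\mu=\Omega X^TQ^{-1}y$. 2. Draw $\Sigma'\sim \mathrm{IW}_d\big(n-p+2a-d-1,\,(y^TQ^{-1}y-\mu^T\Omega^{-1}\mu)^{-1}\big)$, where the inverse Wishart distribution $\mathrm{IW}_d(\nu,\Theta)$ has density on $\mathcal S_d$ $$\frac{|w|^{-\frac{\nu+d+1}{2}}\exp\{-\frac12\mathrm{tr}(\Theta^{-1}w^{-1})\}}{2^{\nu d/2}\pi^{d(d-1)/4}|\Theta|^{\nu/2}\prod_{i=1}^d\Gamma(\frac{\nu+1-i}{2})}.$$ 3. Draw $\beta'\sim \mathrm N_{p,d}(\mu,\Omega,\Sigma')$,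 where the matrix normal distribution $\mathrm N_{p,d}(\theta,A,B)$ has density $$\frac{1}{(2\pi)^{pd/2}|A|^{d/2}|B|^{p/2}}\exp\Big[-\frac12\mathrm{tr}\{A^{-1}(b-\theta)B^{-1}(b-\theta)^T\}\Big]$$ on $\mathbb R^{p\times d}$. Let $k^m(\cdot\,|\,\tilde\beta,\tilde\Sigma)$ be its $m$-step transition density. Suppose that there are $\lambda\in\big[0,\frac1{n-p+2a-1}\big)$ and $L\in\mathbb R$ such that, for every $s\ge0$, $$\frac{\int_0^\infty u^{\frac{d-2}2}e^{-su/2}h(u)\,du}{\int_0^\infty u^{\frac d2}e^{-su/2}h(u)\,du}\le\lambda s+L .$$ Then the DA Markov chain is geometrically ergodic: the posterior is proper, i.e. $m(y)<\infty$, and there are $M:\mathsf X\to[0,\infty)$ and $\rho\in[0,1)$ such that, for all $m\ge1$ and all $(\tilde\beta,\tilde\Sigma)\in\mathsf X$, $$\int_{\mathcal S_d}\int_{\mathbb R^{p\times d}}\big|k^m(\beta,\Sigma|\tilde\beta,\tilde\Sigma)-\pi(\beta,\Sigma|y)\big|\,d\beta\,d\Sigma\le M(\tilde\beta,\tilde\Sigma)\,\rho^m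 .$$ -/

import Mathlib

open MeasureTheory Set
open scoped ENNReal NNReal Matrix

noncomputable section

namespace DAReg

/-- `h` is a mixing density: the Lebesgue density, on `(0, ∞)`, of a positive random variable.
Only the values of `h` on `(0, ∞)` matter. -/
structure IsMixingDensity (h : ℝ → ℝ) : Prop where
  measurable : Measurable h
  nonneg : ∀ u, 0 < u → 0 ≤ h u
  lintegral_eq_one : ∫⁻ u in Ioi (0 : ℝ), ENNReal.ofReal (h u) = 1

/-- Condition `M`: `∫_1^∞ u^{d/2} h(u) du < ∞`. -/
def ConditionM (d : ℕ) (h : ℝ → ℝ) : Prop :=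
  ∫⁻ u in Ioi (1 : ℝ), ENNReal.ofReal (u ^ ((d : ℝ) / 2) * h u) < ∞

/-- `∫_0^∞ u^q e^{-su/2} h(u) du`, as an extended nonnegative number. -/
def mixInt (h : ℝ → ℝ) (q s : ℝ) : ℝ≥0∞ :=
  ∫⁻ u in Ioi (0 : ℝ), ENNReal.ofReal (u ^ q * Real.exp (-(s * u / 2)) * h u)

/-- The density `ψ(u; s) = c(s) u^{d/2} e^{-su/2} h(u)` on `(0, ∞)`, with `c(s)` the normalizing
constant. -/
def psi (d : ℕ) (h : ℝ → ℝ) (s u : ℝ) : ℝ≥0∞ :=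
  (mixInt h ((d : ℝ) / 2) s)⁻¹ *
    ENNReal.ofReal (u ^ ((d : ℝ) / 2) * Real.exp (-(s * u / 2)) * h u)

/-- The positions on and above the diagonal: the `d(d+1)/2` free entries of a symmetric matrix. -/
abbrev Upper (d : ℕ) : Type := {ij : Fin d × Fin d // ij.1 ≤ ij.2}

/-- The symmetric matrix with given entries on and above the diagonal. -/
def symMat {d : ℕ} (v : Upper d → ℝ) : Matrix (Fin d) (Fin d) ℝ :=
  Matrix.of fun i j => v ⟨(min i j, max i j), min_le_max⟩

/-- `∫_{S_d} ∫_{ℝ^{p × d}} F(β, Σ) dβ dΣ`, where `S_d` is the set of positive definite `d × d`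
matrices seen inside `ℝ^{d(d+1)/2}`; `dβ` and `dΣ` are Lebesgue measure. -/
def stateInt {p d : ℕ}
    (F : Matrix (Fin p) (Fin d) ℝ → Matrix (Fin d) (Fin d) ℝ → ℝ≥0∞) : ℝ≥0∞ :=
  ∫⁻ v : Upper d → ℝ in {v | (symMat v).PosDef},
    ∫⁻ b : Fin p → Fin d → ℝ, F (Matrix.of b) (symMat v)

/-- The matrix normal density `N_{r,c}(θ, A, B)`. -/
def matrixNormalDensity {r c : ℕ} (θ : Matrix (Fin r) (Fin c) ℝ) (A : Matrix (Fin r) (Fin r) ℝ)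
    (B : Matrix (Fin c) (Fin c) ℝ) (z : Matrix (Fin r) (Fin c) ℝ) : ℝ :=
  Real.exp (-(1 / 2) * (A⁻¹ * (z - θ) * B⁻¹ * (z - θ)ᵀ).trace) /
    ((2 * Real.pi) ^ ((r : ℝ) * c / 2) * A.det ^ ((c : ℝ) / 2) * B.det ^ ((r : ℝ) / 2))

open Classical in
/-- The inverse Wishart density `IW_d(m, Θ)`, with respect to Lebesgue measure on the
`d(d+1)/2` free entries. -/
def invWishartDensity {d : ℕ} (m : ℝ) (Θ w : Matrix (Fin d) (Fin d) ℝ) : ℝ :=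
  if w.PosDef then
    w.det ^ (-((m + d + 1) / 2)) * Real.exp (-(1 / 2) * (Θ⁻¹ * w⁻¹).trace) /
      ((2 : ℝ) ^ (m * d / 2) * Real.pi ^ ((d : ℝ) * (d - 1) / 4) * Θ.det ^ (m / 2) *
        ∏ i ∈ Finset.Icc 1 d, Real.Gamma ((m + 1 - (i : ℝ)) / 2))
  else 0

section Model

variable {n p d : ℕ} (X : Matrix (Fin n) (Fin p) ℝ) (y : Matrix (Fin n) (Fin d) ℝ)

/-- `(y_i - βᵀ x_i)ᵀ Σ⁻¹ (y_i - βᵀ x_i)`, where `x_i` and `y_i` are the `i`-th rows. -/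
def resid (β : Matrix (Fin p) (Fin d) ℝ) (S : Matrix (Fin d) (Fin d) ℝ) (i : Fin n) : ℝ :=
  (y i - βᵀ *ᵥ X i) ⬝ᵥ (S⁻¹ *ᵥ (y i - βᵀ *ᵥ X i))

/-- The likelihood `f(y | β, Σ)` with errors from the scale mixture of normals. -/
def likelihood (h : ℝ → ℝ) (β : Matrix (Fin p) (Fin d) ℝ) (S : Matrix (Fin d) (Fin d) ℝ) :
    ℝ≥0∞ :=
  ∏ i, ∫⁻ u in Ioi (0 : ℝ), ENNReal.ofReal
    (u ^ ((d : ℝ) / 2) / ((2 * Real.pi) ^ ((d : ℝ) / 2) * S.det ^ ((1 : ℝ) / 2)) *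
      Real.exp (-(u / 2) * resid X y β S i) * h u)

open Classical in
/-- The improper prior `ω(β, Σ) = |Σ|^{-a}` on positive definite `Σ`. -/
def prior (a : ℝ) (S : Matrix (Fin d) (Fin d) ℝ) : ℝ≥0∞ :=
  if S.PosDef then ENNReal.ofReal (S.det ^ (-a)) else 0

/-- `m(y)`: the posterior is proper precisely when this is finite. -/
def marginal (a : ℝ) (h : ℝ → ℝ) : ℝ≥0∞ :=
  stateInt fun (β : Matrix (Fin p) (Fin d) ℝ) S => likelihood X y h β S * prior a S

/-- The posterior density `π(β, Σ | y)`. -/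
def posterior (a : ℝ) (h : ℝ → ℝ) (β : Matrix (Fin p) (Fin d) ℝ)
    (S : Matrix (Fin d) (Fin d) ℝ) : ℝ≥0∞ :=
  likelihood X y h β S * prior a S / marginal X y a h

/-- `Q⁻¹`, the diagonal matrix with entries `z_i`. -/
def Qinv (z : Fin n → ℝ) : Matrix (Fin n) (Fin n) ℝ := Matrix.diagonal z

/-- `Ω = (Xᵀ Q⁻¹ X)⁻¹`. -/
def Om (z : Fin n → ℝ) : Matrix (Fin p) (Fin p) ℝ := (Xᵀ * Qinv z * X)⁻¹

/-- `μ = (Xᵀ Q⁻¹ X)⁻¹ Xᵀ Q⁻¹ y`. -/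
def mu (z : Fin n → ℝ) : Matrix (Fin p) (Fin d) ℝ := (Xᵀ * Qinv z * X)⁻¹ * Xᵀ * Qinv z * y

/-- Step 1 of the algorithm: the density of `z` given the current state `(β, Σ)`. -/
def step1 (h : ℝ → ℝ) (β : Matrix (Fin p) (Fin d) ℝ) (S : Matrix (Fin d) (Fin d) ℝ)
    (z : Fin n → ℝ) : ℝ≥0∞ :=
  ∏ i, psi d h (resid X y β S i) (z i)

/-- Step 2: the density of the new `Σ` given `z`. -/
def step2 (a : ℝ) (z : Fin n → ℝ) (S : Matrix (Fin d) (Fin d) ℝ) : ℝ≥0∞ :=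
  ENNReal.ofReal (invWishartDensity ((n : ℝ) - p + 2 * a - d - 1)
    ((yᵀ * Qinv z * y - (mu X y z)ᵀ * (Om X z)⁻¹ * mu X y z)⁻¹) S)

/-- Step 3: the density of the new `β` given `z` and the new `Σ`. -/
def step3 (z : Fin n → ℝ) (S : Matrix (Fin d) (Fin d) ℝ) (β : Matrix (Fin p) (Fin d) ℝ) :
    ℝ≥0∞ :=
  ENNReal.ofReal (matrixNormalDensity (mu X y z) (Om X z) S β)

/-- The one-step transition density of the data augmentation chain, from `(β₀, S₀)` to `(β, S)`:
the latent `z ∈ (0, ∞)^n` is integrated out. -/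
def trans (a : ℝ) (h : ℝ → ℝ) (β₀ : Matrix (Fin p) (Fin d) ℝ) (S₀ : Matrix (Fin d) (Fin d) ℝ)
    (β : Matrix (Fin p) (Fin d) ℝ) (S : Matrix (Fin d) (Fin d) ℝ) : ℝ≥0∞ :=
  ∫⁻ z : Fin n → ℝ in Set.pi univ (fun _ => Ioi (0 : ℝ)),
    step3 X y z S β * step2 X y a z S * step1 X y h β₀ S₀ z

/-- `transIter X y a h m` is the `(m + 1)`-step transition density `k^{m+1}`. -/
def transIter (a : ℝ) (h : ℝ → ℝ) : ℕ →
    Matrix (Fin p) (Fin d) ℝ → Matrix (Fin d) (Fin d) ℝ →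
    Matrix (Fin p) (Fin d) ℝ → Matrix (Fin d) (Fin d) ℝ → ℝ≥0∞
  | 0 => trans X y a h
  | m + 1 => fun β₀ S₀ β S =>
      stateInt fun β₁ S₁ => trans X y a h β₀ S₀ β₁ S₁ * transIter a h m β₁ S₁ β S

/-- Geometric ergodicity of the data augmentation chain: the posterior is proper, and from every
starting point of the state space the `L¹` distance between `k^m` and the posterior density is at
most `M ρ^m`, for all `m ≥ 1`. (The densities are finite almost everywhere.) -/
def GeometricallyErgodic (a : ℝ) (h : ℝ → ℝ) : Prop :=
  marginal X y a h < ∞ ∧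
  ∃ (M : Matrix (Fin p) (Fin d) ℝ → Matrix (Fin d) (Fin d) ℝ → ℝ≥0) (ρ : ℝ≥0), ρ < 1 ∧
    ∀ (m : ℕ) (β₀ : Matrix (Fin p) (Fin d) ℝ) (S₀ : Matrix (Fin d) (Fin d) ℝ), S₀.PosDef →
      stateInt (fun β S => ENNReal.ofReal
        |(transIter X y a h m β₀ S₀ β S).toReal - (posterior X y a h β S).toReal|)
        ≤ ((M β₀ S₀ * ρ ^ (m + 1) : ℝ≥0) : ℝ≥0∞)

end Model

end DAReg

end

noncomputable section

namespace DAReg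

/-! ### Geometric ergodicity of Markov transition densities from drift and minorization -/

section Harris

variable {E : Type*} [MeasurableSpace E]

/-! The chain is a two-block Gibbs sampler: it alternates `z` given `(β, Σ)` and `(β, Σ)` given `z`,
and both conditionals come from one joint kernel (`target_mul_step1`, `condKernel_eq`). Hence the
unnormalized posterior is an invariant density (`lintegral_target_mul_kernel`). Geometric
convergence comes from a drift condition and a minorization condition for `V = ∑ rᵢ` (`totalResid`).

Drift. Put `N = n - p + 2a - 1` and `ν = N - d`. The integral of `|Σ|^{-(n+2a)/2} exp(-½ ∑ zᵢ rᵢ)`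
over the state space is a constant times `|XᵀQ⁻¹X|^{-d/2} |rss|^{-ν/2}`. Raising `zᵢ` by `t`
multiplies the integrand by `exp(-t rᵢ/2)` and each determinant by at most `1 + t/zᵢ`. So, given
`z`, the Laplace transform of `rᵢ/2` is at least `(1 + t/zᵢ)^{-N/2} ≥ 1 - N t/(2 zᵢ)`, and `t → 0`
shows that the mean of `rᵢ` is at most `N/zᵢ` (`lintegral_condDensity_mul_resid`). Averaging `1/zᵢ`
over step 1 gives exactly the ratio of mixing integrals at the old `rᵢ`, which is at most `λ rᵢ +
L`. Thus `V` contracts at rate `Nλ < 1`, up to an additive constant.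

Minorization. Where `V ≤ R`, every `rᵢ` is at most `R`, and each density `ψ(·; rᵢ)` dominates a
fixed multiple of `ψ(·; R)`; the kernel then dominates a multiple of a fixed density
(`exists_minorization`).

These two conditions make the kernel a strict contraction in total variation weighted by `1 + βV`
(`exists_contraction`), which iterates. They also force any almost everywhere finite invariant
density to be integrable (`lintegral_lt_top_of_invariant`), so that propriety of the posterior is a
by-product. The explicit normalizing constants rest on the inverse Wishart integral, computed by
induction on the dimension (`lintegral_wishartKernel`). -/

/-- `kerIter τ k m` is the `(m + 1)`-fold composition of the transition density `k`. -/
def kerIter (τ : Measure E) (k : E → E → ℝ≥0∞) : ℕ → E → E → ℝ≥0∞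
  | 0 => k
  | m + 1 => fun x z => ∫⁻ w, k x w * kerIter τ k m w z ∂τ

variable {τ : Measure E}

/-- Subtraction is truncated, so these are the two halves of the total variation distance; adding 1
to either gives `∫ max f g`. -/
lemma lintegral_sub_eq_of_density {f g : E → ℝ≥0∞} (hf : Measurable f) (hg : Measurable g)
    (hf1 : ∫⁻ w, f w ∂τ = 1) (hg1 : ∫⁻ w, g w ∂τ = 1) :
    ∫⁻ w, (f w - g w) ∂τ = ∫⁻ w, (g w - f w) ∂τ := by
  have h : (∫⁻ w, (f w - g w) ∂τ) + 1 = (∫⁻ w, (g w - f w) ∂τ) + 1 := by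
    conv_lhs => rw [← hg1]
    conv_rhs => rw [← hf1]
    rw [← lintegral_add_right _ hg, ← lintegral_add_right _ hf]
    refine lintegral_congr fun w => ?_
    rw [tsub_add_eq_max, tsub_add_eq_max, max_comm]
  exact (ENNReal.add_left_inj ENNReal.one_ne_top).1 h

variable [SFinite τ] {k : E → E → ℝ≥0∞}

lemma measurable_kerIter (hk : Measurable (Function.uncurry k)) (m : ℕ) :
    Measurable (Function.uncurry (kerIter τ k m)) := by
  induction m with
  | zero => exact hk
  | succ m ih =>
    have : Measurable (fun q : (E × E) × E => k q.1.1 q.2 * kerIter τ k m q.2 q.1.2) := by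
      refine Measurable.mul ?_ ?_
      · exact hk.comp (by fun_prop : Measurable fun q : (E × E) × E => (q.1.1, q.2))
      · exact ih.comp (by fun_prop : Measurable fun q : (E × E) × E => (q.2, q.1.2))
    exact this.lintegral_prod_right'

/-- Couple `a` and `b` by the product density `a ⊗ b / δ`, where `δ` is their common mass: both
mixtures become averages over pairs `(w, w')`, and the positive part of an average is at most the
average of the positive parts. -/
lemma lintegral_sub_mix_le {f : E → E → ℝ≥0∞} (hf : Measurable (Function.uncurry f))
    {a b : E → ℝ≥0∞} (ha : Measurable a) (hb : Measurable b)
    (hab : ∫⁻ w, a w ∂τ = ∫⁻ w, b w ∂τ) (hfin : ∫⁻ w, a w ∂τ ≠ ∞)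
    {g : E → ℝ≥0∞} (hg : Measurable g) {s : Set E} (hs : ∀ᵐ x ∂τ, x ∈ s)
    (hfg : ∀ w ∈ s, ∀ w' ∈ s, ∫⁻ z, (f w z - f w' z) ∂τ ≤ g w + g w') :
    ∫⁻ z, ((∫⁻ w, a w * f w z ∂τ) - ∫⁻ w, b w * f w z ∂τ) ∂τ
      ≤ (∫⁻ w, a w * g w ∂τ) + ∫⁻ w, b w * g w ∂τ := by
  set δ := ∫⁻ w, a w ∂τ with hδ
  have hfz : ∀ z, Measurable fun w => f w z := fun z => hf.comp measurable_prodMk_right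
  by_cases h0 : δ = 0
  · have ha0 : a =ᵐ[τ] 0 := (lintegral_eq_zero_iff ha).1 h0
    have : ∀ z, ∫⁻ w, a w * f w z ∂τ = 0 := by
      intro z
      have := hfz z
      rw [lintegral_eq_zero_iff (by fun_prop)]
      filter_upwards [ha0] with w hw
      rw [hw, Pi.zero_apply, zero_mul]
    simp [this]
  · have hbd : ∫⁻ w, b w ∂τ = δ := hab.symm
    have key : ∀ z, δ * ((∫⁻ w, a w * f w z ∂τ) - ∫⁻ w, b w * f w z ∂τ)
        ≤ ∫⁻ w, ∫⁻ w', a w * b w' * (f w z - f w' z) ∂τ ∂τ := by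
      intro z
      have hfz' := hfz z
      rw [ENNReal.mul_sub (fun _ _ => hfin)]
      have e1 : δ * ∫⁻ w, a w * f w z ∂τ = ∫⁻ w, ∫⁻ w', a w * b w' * f w z ∂τ ∂τ := by
        rw [← lintegral_const_mul _ (by fun_prop)]
        refine lintegral_congr fun w => ?_
        have : ∀ w', a w * b w' * f w z = (a w * f w z) * b w' := fun w' => by ring
        simp_rw [this]
        rw [lintegral_const_mul _ hb, hbd, mul_comm]
      have e2 : δ * ∫⁻ w, b w * f w z ∂τ = ∫⁻ w, ∫⁻ w', a w * b w' * f w' z ∂τ ∂τ := by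
        have : ∀ w, ∫⁻ w', a w * b w' * f w' z ∂τ = a w * ∫⁻ w', b w' * f w' z ∂τ := by
          intro w
          simp_rw [mul_assoc]
          rw [lintegral_const_mul _ (by fun_prop)]
        simp_rw [this]
        rw [lintegral_mul_const _ ha]
      rw [e1, e2]
      have m2 : Measurable fun q : E × E => a q.1 * b q.2 * f q.2 z :=
        ((ha.comp measurable_fst).mul (hb.comp measurable_snd)).mul ((hfz z).comp measurable_snd)
      refine (lintegral_sub_le _ _ m2.lintegral_prod_right').trans ?_
      refine lintegral_mono fun w => ?_
      refine (lintegral_sub_le _ _ (m2.comp measurable_prodMk_left)).trans ?_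
      refine lintegral_mono fun w' => ?_
      exact tsub_le_iff_right.2 (by
        change _ ≤ _ + a w * b w' * f w' z
        rw [← mul_add]
        gcongr
        exact le_tsub_add)
    have hF : Measurable fun q : E × E × E => a q.2.1 * b q.2.2 * (f q.2.1 q.1 - f q.2.2 q.1) := by
      refine ((ha.comp (by fun_prop)).mul (hb.comp (by fun_prop))).mul (Measurable.sub ?_ ?_)
      · exact hf.comp (by fun_prop : Measurable fun q : E × E × E => (q.2.1, q.1))
      · exact hf.comp (by fun_prop : Measurable fun q : E × E × E => (q.2.2, q.1))
    have step : δ * ∫⁻ z, ((∫⁻ w, a w * f w z ∂τ) - ∫⁻ w, b w * f w z ∂τ) ∂τ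
        ≤ ∫⁻ w, ∫⁻ w', a w * b w' * (g w + g w') ∂τ ∂τ := by
      have hm : Measurable fun z => (∫⁻ w, a w * f w z ∂τ) - ∫⁻ w, b w * f w z ∂τ := by
        refine Measurable.sub ?_ ?_
        · exact Measurable.lintegral_prod_right' (f := fun q : E × E => a q.2 * f q.2 q.1)
            ((ha.comp measurable_snd).mul (hf.comp measurable_swap))
        · exact Measurable.lintegral_prod_right' (f := fun q : E × E => b q.2 * f q.2 q.1)
            ((hb.comp measurable_snd).mul (hf.comp measurable_swap))
      rw [← lintegral_const_mul _ hm]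
      refine (lintegral_mono key).trans ?_
      have hF1 : Measurable fun q : E × E =>
          ∫⁻ w', a q.2 * b w' * (f q.2 q.1 - f w' q.1) ∂τ :=
        Measurable.lintegral_prod_right' (f := fun r : (E × E) × E =>
          a r.1.2 * b r.2 * (f r.1.2 r.1.1 - f r.2 r.1.1))
          (hF.comp (by fun_prop : Measurable fun r : (E × E) × E => (r.1.1, r.1.2, r.2)))
      rw [lintegral_lintegral_swap hF1.aemeasurable]
      refine lintegral_mono_ae ?_
      filter_upwards [hs] with w hw
      rw [lintegral_lintegral_swap]
      · refine lintegral_mono_ae ?_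
        filter_upwards [hs] with w' hw'
        rw [lintegral_const_mul]
        · gcongr
          exact hfg w hw w' hw'
        · exact (hf.comp measurable_prodMk_left).sub (hf.comp measurable_prodMk_left)
      · exact (hF.comp (by fun_prop : Measurable fun r : E × E => (r.1, w, r.2))).aemeasurable
    have rhs : ∫⁻ w, ∫⁻ w', a w * b w' * (g w + g w') ∂τ ∂τ
        = δ * ((∫⁻ w, a w * g w ∂τ) + ∫⁻ w, b w * g w ∂τ) := by
      have : ∀ w, ∫⁻ w', a w * b w' * (g w + g w') ∂τ
          = a w * g w * δ + a w * ∫⁻ w', b w' * g w' ∂τ := by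
        intro w
        have : ∀ w', a w * b w' * (g w + g w') = a w * g w * b w' + a w * (b w' * g w') :=
          fun w' => by ring
        simp_rw [this]
        rw [lintegral_add_left (hb.const_mul _), lintegral_const_mul _ hb, hbd,
          lintegral_const_mul _ (by fun_prop)]
      simp_rw [this]
      rw [lintegral_add_left (by fun_prop), lintegral_mul_const _ (by fun_prop),
        lintegral_mul_const _ ha, ← hδ]
      ring
    rw [rhs] at step
    exact (ENNReal.mul_le_mul_iff_right h0 hfin).1 step

/-- The one-step contraction `hc` is weighted by `W` and the conclusion is unweighted, but its right
side is again of the form `g x + g y` with `g = r ^ (m + 1) * W`. This lets `lintegral_sub_mix_le`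
feed it back into `hc`. -/
lemma lintegral_sub_kerIter_le (hk : Measurable (Function.uncurry k)) {s : Set E}
    (hs : ∀ᵐ x ∂τ, x ∈ s) (hk1 : ∀ x ∈ s, ∫⁻ z, k x z ∂τ = 1)
    {W : E → ℝ≥0∞} (hW : Measurable W) (hW1 : ∀ x, 1 ≤ W x) {r : ℝ≥0∞}
    (hc : ∀ x ∈ s, ∀ y ∈ s,
      ∫⁻ w, ((k x w - k y w) + (k y w - k x w)) * W w ∂τ ≤ r * (W x + W y)) (m : ℕ) :
    ∀ x ∈ s, ∀ y ∈ s,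
      ∫⁻ z, (kerIter τ k m x z - kerIter τ k m y z) ∂τ ≤ r ^ (m + 1) * (W x + W y) := by
  induction m with
  | zero =>
    intro x hx y hy
    rw [zero_add, pow_one]
    refine le_trans (lintegral_mono fun w => ?_) (hc x hx y hy)
    calc k x w - k y w ≤ ((k x w - k y w) + (k y w - k x w)) * 1 := by
          rw [mul_one]; exact le_self_add
      _ ≤ _ := by gcongr; exact hW1 w
  | succ m ih =>
    intro x hx y hy
    have hkx : ∀ x, Measurable (k x) := fun x => hk.comp measurable_prodMk_left
    have hI := measurable_kerIter (τ := τ) hk m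
    have hIz : ∀ z, Measurable fun w => kerIter τ k m w z :=
      fun z => hI.comp measurable_prodMk_right
    have ha : Measurable fun w => k x w - k y w := (hkx x).sub (hkx y)
    have hb : Measurable fun w => k y w - k x w := (hkx y).sub (hkx x)
    have hab := lintegral_sub_eq_of_density (hkx x) (hkx y) (hk1 x hx) (hk1 y hy)
    have hfin : ∫⁻ w, (k x w - k y w) ∂τ ≠ ∞ := by
      refine ne_top_of_le_ne_top ENNReal.one_ne_top ?_
      rw [← hk1 x hx]
      exact lintegral_mono fun w => tsub_le_self
    have main := lintegral_sub_mix_le hI ha hb hab hfin (hW.const_mul (r ^ (m + 1))) hs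
      (fun w hw w' hw' => (ih w hw w' hw').trans_eq (mul_add _ _ _))
    -- The part `min (k x) (k y)` common to both first steps contributes equally to both iterates
    -- and cancels; only the two excess parts, of equal mass, remain.
    have dec : ∀ x y z, kerIter τ k (m + 1) x z
        = (∫⁻ w, (k x w - k y w) * kerIter τ k m w z ∂τ)
          + ∫⁻ w, min (k x w) (k y w) * kerIter τ k m w z ∂τ := by
      intro x y z
      have h1 := hkx x
      have h2 := hkx y
      have h3 := hIz z
      rw [← lintegral_add_left (by fun_prop)]
      change ∫⁻ w, k x w * kerIter τ k m w z ∂τ = _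
      refine lintegral_congr fun w => ?_
      rw [← add_mul, tsub_add_min]
    calc ∫⁻ z, (kerIter τ k (m + 1) x z - kerIter τ k (m + 1) y z) ∂τ
        ≤ ∫⁻ z, ((∫⁻ w, (k x w - k y w) * kerIter τ k m w z ∂τ)
            - ∫⁻ w, (k y w - k x w) * kerIter τ k m w z ∂τ) ∂τ := by
          refine lintegral_mono fun z => ?_
          rw [dec x y z, dec y x z]
          simp_rw [min_comm (k y _)]
          exact add_tsub_add_le_tsub_right
      _ ≤ _ := main
      _ = r ^ (m + 1) * ∫⁻ w, ((k x w - k y w) + (k y w - k x w)) * W w ∂τ := by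
          have h1 := hkx x
          have h2 := hkx y
          rw [← lintegral_add_left (by fun_prop), ← lintegral_const_mul _ (by fun_prop)]
          refine lintegral_congr fun w => ?_
          ring
      _ ≤ r ^ (m + 1) * (r * (W x + W y)) := by gcongr; exact hc x hx y hy
      _ = _ := by ring

end Harris

/-! ### One-step contraction in weighted total variation -/

section Drift

variable {E : Type*} [MeasurableSpace E] {τ : Measure E} {k : E → E → ℝ≥0∞}

lemma exists_contraction (hk : Measurable (Function.uncurry k)) {s : Set E}
    (hk1 : ∀ x ∈ s, ∫⁻ z, k x z ∂τ = 1) {V : E → ℝ≥0} (hV : Measurable V) {γ K : ℝ≥0}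
    (hγ : γ < 1) (hdrift : ∀ x ∈ s, ∫⁻ z, k x z * V z ∂τ ≤ γ * V x + K)
    (hmin : ∀ R : ℝ≥0, ∃ ε : ℝ≥0, 0 < ε ∧ ∃ q : E → ℝ≥0∞, Measurable q ∧ ∫⁻ z, q z ∂τ = 1 ∧
      ∀ x ∈ s, V x ≤ R → ∀ z, ε * q z ≤ k x z) :
    ∃ β r : ℝ≥0, 0 < β ∧ r < 1 ∧ ∀ x ∈ s, ∀ y ∈ s,
      ∫⁻ w, ((k x w - k y w) + (k y w - k x w)) * ((1 + β * V w : ℝ≥0) : ℝ≥0∞) ∂τ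
        ≤ r * (((1 + β * V x : ℝ≥0) : ℝ≥0∞) + ((1 + β * V y : ℝ≥0) : ℝ≥0∞)) := by
  have hγ' : (γ : ℝ) < 1 := by exact_mod_cast hγ
  -- Above level `R` the drift gain `(1 - γ)(V x + V y)` is at least `4(K + 1)`. The weight `β` is
  -- so small that the drift constants cost `2βK = ε - 2β`, less than the mass `2ε` gained from
  -- minorization. The rate `1 - η` has to work in both regimes.
  set R : ℝ := 4 * (K + 1) / (1 - γ) with hR
  have hRnn : 0 ≤ R := by have : 0 < 1 - (γ : ℝ) := by linarith
                          positivity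
  obtain ⟨ε, hε, q, hq, hq1, hqk⟩ := hmin R.toNNReal
  set β : ℝ≥0 := ε / (2 * (K + 1)) with hβ
  have hβpos : 0 < β := by positivity
  have hβK : (β : ℝ) * (K + 1) = ε / 2 := by
    rw [hβ]; push_cast; field_simp
  set η : ℝ := min β ((1 - γ) / 4) with hη
  have hη0 : 0 < η := lt_min (by exact_mod_cast hβpos) (by linarith)
  have hηβ : η ≤ β := min_le_left _ _
  have hηγ : η ≤ (1 - γ) / 4 := min_le_right _ _
  have hγ0 : (0 : ℝ) ≤ γ := γ.2
  have hr0 : 0 ≤ 1 - η := by linarith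
  obtain ⟨r, hr⟩ : ∃ r : ℝ≥0, (r : ℝ) = 1 - η := ⟨⟨1 - η, hr0⟩, rfl⟩
  refine ⟨β, r, hβpos, by
    rw [← NNReal.coe_lt_coe, hr, NNReal.coe_one]; linarith, fun x hx y hy => ?_⟩
  have hkx : ∀ x, Measurable (k x) := fun x => hk.comp measurable_prodMk_left
  have h1 := hkx x
  have h2 := hkx y
  have hWm : ∀ x ∈ s, ∫⁻ w, k x w * ((1 + β * V w : ℝ≥0) : ℝ≥0∞) ∂τ
      ≤ ((1 + β * (γ * V x + K) : ℝ≥0) : ℝ≥0∞) := by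
    intro x hx
    have h1 := hkx x
    have : ∀ w, k x w * ((1 + β * V w : ℝ≥0) : ℝ≥0∞) = k x w + β * (k x w * V w) := by
      intro w; push_cast; ring
    simp_rw [this]
    rw [lintegral_add_left h1, lintegral_const_mul _ (by fun_prop), hk1 x hx]
    push_cast
    gcongr
    exact hdrift x hx
  set T := ∫⁻ w, ((k x w - k y w) + (k y w - k x w)) * ((1 + β * V w : ℝ≥0) : ℝ≥0∞) ∂τ with hT
  -- Pointwise `|a - b| + 2 min a b = a + b`: any overlap of the two kernels is subtracted twice
  -- from the drift bound.
  have hsum : T + 2 * ∫⁻ w, min (k x w) (k y w) * ((1 + β * V w : ℝ≥0) : ℝ≥0∞) ∂τ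
      ≤ ((1 + β * (γ * V x + K) : ℝ≥0) : ℝ≥0∞) + ((1 + β * (γ * V y + K) : ℝ≥0) : ℝ≥0∞) := by
    refine le_trans (le_of_eq ?_) (add_le_add (hWm x hx) (hWm y hy))
    rw [hT, ← lintegral_const_mul _ (by fun_prop), ← lintegral_add_left (by fun_prop),
      ← lintegral_add_left (by fun_prop)]
    refine lintegral_congr fun w => ?_
    have e1 : k x w - k y w + min (k x w) (k y w) = k x w := tsub_add_min
    have e2 : k y w - k x w + min (k x w) (k y w) = k y w := by rw [min_comm]; exact tsub_add_min
    conv_rhs => rw [← e1, ← e2]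
    ring_nf
    simp only [e2]
    ring_nf
  have hTtop : T ≠ ∞ := ne_top_of_le_ne_top (by finiteness) (le_self_add.trans hsum)
  lift T to ℝ≥0 using hTtop with t
  have hS0 : (0 : ℝ) ≤ V x + V y := by positivity
  have hβr : (0 : ℝ) < β := by exact_mod_cast hβpos
  suffices (t : ℝ) ≤ (1 - η) * (1 + β * V x + (1 + β * V y)) by
    have h3 : t ≤ r * ((1 + β * V x) + (1 + β * V y)) := by
      rw [← NNReal.coe_le_coe]; push_cast; rw [hr]; exact this
    exact_mod_cast h3
  -- For small `V x + V y` both kernels contain `ε q` and the overlap gives the contraction; for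
  -- large values the drift alone suffices.
  by_cases hcase : (V x : ℝ) + V y ≤ R
  · have hle : ∀ x ∈ s, (V x : ℝ) ≤ R → ∀ z, ε * q z ≤ k x z := fun x hx h z =>
      hqk x hx (NNReal.le_toNNReal_of_coe_le h) z
    have hx' := hle x hx (by linarith [(V y).2])
    have hy' := hle y hy (by linarith [(V x).2])
    have : (ε : ℝ≥0∞) ≤ ∫⁻ w, min (k x w) (k y w) * ((1 + β * V w : ℝ≥0) : ℝ≥0∞) ∂τ := by
      calc (ε : ℝ≥0∞) = ∫⁻ w, ε * q w ∂τ := by rw [lintegral_const_mul _ hq, hq1, mul_one]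
        _ ≤ _ := by
          refine lintegral_mono fun w => ?_
          calc ε * q w ≤ min (k x w) (k y w) * 1 := by rw [mul_one]; exact le_min (hx' w) (hy' w)
            _ ≤ _ := by
              gcongr
              exact_mod_cast le_self_add
    have h3 : (t : ℝ≥0∞) + 2 * ε ≤ _ := (by gcongr : _ ≤ _).trans hsum
    have h4 : t + 2 * ε ≤ (1 + β * (γ * V x + K)) + (1 + β * (γ * V y + K)) := by
      exact_mod_cast h3
    have h5 : (t : ℝ) + 2 * ε ≤ (1 + β * (γ * V x + K)) + (1 + β * (γ * V y + K)) := by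
      exact_mod_cast h4
    have h6 : (γ : ℝ) * (β * (V x + V y)) ≤ (1 - η) * (β * (V x + V y)) := by
      gcongr
      linarith
    nlinarith
  · have h3 : (t : ℝ≥0∞) ≤ _ := le_self_add.trans hsum
    have h4 : t ≤ (1 + β * (γ * V x + K)) + (1 + β * (γ * V y + K)) := by
      exact_mod_cast h3
    have h5 : (t : ℝ) ≤ (1 + β * (γ * V x + K)) + (1 + β * (γ * V y + K)) := by
      exact_mod_cast h4
    push Not at hcase
    have h6 : 4 * ((K : ℝ) + 1) ≤ (1 - γ) * (V x + V y) := by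
      rw [hR, div_lt_iff₀ (by linarith)] at hcase
      linarith
    have h7 : β * (4 * ((K : ℝ) + 1)) ≤ β * ((1 - γ) * (V x + V y)) := by gcongr
    have h8 : (η : ℝ) * (β * (V x + V y)) ≤ (1 - γ) / 4 * (β * (V x + V y)) := by
      gcongr
    have h9 : (0 : ℝ) ≤ β * K := by positivity
    nlinarith

end Drift

/-! ### Integrability of the invariant density, and convergence to it -/

section Invariant

variable {E : Type*} [MeasurableSpace E] {τ : Measure E} [SFinite τ] {k : E → E → ℝ≥0∞}

lemma lintegral_mul_kerIter (hk : Measurable (Function.uncurry k)) {f : E → ℝ≥0∞}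
    (hf : Measurable f) (hinv : ∀ᵐ z ∂τ, ∫⁻ x, f x * k x z ∂τ = f z) (m : ℕ) :
    ∀ᵐ z ∂τ, ∫⁻ x, f x * kerIter τ k m x z ∂τ = f z := by
  induction m with
  | zero => exact hinv
  | succ m ih =>
    filter_upwards [ih] with z hz
    have hI := measurable_kerIter (τ := τ) hk m
    have hkx : ∀ x, Measurable (k x) := fun x => hk.comp measurable_prodMk_left
    have hkz : ∀ z, Measurable fun x => k x z := fun x => hk.comp measurable_prodMk_right
    have hIz : Measurable fun w => kerIter τ k m w z := hI.comp measurable_prodMk_right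
    calc ∫⁻ x, f x * kerIter τ k (m + 1) x z ∂τ
        = ∫⁻ x, ∫⁻ w, f x * (k x w * kerIter τ k m w z) ∂τ ∂τ := by
          refine lintegral_congr fun x => ?_
          have := hkx x
          rw [lintegral_const_mul _ (by fun_prop)]
          rfl
      _ = ∫⁻ w, ∫⁻ x, f x * (k x w * kerIter τ k m w z) ∂τ ∂τ := by
          refine lintegral_lintegral_swap (Measurable.aemeasurable ?_)
          exact (hf.comp measurable_fst).mul (hk.mul (hIz.comp measurable_snd))
      _ = ∫⁻ w, f w * kerIter τ k m w z ∂τ := by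
          refine lintegral_congr_ae ?_
          filter_upwards [hinv] with w hw
          have := hkz w
          simp_rw [← mul_assoc]
          rw [lintegral_mul_const _ (by fun_prop), hw]
      _ = f z := hz

/-- Under drift and minorization, an invariant density that is finite almost everywhere is
integrable. -/
lemma lintegral_lt_top_of_invariant (hk : Measurable (Function.uncurry k)) {s : Set E}
    (hs : ∀ᵐ x ∂τ, x ∈ s) (hk1 : ∀ x ∈ s, ∫⁻ z, k x z ∂τ = 1) {V : E → ℝ≥0} (hV : Measurable V)
    {γ K : ℝ≥0} (hγ : γ < 1) (hdrift : ∀ x ∈ s, ∫⁻ z, k x z * V z ∂τ ≤ γ * V x + K)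
    (hmin : ∀ R : ℝ≥0, ∃ ε : ℝ≥0, 0 < ε ∧ ∃ q : E → ℝ≥0∞, Measurable q ∧ ∫⁻ z, q z ∂τ = 1 ∧
      ∀ x ∈ s, V x ≤ R → ∀ z, ε * q z ≤ k x z)
    [SigmaFinite τ] {f : E → ℝ≥0∞} (hf : Measurable f) (hfin : ∀ x, f x ≠ ∞)
    (hinv : ∀ᵐ z ∂τ, ∫⁻ x, f x * k x z ∂τ = f z) :
    ∫⁻ x, f x ∂τ < ∞ := by
  have hkx : ∀ x, Measurable (k x) := fun x => hk.comp measurable_prodMk_left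
  -- `K'` is the fixed point of `v ↦ γ v + K`, so `m` steps of drift bound the mean of `V` by `γ ^ m
  -- * V x + K' * (1 - γ ^ m)`.
  set K' : ℝ≥0 := K / (1 - γ) with hK'
  have h1γ : 0 < 1 - γ := tsub_pos_of_lt hγ
  obtain ⟨ε, hε, q, hq, hq1, hqk⟩ := hmin (2 * (1 + K'))
  have : SigmaFinite (τ.withDensity f) :=
    SigmaFinite.withDensity_of_ne_top' hfin
  -- The measure with density `f` is σ-finite because `f` is finite; some set of an exhaustion by
  -- sets of finite `f`-mass must be charged by `q`.
  obtain ⟨n, hn⟩ : ∃ n, ∫⁻ z in spanningSets (τ.withDensity f) n, q z ∂τ ≠ 0 := by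
    by_contra! hcon
    have h0 : (τ.withDensity q) univ = 0 := by
      rw [← iUnion_spanningSets (τ.withDensity f)]
      refine measure_iUnion_null fun n => ?_
      rw [withDensity_apply _ (measurableSet_spanningSets _ _)]
      exact hcon n
    rw [withDensity_apply _ MeasurableSet.univ, Measure.restrict_univ, hq1] at h0
    exact one_ne_zero h0
  set A := spanningSets (τ.withDensity f) n with hA
  have hAm : MeasurableSet A := measurableSet_spanningSets _ _
  have hfA : ∫⁻ z in A, f z ∂τ < ∞ := by
    rw [← withDensity_apply _ hAm]
    exact measure_spanningSets_lt_top _ _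
  set qA := ∫⁻ z in A, q z ∂τ with hqA
  have hqA1 : qA ≤ 1 := by rw [← hq1]; exact setLIntegral_le_lintegral _ _
  have hqAt : qA ≠ ∞ := ne_top_of_le_ne_top ENNReal.one_ne_top hqA1
  set c : ℝ≥0∞ := ε * qA with hc
  have hc0 : c ≠ 0 := mul_ne_zero (by exact_mod_cast hε.ne') hn
  have hct : c ≠ ∞ := ENNReal.mul_ne_top ENNReal.coe_ne_top hqAt
  -- the probabilities of hitting `A`
  let u : ℕ → E → ℝ≥0∞ := fun m => Nat.rec (fun x => ∫⁻ z in A, k x z ∂τ)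
    (fun _ v x => ∫⁻ w, k x w * v w ∂τ) m
  have hu0 : ∀ x, u 0 x = ∫⁻ z in A, k x z ∂τ := fun x => rfl
  have hus : ∀ m x, u (m + 1) x = ∫⁻ w, k x w * u m w ∂τ := fun m x => rfl
  have hum : ∀ m, Measurable (u m) := by
    intro m
    induction m with
    | zero => exact hk.lintegral_prod_right'
    | succ m ih => exact (hk.mul (ih.comp measurable_snd)).lintegral_prod_right'
  have hfu : ∀ m, ∫⁻ x, f x * u m x ∂τ = ∫⁻ z in A, f z ∂τ := by
    intro m
    induction m with
    | zero =>
      calc ∫⁻ x, f x * u 0 x ∂τ = ∫⁻ x, ∫⁻ z in A, f x * k x z ∂τ ∂τ := by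
            refine lintegral_congr fun x => ?_
            rw [lintegral_const_mul _ (hkx x), hu0]
        _ = ∫⁻ z in A, ∫⁻ x, f x * k x z ∂τ ∂τ :=
            lintegral_lintegral_swap ((hf.comp measurable_fst).mul hk).aemeasurable
        _ = _ := lintegral_congr_ae (ae_restrict_of_ae hinv)
    | succ m ih =>
      rw [← ih]
      have hm := hum m
      calc ∫⁻ x, f x * u (m + 1) x ∂τ = ∫⁻ x, ∫⁻ w, f x * (k x w * u m w) ∂τ ∂τ := by
            refine lintegral_congr fun x => ?_
            have := hkx x
            rw [lintegral_const_mul _ (by fun_prop), hus]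
        _ = ∫⁻ w, ∫⁻ x, f x * (k x w * u m w) ∂τ ∂τ := by
            refine lintegral_lintegral_swap (Measurable.aemeasurable ?_)
            exact (hf.comp measurable_fst).mul (hk.mul (hm.comp measurable_snd))
        _ = _ := by
            refine lintegral_congr_ae ?_
            filter_upwards [hinv] with w hw
            have : Measurable fun x => k x w := hk.comp measurable_prodMk_right
            simp_rw [← mul_assoc]
            rw [lintegral_mul_const _ (by fun_prop), hw]
  set R : ℝ≥0 := 2 * (1 + K') with hR
  have hRpos : 0 < R := by positivity
  -- After `m` steps the chain is in `{V ≤ R}` except with probability at most `E[V] / R` (Markov's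
  -- inequality), and from there the next step enters `A` with probability at least `c = ε qA`. The
  -- error is kept on the right because subtraction is truncated.
  have hlow : ∀ m, ∀ x ∈ s, c ≤ u m x + c * ((γ ^ m * V x + K' * (1 - γ ^ m)) / R : ℝ≥0) := by
    intro m
    induction m with
    | zero =>
      intro x hx
      by_cases hxR : V x ≤ R
      · refine le_trans ?_ le_self_add
        rw [hu0, hc, hqA, ← lintegral_const_mul _ hq]
        exact lintegral_mono fun z => hqk x hx hxR z
      · refine le_trans ?_ le_add_self
        conv_lhs => rw [← mul_one c]
        gcongr
        push Not at hxR
        have : (1 : ℝ≥0) ≤ (γ ^ 0 * V x + K' * (1 - γ ^ 0)) / R := by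
          rw [one_le_div hRpos]; simpa using hxR.le
        exact_mod_cast this
    | succ m ih =>
      intro x hx
      have hm := hum m
      have h1 := hkx x
      calc c = ∫⁻ w, k x w * c ∂τ := by
            rw [lintegral_mul_const _ h1, hk1 x hx, one_mul]
        _ ≤ ∫⁻ w, k x w * (u m w + c * ((γ ^ m * V w + K' * (1 - γ ^ m)) / R : ℝ≥0)) ∂τ := by
            refine lintegral_mono_ae ?_
            filter_upwards [hs] with w hw
            gcongr
            exact ih w hw
        _ = u (m + 1) x + c * ((γ ^ m / R : ℝ≥0) * (∫⁻ w, k x w * V w ∂τ)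
              + (K' * (1 - γ ^ m) / R : ℝ≥0)) := by
            have : ∀ w, k x w * (u m w + c * ((γ ^ m * V w + K' * (1 - γ ^ m)) / R : ℝ≥0))
                = k x w * u m w + (c * ((γ ^ m / R : ℝ≥0) * (k x w * V w))
                  + c * (K' * (1 - γ ^ m) / R : ℝ≥0) * k x w) := by
              intro w
              rw [add_div, mul_div_right_comm]
              push_cast
              ring
            simp_rw [this]
            rw [lintegral_add_left (by fun_prop), lintegral_add_left (by fun_prop),
              lintegral_const_mul _ (by fun_prop), lintegral_const_mul _ (by fun_prop),
              lintegral_const_mul _ (by fun_prop), hk1 x hx, hus]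
            ring
        _ ≤ u (m + 1) x + c * ((γ ^ m / R : ℝ≥0) * (γ * V x + K)
              + (K' * (1 - γ ^ m) / R : ℝ≥0)) := by
            gcongr
            exact hdrift x hx
        _ = _ := by
            congr 2
            norm_cast
            have hK : K = K' * (1 - γ) := by rw [hK', div_mul_cancel₀ _ h1γ.ne']
            have hp1 : γ ^ m ≤ 1 := pow_le_one₀ (zero_le) hγ.le
            have hp2 : γ ^ (m + 1) ≤ 1 := pow_le_one₀ (zero_le) hγ.le
            rw [hK, ← NNReal.coe_inj]
            push_cast [NNReal.coe_sub hp1, NNReal.coe_sub hp2, NNReal.coe_sub hγ.le]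
            ring
  -- For fixed `N` and `m` large, `u m ≥ c / 2` on `{V ≤ N}`, since `R = 2(1 + K')`. As `∫ f * u m`
  -- equals the `f`-mass of `A` for every `m`, the bound obtained does not depend on `N`.
  have hball : ∀ N : ℕ, ∫⁻ x in {x | V x ≤ N}, f x ∂τ ≤ (∫⁻ z in A, f z ∂τ) / (c / 2) := by
    intro N
    obtain ⟨m, hm⟩ : ∃ m : ℕ, γ ^ m * N ≤ 1 := by
      obtain ⟨m, hm⟩ := exists_pow_lt_of_lt_one (show (0 : ℝ≥0) < 1 / (N + 1) by positivity) hγ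
      refine ⟨m, ?_⟩
      rw [lt_div_iff₀ (by positivity)] at hm
      refine le_trans ?_ hm.le
      gcongr
      exact le_self_add
    have hms : MeasurableSet {x | V x ≤ (N : ℝ≥0)} := measurableSet_le hV measurable_const
    rw [ENNReal.le_div_iff_mul_le (Or.inl (ENNReal.div_ne_zero.2 ⟨hc0, by simp⟩))
      (Or.inl (ENNReal.div_ne_top hct two_ne_zero)), ← lintegral_mul_const _ hf, ← hfu m]
    refine le_trans (lintegral_mono_ae ?_) (setLIntegral_le_lintegral {x | V x ≤ (N : ℝ≥0)} _)
    filter_upwards [ae_restrict_of_ae hs, ae_restrict_mem hms] with x hx hxN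
    gcongr
    have h1 := hlow m x hx
    have h2 : (γ ^ m * V x + K' * (1 - γ ^ m)) / R ≤ 1 / 2 := by
      rw [div_le_iff₀ hRpos, hR]
      calc γ ^ m * V x + K' * (1 - γ ^ m) ≤ γ ^ m * N + K' * 1 := by
            gcongr
            exact tsub_le_self
        _ ≤ 1 + K' := by rw [mul_one]; gcongr
        _ = 1 / 2 * (2 * (1 + K')) := by ring
    have h3 : c ≤ u m x + c / 2 := by
      refine h1.trans ?_
      gcongr
      rw [ENNReal.div_eq_inv_mul, mul_comm]
      gcongr
      calc (((γ ^ m * V x + K' * (1 - γ ^ m)) / R : ℝ≥0) : ℝ≥0∞) ≤ ((1 / 2 : ℝ≥0) : ℝ≥0∞) := by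
            exact_mod_cast h2
        _ = 2⁻¹ := by
            rw [one_div, ENNReal.coe_inv two_ne_zero]; rfl
    have h4 : c / 2 + c / 2 ≤ u m x + c / 2 := by rwa [ENNReal.add_halves]
    exact (ENNReal.add_le_add_iff_right (ENNReal.div_ne_top hct two_ne_zero)).1 h4
  have huniv : (τ.withDensity f) univ ≤ (∫⁻ z in A, f z ∂τ) / (c / 2) := by
    have hmono : Monotone fun N : ℕ => {x | V x ≤ (N : ℝ≥0)} := by
      intro a b hab x hx
      exact (show V x ≤ a from hx).trans (by exact_mod_cast hab)
    have hU : (⋃ N : ℕ, {x | V x ≤ (N : ℝ≥0)}) = univ := by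
      refine eq_univ_of_forall fun x => ?_
      obtain ⟨N, hN⟩ := exists_nat_ge (V x)
      exact mem_iUnion.2 ⟨N, hN⟩
    rw [← hU, hmono.measure_iUnion]
    refine iSup_le fun N => ?_
    rw [withDensity_apply _ (measurableSet_le hV measurable_const)]
    exact hball N
  rw [withDensity_apply _ MeasurableSet.univ, Measure.restrict_univ] at huniv
  refine lt_of_le_of_lt huniv (ENNReal.div_lt_top hfA.ne ?_)
  exact ENNReal.div_ne_zero.2 ⟨hc0, by simp⟩

/-- Under drift, the drift function is integrable against a finite invariant density. -/
lemma lintegral_mul_drift_lt_top (hk : Measurable (Function.uncurry k)) {s : Set E}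
    (hs : ∀ᵐ x ∂τ, x ∈ s) (hk1 : ∀ x ∈ s, ∫⁻ z, k x z ∂τ = 1) {V : E → ℝ≥0} (hV : Measurable V)
    {γ K : ℝ≥0} (hγ : γ < 1) (hdrift : ∀ x ∈ s, ∫⁻ z, k x z * V z ∂τ ≤ γ * V x + K)
    {f : E → ℝ≥0∞} (hf : Measurable f) (hfin : ∫⁻ x, f x ∂τ < ∞)
    (hinv : ∀ᵐ z ∂τ, ∫⁻ x, f x * k x z ∂τ = f z) :
    ∫⁻ x, f x * V x ∂τ < ∞ := by
  have hkx : ∀ x, Measurable (k x) := fun x => hk.comp measurable_prodMk_left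
  have h1γ : 0 < 1 - γ := tsub_pos_of_lt hγ
  set F := ∫⁻ x, f x ∂τ with hF
  have htrunc : ∀ N : ℕ, ((1 - γ : ℝ≥0) : ℝ≥0∞) * ∫⁻ x in {x | V x ≤ N}, f x * V x ∂τ
      ≤ K * F := by
    intro N
    -- Truncating `V` at `N` makes `I` finite, so that it can be cancelled after invariance and
    -- drift are applied.
    set I := ∫⁻ x, f x * ((min (V x) N : ℝ≥0) : ℝ≥0∞) ∂τ with hI
    have hIfin : I ≠ ∞ := by
      refine ne_top_of_le_ne_top (ENNReal.mul_ne_top hfin.ne (ENNReal.natCast_ne_top N)) ?_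
      rw [hF, ← lintegral_mul_const _ hf]
      refine lintegral_mono fun x => ?_
      gcongr
      exact (ENNReal.coe_le_coe.2 (min_le_right _ _)).trans_eq (by simp)
    have hI2 : I ≤ ∫⁻ x, f x * ((min (γ * V x + K) N : ℝ≥0) : ℝ≥0∞) ∂τ := by
      calc I = ∫⁻ z, ∫⁻ x, f x * k x z * ((min (V z) N : ℝ≥0) : ℝ≥0∞) ∂τ ∂τ := by
            refine lintegral_congr_ae ?_
            filter_upwards [hinv] with z hz
            have : Measurable fun x => k x z := hk.comp measurable_prodMk_right
            rw [lintegral_mul_const _ (by fun_prop), hz]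
        _ = ∫⁻ x, ∫⁻ z, f x * k x z * ((min (V z) N : ℝ≥0) : ℝ≥0∞) ∂τ ∂τ := by
            refine lintegral_lintegral_swap (Measurable.aemeasurable ?_)
            refine Measurable.mul ?_ ?_
            · exact (hf.comp measurable_snd).mul (hk.comp measurable_swap)
            · exact ((hV.min measurable_const).coe_nnreal_ennreal).comp measurable_fst
        _ ≤ _ := by
            refine lintegral_mono_ae ?_
            filter_upwards [hs] with x hx
            have h1 := hkx x
            simp_rw [mul_assoc]
            rw [lintegral_const_mul _ (by fun_prop)]
            gcongr
            rw [ENNReal.coe_min]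
            refine le_min ?_ ?_
            · refine le_trans (lintegral_mono fun z => ?_) ((hdrift x hx).trans_eq (by push_cast; rfl))
              gcongr
              exact min_le_left _ _
            · calc ∫⁻ z, k x z * ((min (V z) N : ℝ≥0) : ℝ≥0∞) ∂τ ≤ ∫⁻ z, k x z * (N : ℝ≥0) ∂τ := by
                    refine lintegral_mono fun z => ?_
                    gcongr
                    exact min_le_right _ _
                _ = _ := by rw [lintegral_mul_const _ h1, hk1 x hx, one_mul]
    have hms : MeasurableSet {x | V x ≤ (N : ℝ≥0)} := measurableSet_le hV measurable_const
    have hpt : ∀ x, f x * ((min (γ * V x + K) N : ℝ≥0) : ℝ≥0∞)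
          + ((1 - γ : ℝ≥0) : ℝ≥0∞) * ({x | V x ≤ (N : ℝ≥0)}.indicator (fun x => f x * V x) x)
        ≤ f x * ((min (V x) N : ℝ≥0) : ℝ≥0∞) + K * f x := by
      intro x
      by_cases hx : V x ≤ (N : ℝ≥0)
      · rw [indicator_of_mem (by exact hx), min_eq_left hx]
        calc _ ≤ f x * ((γ * V x + K : ℝ≥0) : ℝ≥0∞) + ((1 - γ : ℝ≥0) : ℝ≥0∞) * (f x * V x) := by
              gcongr; exact min_le_left _ _
          _ = f x * (((γ + (1 - γ)) * V x + K : ℝ≥0) : ℝ≥0∞) := by push_cast; ring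
          _ = _ := by
              rw [add_tsub_cancel_of_le hγ.le]; push_cast; ring
      · rw [indicator_of_notMem (by exact hx), min_eq_right (not_le.1 hx).le, mul_zero, add_zero]
        refine le_trans ?_ le_self_add
        gcongr
        exact min_le_right _ _
    have h3 := lintegral_mono (μ := τ) hpt
    rw [lintegral_add_left (by fun_prop), lintegral_add_left (by fun_prop),
      lintegral_const_mul _ ((by fun_prop : Measurable fun x => f x * V x).indicator hms),
      lintegral_indicator hms, lintegral_const_mul _ hf] at h3
    have h4 := (add_le_add_left hI2 _).trans h3
    exact (ENNReal.add_le_add_iff_left hIfin).1 h4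
  have hle : (τ.withDensity fun x => f x * V x) univ ≤ K * F / ((1 - γ : ℝ≥0) : ℝ≥0∞) := by
    have hmono : Monotone fun N : ℕ => {x | V x ≤ (N : ℝ≥0)} := by
      intro a b hab x hx
      exact (show V x ≤ a from hx).trans (by exact_mod_cast hab)
    have hU : (⋃ N : ℕ, {x | V x ≤ (N : ℝ≥0)}) = univ := by
      refine eq_univ_of_forall fun x => ?_
      obtain ⟨N, hN⟩ := exists_nat_ge (V x)
      exact mem_iUnion.2 ⟨N, hN⟩
    rw [← hU, hmono.measure_iUnion]
    refine iSup_le fun N => ?_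
    rw [withDensity_apply _ (measurableSet_le hV measurable_const),
      ENNReal.le_div_iff_mul_le (Or.inl (by exact_mod_cast h1γ.ne')) (Or.inl ENNReal.coe_ne_top),
      mul_comm]
    exact htrunc N
  rw [withDensity_apply _ MeasurableSet.univ, Measure.restrict_univ] at hle
  refine lt_of_le_of_lt hle (ENNReal.div_lt_top (ENNReal.mul_ne_top ENNReal.coe_ne_top hfin.ne) ?_)
  exact_mod_cast h1γ.ne'

/-- Harris' theorem: a transition density satisfying a geometric drift condition and
minorization on the sublevel sets of the drift function converges geometrically fast, in `L¹`,
to its normalized invariant density. -/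
theorem exists_geometric_bound (hk : Measurable (Function.uncurry k)) {s : Set E}
    (hs : ∀ᵐ x ∂τ, x ∈ s) (hk1 : ∀ x ∈ s, ∫⁻ z, k x z ∂τ = 1) {V : E → ℝ≥0} (hV : Measurable V)
    {γ K : ℝ≥0} (hγ : γ < 1) (hdrift : ∀ x ∈ s, ∫⁻ z, k x z * V z ∂τ ≤ γ * V x + K)
    (hmin : ∀ R : ℝ≥0, ∃ ε : ℝ≥0, 0 < ε ∧ ∃ q : E → ℝ≥0∞, Measurable q ∧ ∫⁻ z, q z ∂τ = 1 ∧
      ∀ x ∈ s, V x ≤ R → ∀ z, ε * q z ≤ k x z)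
    {f : E → ℝ≥0∞} (hf : Measurable f) (hfin : ∫⁻ x, f x ∂τ < ∞) (hf0 : ∫⁻ x, f x ∂τ ≠ 0)
    (hinv : ∀ᵐ z ∂τ, ∫⁻ x, f x * k x z ∂τ = f z) :
    ∃ (M : E → ℝ≥0) (ρ : ℝ≥0), ρ < 1 ∧ ∀ m, ∀ x ∈ s,
      ∫⁻ z, ((kerIter τ k m x z - f z / ∫⁻ x, f x ∂τ)
        + (f z / (∫⁻ x, f x ∂τ) - kerIter τ k m x z)) ∂τ ≤ ((M x * ρ ^ (m + 1) : ℝ≥0) : ℝ≥0∞) := by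
  obtain ⟨β, r, hβ, hr, hcon⟩ := exists_contraction hk hk1 hV hγ hdrift hmin
  set W : E → ℝ≥0∞ := fun w => ((1 + β * V w : ℝ≥0) : ℝ≥0∞) with hW
  have hWm : Measurable W := by fun_prop
  have hD := lintegral_sub_kerIter_le hk hs hk1 hWm
    (fun x => by simp only [hW]; exact_mod_cast le_self_add) hcon
  set F := ∫⁻ x, f x ∂τ with hF
  set p : E → ℝ≥0∞ := fun z => f z / F with hp
  have hpm : Measurable p := hf.div_const _
  have hp1 : ∫⁻ z, p z ∂τ = 1 := by
    simp only [hp, div_eq_mul_inv]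
    rw [lintegral_mul_const _ hf, ← hF]
    exact ENNReal.mul_inv_cancel hf0 hfin.ne
  have hpinv : ∀ᵐ z ∂τ, ∫⁻ x, p x * k x z ∂τ = p z := by
    filter_upwards [hinv] with z hz
    have : Measurable fun x => k x z := hk.comp measurable_prodMk_right
    simp only [hp, div_eq_mul_inv, mul_right_comm _ F⁻¹]
    rw [lintegral_mul_const _ (by fun_prop), hz]
  have hPV := lintegral_mul_drift_lt_top hk hs hk1 hV hγ hdrift hpm
    (by rw [hp1]; exact ENNReal.one_lt_top) hpinv
  have hPW : ∫⁻ x, p x * W x ∂τ ≠ ∞ := by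
    have : ∀ x, p x * W x = p x + β * (p x * V x) := by
      intro x; simp only [hW]; push_cast; ring
    simp_rw [this]
    rw [lintegral_add_left hpm, lintegral_const_mul _ (by fun_prop), hp1]
    exact ENNReal.add_ne_top.2 ⟨ENNReal.one_ne_top, ENNReal.mul_ne_top ENNReal.coe_ne_top hPV.ne⟩
  set B : ℝ≥0 := (∫⁻ x, p x * W x ∂τ).toNNReal with hB
  have hBc : (B : ℝ≥0∞) = ∫⁻ x, p x * W x ∂τ := ENNReal.coe_toNNReal hPW
  refine ⟨fun x => 2 * (1 + β * V x + B), r, hr, fun m x hx => ?_⟩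
  have hI := measurable_kerIter (τ := τ) hk m
  have hIx : Measurable (kerIter τ k m x) := hI.comp measurable_prodMk_left
  have hIz : ∀ z, Measurable fun y => kerIter τ k m y z :=
    fun z => hI.comp measurable_prodMk_right
  have hpk := lintegral_mul_kerIter hk hpm hpinv m
  have hWs : ∫⁻ y, p y * (W x + W y) ∂τ = ((1 + β * V x + B : ℝ≥0) : ℝ≥0∞) := by
    simp_rw [mul_add]
    rw [lintegral_add_left (by fun_prop), lintegral_mul_const _ hpm, hp1, ← hBc, one_mul]
    push_cast [hW]
    rfl
  -- By invariance `p` is the `p`-average of the densities `kerIter τ k m y`, so the distance to `p`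
  -- is at most the average over `y` of the distances between two starting points.
  have hup : ∫⁻ z, (kerIter τ k m x z - p z) ∂τ
      ≤ r ^ (m + 1) * ((1 + β * V x + B : ℝ≥0) : ℝ≥0∞) := by
    calc ∫⁻ z, (kerIter τ k m x z - p z) ∂τ
        ≤ ∫⁻ z, ∫⁻ y, p y * (kerIter τ k m x z - kerIter τ k m y z) ∂τ ∂τ := by
          refine lintegral_mono_ae ?_
          filter_upwards [hpk] with z hz
          have := hIz z
          have e : kerIter τ k m x z = ∫⁻ y, p y * kerIter τ k m x z ∂τ := by
            rw [lintegral_mul_const _ hpm, hp1, one_mul]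
          rw [← hz]
          conv_lhs => rw [e]
          refine (lintegral_sub_le _ _ (by fun_prop)).trans (lintegral_mono fun y => ?_)
          rw [tsub_le_iff_right, ← mul_add]
          gcongr
          exact le_tsub_add
      _ = ∫⁻ y, ∫⁻ z, p y * (kerIter τ k m x z - kerIter τ k m y z) ∂τ ∂τ := by
          refine lintegral_lintegral_swap (Measurable.aemeasurable ?_)
          exact (hpm.comp measurable_snd).mul ((hIx.comp measurable_fst).sub
            (hI.comp measurable_swap))
      _ ≤ ∫⁻ y, p y * (r ^ (m + 1) * (W x + W y)) ∂τ := by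
          refine lintegral_mono_ae ?_
          filter_upwards [hs] with y hy
          have : Measurable (kerIter τ k m y) := hI.comp measurable_prodMk_left
          rw [lintegral_const_mul _ (by fun_prop)]
          gcongr
          exact hD m x hx y hy
      _ = _ := by
          simp_rw [mul_left_comm (p _)]
          rw [lintegral_const_mul _ (by fun_prop), hWs]
  have hdown : ∫⁻ z, (p z - kerIter τ k m x z) ∂τ
      ≤ r ^ (m + 1) * ((1 + β * V x + B : ℝ≥0) : ℝ≥0∞) := by
    calc ∫⁻ z, (p z - kerIter τ k m x z) ∂τ
        ≤ ∫⁻ z, ∫⁻ y, p y * (kerIter τ k m y z - kerIter τ k m x z) ∂τ ∂τ := by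
          refine lintegral_mono_ae ?_
          filter_upwards [hpk] with z hz
          have := hIz z
          have e : kerIter τ k m x z = ∫⁻ y, p y * kerIter τ k m x z ∂τ := by
            rw [lintegral_mul_const _ hpm, hp1, one_mul]
          rw [← hz]
          conv_lhs => rw [e]
          refine (lintegral_sub_le _ _ (by fun_prop)).trans (lintegral_mono fun y => ?_)
          rw [tsub_le_iff_right, ← mul_add]
          gcongr
          exact le_tsub_add
      _ = ∫⁻ y, ∫⁻ z, p y * (kerIter τ k m y z - kerIter τ k m x z) ∂τ ∂τ := by
          refine lintegral_lintegral_swap (Measurable.aemeasurable ?_)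
          exact (hpm.comp measurable_snd).mul ((hI.comp measurable_swap).sub
            (hIx.comp measurable_fst))
      _ ≤ ∫⁻ y, p y * (r ^ (m + 1) * (W x + W y)) ∂τ := by
          refine lintegral_mono_ae ?_
          filter_upwards [hs] with y hy
          have : Measurable (kerIter τ k m y) := hI.comp measurable_prodMk_left
          rw [lintegral_const_mul _ (by fun_prop)]
          gcongr
          rw [add_comm (W x)]
          exact hD m y hy x hx
      _ = _ := by
          simp_rw [mul_left_comm (p _)]
          rw [lintegral_const_mul _ (by fun_prop), hWs]
  rw [lintegral_add_left (f := fun z => kerIter τ k m x z - f z / F) (by fun_prop)]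
  refine (add_le_add hup hdown).trans_eq ?_
  push_cast
  ring

end Invariant

/-! ### Gaussian and inverse Wishart integrals -/

lemma lintegral_fin_prod_eq_prod {n : ℕ} {μ : Measure ℝ} [SigmaFinite μ]
    (f : Fin n → ℝ → ℝ≥0∞) (hf : ∀ i, Measurable (f i)) :
    ∫⁻ x : Fin n → ℝ, ∏ i, f i (x i) ∂(Measure.pi fun _ => μ) = ∏ i, ∫⁻ x, f i x ∂μ := by
  induction n with
  | zero => simp [lintegral_unique]
  | succ n ih =>
    rw [← (measurePreserving_piFinSuccAbove (fun _ : Fin (n + 1) => μ) 0).symm.lintegral_comp_emb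
      (MeasurableEquiv.measurableEmbedding _), Fin.prod_univ_succ, ← ih _ fun i => hf _]
    have h2 : Measurable fun y : Fin n → ℝ => ∏ i, f i.succ (y i) :=
      Finset.measurable_prod _ fun i _ => (hf _).comp (measurable_pi_apply i)
    rw [← lintegral_prod_mul (hf 0).aemeasurable h2.aemeasurable]
    refine lintegral_congr fun q => ?_
    rw [Fin.prod_univ_succ]
    simp [MeasurableEquiv.piFinSuccAbove_symm_apply, Fin.insertNthEquiv]

lemma lintegral_fintype_prod_eq_prod {ι : Type*} [Fintype ι] {μ : Measure ℝ} [SigmaFinite μ]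
    (f : ι → ℝ → ℝ≥0∞) (hf : ∀ i, Measurable (f i)) :
    ∫⁻ x : ι → ℝ, ∏ i, f i (x i) ∂(Measure.pi fun _ => μ) = ∏ i, ∫⁻ x, f i x ∂μ := by
  let e := (Fintype.equivFin ι).symm
  rw [← (measurePreserving_piCongrLeft _ e).lintegral_comp_emb
    (MeasurableEquiv.measurableEmbedding _)]
  simp_rw [← e.prod_comp, MeasurableEquiv.coe_piCongrLeft, Equiv.piCongrLeft_apply_apply,
    lintegral_fin_prod_eq_prod _ (fun i => hf _)]

/-- Turns integrals over matrices into integrals over vectors indexed by pairs, where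
`lintegral_gaussian` applies. -/
lemma measurePreserving_uncurry (ι κ : Type*) [Fintype ι] [Fintype κ] :
    MeasurePreserving (fun (f : ι → κ → ℝ) (q : ι × κ) => f q.1 q.2) := by
  have hm : Measurable (fun (f : ι → κ → ℝ) (q : ι × κ) => f q.1 q.2) := by fun_prop
  refine ⟨hm, ?_⟩
  refine (Measure.pi_eq fun s hs => ?_).symm
  rw [Measure.map_apply hm (MeasurableSet.univ_pi hs)]
  have : (fun (f : ι → κ → ℝ) (q : ι × κ) => f q.1 q.2) ⁻¹' (univ.pi s)
      = univ.pi fun i => univ.pi fun j => s (i, j) := by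
    ext f
    simp [Set.mem_pi]
  rw [this, volume_pi_pi]
  simp_rw [volume_pi_pi]
  rw [Fintype.prod_prod_type]

lemma lintegral_comp_mulVec {ι : Type*} [Fintype ι] [DecidableEq ι] {B : Matrix ι ι ℝ}
    (hB : B.det ≠ 0) {f : (ι → ℝ) → ℝ≥0∞} (hf : Measurable f) :
    ∫⁻ x, f (B *ᵥ x) = ENNReal.ofReal |B.det⁻¹| * ∫⁻ x, f x := by
  have h := Real.map_matrix_volume_pi_eq_smul_volume_pi hB
  have hm : Measurable (Matrix.toLin' B) :=
    (LinearMap.continuous_on_pi (Matrix.toLin' B)).measurable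
  rw [← smul_eq_mul, ← lintegral_smul_measure, ← h, lintegral_map hf hm]
  rfl

lemma exists_eq_transpose_mul_self {ι : Type*} [Fintype ι] [DecidableEq ι] {P : Matrix ι ι ℝ}
    (hP : P.PosSemidef) : ∃ B : Matrix ι ι ℝ, P = Bᵀ * B := by
  open scoped MatrixOrder ComplexOrder in
  obtain ⟨B, hB⟩ := CStarAlgebra.nonneg_iff_eq_star_mul_self.1 hP.nonneg
  exact ⟨B, by rw [hB, Matrix.star_eq_conjTranspose, Matrix.conjTranspose_eq_transpose_of_trivial]⟩

lemma lintegral_exp_neg_half_sq :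
    ∫⁻ x : ℝ, ENNReal.ofReal (Real.exp (-(1 / 2) * x ^ 2)) = ENNReal.ofReal (√(2 * Real.pi)) := by
  rw [← ofReal_integral_eq_lintegral_ofReal (integrable_exp_neg_mul_sq (by norm_num))
    (Filter.Eventually.of_forall fun x => (Real.exp_pos _).le), integral_gaussian]
  congr 2
  ring

/-- The Gaussian integral with precision matrix `P`. -/
lemma lintegral_gaussian {ι : Type*} [Fintype ι] [DecidableEq ι] {P : Matrix ι ι ℝ}
    (hP : P.PosDef) (θ : ι → ℝ) :
    ∫⁻ b : ι → ℝ, ENNReal.ofReal (Real.exp (-(1 / 2) * ((b - θ) ⬝ᵥ (P *ᵥ (b - θ)))))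
      = ENNReal.ofReal ((2 * Real.pi) ^ ((Fintype.card ι : ℝ) / 2) * P.det ^ (-(1 / 2) : ℝ)) := by
  -- With `P = Bᵀ B` the substitution `x = B b` turns the form into a sum of squares, at the cost of
  -- the Jacobian `|det B|⁻¹ = (det P)^(-1/2)`.
  obtain ⟨B, hB⟩ := exists_eq_transpose_mul_self hP.posSemidef
  have hdet : P.det = B.det ^ 2 := by rw [hB, Matrix.det_mul, Matrix.det_transpose, sq]
  have hBdet : B.det ≠ 0 := by
    intro h0
    have := hP.det_pos
    rw [hdet, h0] at this
    norm_num at this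
  rw [lintegral_sub_right_eq_self
    (fun b : ι → ℝ => ENNReal.ofReal (Real.exp (-(1 / 2) * (b ⬝ᵥ (P *ᵥ b))))) θ]
  have hq : ∀ b : ι → ℝ, b ⬝ᵥ (P *ᵥ b) = ∑ i, (B *ᵥ b) i ^ 2 := by
    intro b
    rw [hB, ← Matrix.mulVec_mulVec, Matrix.dotProduct_mulVec, Matrix.vecMul_transpose]
    simp [dotProduct, sq]
  have hprod : ∀ x : ι → ℝ, ENNReal.ofReal (Real.exp (-(1 / 2) * ∑ i, x i ^ 2))
      = ∏ i, ENNReal.ofReal (Real.exp (-(1 / 2) * x i ^ 2)) := by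
    intro x
    rw [Finset.mul_sum, Real.exp_sum, ENNReal.ofReal_prod_of_nonneg]
    exact fun i _ => (Real.exp_pos _).le
  simp_rw [hq]
  rw [lintegral_comp_mulVec (f := fun x => ENNReal.ofReal (Real.exp (-(1 / 2) * ∑ i, x i ^ 2)))
    hBdet (by fun_prop)]
  simp_rw [hprod]
  rw [volume_pi, lintegral_fintype_prod_eq_prod (fun _ x => ENNReal.ofReal (Real.exp (-(1 / 2) * x ^ 2)))
    (fun _ => by fun_prop)]
  simp_rw [lintegral_exp_neg_half_sq]
  rw [Finset.prod_const, ← ENNReal.ofReal_pow (Real.sqrt_nonneg _), ← ENNReal.ofReal_mul (abs_nonneg _)]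
  congr 1
  rw [hdet, mul_comm]
  congr 1
  · rw [Real.sqrt_eq_rpow, ← Real.rpow_mul_natCast (by positivity), Finset.card_univ]
    congr 1; ring
  · rw [Real.rpow_neg (sq_nonneg _), ← Real.sqrt_eq_rpow, Real.sqrt_sq_eq_abs, abs_inv]

/-- The matrix normal law is a Gaussian on vectors whose precision matrix is a Kronecker product;
its determinant then comes from `Matrix.det_kronecker`. -/
lemma trace_mul_mul_mul_transpose {r c : ℕ} (A : Matrix (Fin r) (Fin r) ℝ)
    (B : Matrix (Fin c) (Fin c) ℝ) (hB : B.IsHermitian) (z : Matrix (Fin r) (Fin c) ℝ) :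
    (A * z * B * zᵀ).trace = (fun q : Fin r × Fin c => z q.1 q.2) ⬝ᵥ
      ((Matrix.kroneckerMap (· * ·) A B) *ᵥ fun q => z q.1 q.2) := by
  have hs : ∀ i j, B i j = B j i := fun i j => by
    have := hB.apply i j; simpa using this.symm
  simp only [Matrix.trace, Matrix.diag, Matrix.mul_apply, dotProduct, Matrix.mulVec,
    Matrix.kroneckerMap_apply, Fintype.sum_prod_type, Matrix.transpose_apply, Finset.sum_mul,
    Finset.mul_sum]
  refine Finset.sum_congr rfl fun i _ => Finset.sum_congr rfl fun j _ => ?_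
  rw [Finset.sum_comm]
  refine Finset.sum_congr rfl fun k _ => Finset.sum_congr rfl fun l _ => ?_
  rw [hs j l]
  ring

/-- The matrix normal density integrates to one. -/
lemma lintegral_matrixNormalDensity {r c : ℕ} (θ : Matrix (Fin r) (Fin c) ℝ)
    {A : Matrix (Fin r) (Fin r) ℝ} (hA : A.PosDef) {B : Matrix (Fin c) (Fin c) ℝ}
    (hB : B.PosDef) :
    ∫⁻ b : Fin r → Fin c → ℝ, ENNReal.ofReal (matrixNormalDensity θ A B (Matrix.of b)) = 1 := by
  have hAd := hA.det_pos
  have hBd := hB.det_pos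
  have hK := hA.inv.kronecker hB.inv
  set N : ℝ := (2 * Real.pi) ^ ((r : ℝ) * c / 2) * A.det ^ ((c : ℝ) / 2) * B.det ^ ((r : ℝ) / 2)
    with hN
  have hNpos : 0 < N := by positivity
  set g : (Fin r × Fin c → ℝ) → ℝ≥0∞ := fun q : Fin r × Fin c → ℝ => ENNReal.ofReal (Real.exp (-(1 / 2) *
            ((q - fun q => θ q.1 q.2) ⬝ᵥ ((Matrix.kroneckerMap (· * ·) A⁻¹ B⁻¹) *ᵥ
              (q - fun q => θ q.1 q.2))))) with hg
  have h1 : ∀ b : Fin r → Fin c → ℝ, ENNReal.ofReal (matrixNormalDensity θ A B (Matrix.of b))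
      = ENNReal.ofReal N⁻¹ * g (fun q => b q.1 q.2) := by
    intro b
    rw [← ENNReal.ofReal_mul (by positivity), matrixNormalDensity, ← hN,
      trace_mul_mul_mul_transpose _ _ hB.inv.isHermitian, div_eq_inv_mul]
    rfl
  have hm : Measurable g := by
    simp only [hg, dotProduct, Matrix.mulVec]
    fun_prop
  simp_rw [h1]
  have hm' : Measurable fun b : Fin r → Fin c → ℝ => g fun q => b q.1 q.2 :=
    hm.comp (measurePreserving_uncurry _ _).measurable
  rw [lintegral_const_mul _ hm',
    (measurePreserving_uncurry _ _).lintegral_comp hm, lintegral_gaussian hK,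
    ← ENNReal.ofReal_mul (by positivity), ← ENNReal.ofReal_one]
  congr 1
  rw [inv_mul_eq_one₀ hNpos.ne', hN, Matrix.det_kronecker, Matrix.det_nonsing_inv,
    Matrix.det_nonsing_inv, Ring.inverse_eq_inv']
  simp only [Fintype.card_prod, Fintype.card_fin, Nat.cast_mul]
  rw [mul_assoc, Real.mul_rpow (x := A.det⁻¹ ^ c) (by positivity) (by positivity),
    ← Real.rpow_natCast_mul (by positivity), ← Real.rpow_natCast_mul (by positivity)]
  congr 2
  · rw [Real.inv_rpow hAd.le, ← Real.rpow_neg hAd.le]; congr 1; ring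
  · rw [Real.inv_rpow hBd.le, ← Real.rpow_neg hBd.le]; congr 1; ring

/-- This is the Gamma integral after the substitution `s ↦ 1/s`. -/
lemma lintegral_inverse_gamma {κ b : ℝ} (hκ : 0 < κ) (hb : 0 < b) :
    ∫⁻ s in Ioi (0 : ℝ), ENNReal.ofReal (s ^ (-(κ + 1)) * Real.exp (-(b / s)))
      = ENNReal.ofReal (b ^ (-κ) * Real.Gamma κ) := by
  have h1 := integral_comp_rpow_Ioi (fun y : ℝ => y ^ (κ - 1) * Real.exp (-(b * y)))
    (show (-1 : ℝ) ≠ 0 by norm_num)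
  rw [Real.integral_rpow_mul_exp_neg_mul_Ioi hκ hb] at h1
  have h2 : ∫ s in Ioi (0 : ℝ), s ^ (-(κ + 1)) * Real.exp (-(b / s))
      = b ^ (-κ) * Real.Gamma κ := by
    rw [Real.rpow_neg hb.le, ← Real.inv_rpow hb.le, ← one_div, ← h1]
    refine setIntegral_congr_fun measurableSet_Ioi fun s (hs : 0 < s) => ?_
    simp only [smul_eq_mul, Real.rpow_neg_one, abs_neg, abs_one, one_mul]
    rw [← mul_assoc, Real.inv_rpow hs.le, ← Real.rpow_neg hs.le, ← Real.rpow_add hs]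
    congr 2
    ring
  have hpos : 0 < b ^ (-κ) * Real.Gamma κ := by
    have := Real.Gamma_pos_of_pos hκ
    positivity
  -- A non-integrable function has Bochner integral 0, whereas the value `h2` is positive.
  have hint : IntegrableOn (fun s : ℝ => s ^ (-(κ + 1)) * Real.exp (-(b / s))) (Ioi 0) := by
    by_contra hcon
    rw [integral_undef hcon] at h2
    exact hpos.ne h2
  rw [← h2, ofReal_integral_eq_lintegral_ofReal hint]
  filter_upwards [ae_restrict_mem measurableSet_Ioi] with s (hs : 0 < s)
  positivity

/-! ### Bordered symmetric matrices and Schur complements -/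

/-- The entries on and above the diagonal of a `(d + 1) × (d + 1)` matrix, with those of the last
column split off. -/
def upperSplit (d : ℕ) : Upper d ⊕ (Fin d ⊕ Unit) ≃ Upper (d + 1) :=
  Equiv.ofBijective
    (Sum.elim (fun q => ⟨(q.1.1.castSucc, q.1.2.castSucc), q.2⟩)
      (Sum.elim (fun i => ⟨(i.castSucc, Fin.last d), Fin.le_last _⟩)
        (fun _ => ⟨(Fin.last d, Fin.last d), le_rfl⟩))) (by
    constructor
    · rintro (⟨⟨i, j⟩, hij⟩ | i | _) (⟨⟨k, l⟩, hkl⟩ | k | _) h <;>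
        simp_all [Fin.ext_iff] <;> omega
    · rintro ⟨⟨i, j⟩, hij⟩
      induction j using Fin.lastCases with
      | last =>
        induction i using Fin.lastCases with
        | last => exact ⟨Sum.inr (Sum.inr ()), rfl⟩
        | cast i => exact ⟨Sum.inr (Sum.inl i), rfl⟩
      | cast j =>
        induction i using Fin.lastCases with
        | last => exact absurd hij (by simp [Fin.le_def])
        | cast i => exact ⟨Sum.inl ⟨(i, j), hij⟩, rfl⟩)

/-- The upper entries of the symmetric matrix with leading block `symMat v`, last column `b` and
corner `c`. -/
def borderUpper {d : ℕ} (v : Upper d → ℝ) (b : Fin d → ℝ) (c : ℝ) : Upper (d + 1) → ℝ :=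
  fun q => Sum.elim v (Sum.elim b fun _ => c) ((upperSplit d).symm q)

lemma borderUpper_split {d : ℕ} (v : Upper d → ℝ) (b : Fin d → ℝ) (c : ℝ)
    (q : Upper d ⊕ (Fin d ⊕ Unit)) :
    borderUpper v b c (upperSplit d q) = Sum.elim v (Sum.elim b fun _ => c) q := by
  simp [borderUpper]

lemma measurePreserving_borderUpper (d : ℕ) :
    MeasurePreserving (fun q : (Upper d → ℝ) × (Fin d → ℝ) × ℝ => borderUpper q.1 q.2.1 q.2.2) := by
  have hm : Measurable
      (fun q : (Upper d → ℝ) × (Fin d → ℝ) × ℝ => borderUpper q.1 q.2.1 q.2.2) := by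
    refine measurable_pi_lambda _ fun q => ?_
    obtain ⟨q, rfl⟩ := (upperSplit d).surjective q
    simp_rw [borderUpper_split]
    rcases q with q | i | _ <;> simp only [Sum.elim_inl, Sum.elim_inr] <;> fun_prop
  refine ⟨hm, ?_⟩
  refine (Measure.pi_eq fun s hs => ?_).symm
  rw [Measure.map_apply hm (MeasurableSet.univ_pi hs)]
  have : (fun q : (Upper d → ℝ) × (Fin d → ℝ) × ℝ => borderUpper q.1 q.2.1 q.2.2) ⁻¹' (univ.pi s)
      = (univ.pi fun i => s (upperSplit d (Sum.inl i))) ×ˢ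
        ((univ.pi fun i => s (upperSplit d (Sum.inr (Sum.inl i)))) ×ˢ
          s (upperSplit d (Sum.inr (Sum.inr ())))) := by
    ext ⟨v, b, c⟩
    simp only [mem_preimage, mem_pi, mem_univ, mem_prod, Unique.forall_iff,
      (upperSplit d).surjective.forall, borderUpper_split, Sum.forall, Sum.elim_inl, Sum.elim_inr]
  rw [this, Measure.volume_eq_prod, Measure.prod_prod, Measure.volume_eq_prod, Measure.prod_prod,
    volume_pi_pi, volume_pi_pi, ← (upperSplit d).prod_comp, Fintype.prod_sum_type,
    Fintype.prod_sum_type]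
  simp

/-- The symmetric matrix with blocks `A`, `b`, `bᵀ`, `c`. -/
def border {d : ℕ} (A : Matrix (Fin d) (Fin d) ℝ) (b : Fin d → ℝ) (c : ℝ) :
    Matrix (Fin d ⊕ Fin 1) (Fin d ⊕ Fin 1) ℝ :=
  Matrix.fromBlocks A (Matrix.replicateCol (Fin 1) b) (Matrix.replicateRow (Fin 1) b)
    (Matrix.of fun _ _ => c)

lemma symMat_borderUpper {d : ℕ} (v : Upper d → ℝ) (b : Fin d → ℝ) (c : ℝ) :
    symMat (borderUpper v b c) = (border (symMat v) b c).submatrix finSumFinEquiv.symm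
      finSumFinEquiv.symm := by
  have key : (symMat (borderUpper v b c)).submatrix finSumFinEquiv finSumFinEquiv
      = border (symMat v) b c := by
    ext i j
    rcases i with i | i <;> rcases j with j | j
    · exact borderUpper_split v b c (Sum.inl ⟨(min i j, max i j), min_le_max⟩)
    · have h := borderUpper_split v b c (Sum.inr (Sum.inl i))
      have hj : j = 0 := Subsingleton.elim _ _
      subst hj
      simp only [Matrix.submatrix_apply, finSumFinEquiv_apply_left, finSumFinEquiv_apply_right,
        symMat, Matrix.of_apply, border, Matrix.fromBlocks_apply₁₂, Matrix.replicateCol_apply]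
      rw [← (show _ = b i from h)]
      congr 1
      ext <;> simp [upperSplit, Fin.natAdd, Fin.last]
    · have h := borderUpper_split v b c (Sum.inr (Sum.inl j))
      have hj : i = 0 := Subsingleton.elim _ _
      subst hj
      simp only [Matrix.submatrix_apply, finSumFinEquiv_apply_left, finSumFinEquiv_apply_right,
        symMat, Matrix.of_apply, border, Matrix.fromBlocks_apply₂₁, Matrix.replicateRow_apply]
      rw [← (show _ = b j from h)]
      congr 1
      ext <;> simp [upperSplit, Fin.natAdd, Fin.last]
    · have h := borderUpper_split v b c (Sum.inr (Sum.inr ()))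
      have hj : i = 0 := Subsingleton.elim _ _
      have hj : j = 0 := Subsingleton.elim _ _
      subst i j
      simp only [Matrix.submatrix_apply, finSumFinEquiv_apply_right,
        symMat, Matrix.of_apply, border, Matrix.fromBlocks_apply₂₂]
      rw [← (show _ = c from h)]
      congr 1
      ext <;> simp [upperSplit, Fin.natAdd, Fin.last]
  rw [← key]
  simp

lemma exists_eq_border {d : ℕ} {Ψ : Matrix (Fin (d + 1)) (Fin (d + 1)) ℝ} (h : Ψ.IsHermitian) :
    ∃ (A : Matrix (Fin d) (Fin d) ℝ) (b : Fin d → ℝ) (c : ℝ),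
      Ψ = (border A b c).submatrix finSumFinEquiv.symm finSumFinEquiv.symm := by
  refine ⟨Ψ.submatrix (Fin.castAdd 1) (Fin.castAdd 1), fun i => Ψ (Fin.castAdd 1 i) (Fin.natAdd d 0),
    Ψ (Fin.natAdd d 0) (Fin.natAdd d 0), ?_⟩
  have key : Ψ.submatrix finSumFinEquiv finSumFinEquiv
      = border (Ψ.submatrix (Fin.castAdd 1) (Fin.castAdd 1))
        (fun i => Ψ (Fin.castAdd 1 i) (Fin.natAdd d 0)) (Ψ (Fin.natAdd d 0) (Fin.natAdd d 0)) := by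
    ext i j
    rcases i with i | i <;> rcases j with j | j
    · rfl
    · rw [Subsingleton.elim j 0]; rfl
    · rw [Subsingleton.elim i 0]
      exact (h.apply (Fin.natAdd d 0) (Fin.castAdd 1 j)).symm
    · rw [Subsingleton.elim i 0, Subsingleton.elim j 0]; rfl
  rw [← key]
  simp

variable {d : ℕ} {A : Matrix (Fin d) (Fin d) ℝ}

lemma border_schur (b : Fin d → ℝ) :
    Matrix.replicateRow (Fin 1) b * A⁻¹ * Matrix.replicateCol (Fin 1) b
      = Matrix.of fun _ _ => b ⬝ᵥ (A⁻¹ *ᵥ b) := by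
  ext i j
  rw [Matrix.mul_assoc]
  simp [Matrix.mul_apply, dotProduct, Matrix.mulVec]

lemma det_border (hA : A.PosDef) (b : Fin d → ℝ) (c : ℝ) :
    (border A b c).det = A.det * (c - b ⬝ᵥ (A⁻¹ *ᵥ b)) := by
  have := hA.isUnit.invertible
  rw [border, Matrix.det_fromBlocks₁₁, Matrix.invOf_eq_nonsing_inv, border_schur]
  simp

/-- In the coordinates (leading block, last column, Schur complement) the positive definite cone is
a product, which makes the induction on `d` possible. -/
lemma posDef_border_iff (b : Fin d → ℝ) (c : ℝ) :
    (border A b c).PosDef ↔ A.PosDef ∧ 0 < c - b ⬝ᵥ (A⁻¹ *ᵥ b) := by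
  have hsub : (border A b c).PosDef → A.PosDef := fun h => by
    have := h.submatrix (e := Sum.inl) Sum.inl_injective
    exact this
  refine ⟨fun h => ⟨hsub h, ?_⟩, fun ⟨hA, hc⟩ => ?_⟩
  · have h1 := h.det_pos
    rw [det_border (hsub h)] at h1
    exact (pos_iff_pos_of_mul_pos h1).1 (hsub h).det_pos
  · have := hA.isUnit.invertible
    have hpsd : (border A b c).PosSemidef := by
      have h2 := Matrix.PosDef.fromBlocks₁₁ (Matrix.replicateCol (Fin 1) b)
        (Matrix.of fun _ _ => c : Matrix (Fin 1) (Fin 1) ℝ) hA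
      rw [Matrix.conjTranspose_eq_transpose_of_trivial, Matrix.transpose_replicateCol,
        border_schur] at h2
      refine h2.2 ?_
      have : ((Matrix.of fun _ _ => c : Matrix (Fin 1) (Fin 1) ℝ)
          - Matrix.of fun _ _ => b ⬝ᵥ (A⁻¹ *ᵥ b))
          = Matrix.diagonal fun _ => c - b ⬝ᵥ (A⁻¹ *ᵥ b) := by
        ext i j
        rw [Subsingleton.elim i j]
        simp
      rw [this, Matrix.posSemidef_diagonal_iff]
      exact fun _ => hc.le
    rw [hpsd.posDef_iff_det_ne_zero, det_border hA]
    exact (mul_pos hA.det_pos hc).ne'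

lemma trace_border_mul_inv (hA : A.PosDef) (b : Fin d → ℝ) (c : ℝ)
    (hc : 0 < c - b ⬝ᵥ (A⁻¹ *ᵥ b)) (P : Matrix (Fin d) (Fin d) ℝ) (ψ : Fin d → ℝ) (ω : ℝ) :
    (border P ψ ω * (border A b c)⁻¹).trace = (P * A⁻¹).trace + (c - b ⬝ᵥ (A⁻¹ *ᵥ b))⁻¹ *
      ((A⁻¹ *ᵥ b) ⬝ᵥ (P *ᵥ (A⁻¹ *ᵥ b)) - 2 * (A⁻¹ *ᵥ b) ⬝ᵥ ψ + ω) := by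
  set g := A⁻¹ *ᵥ b with hg
  set s := c - b ⬝ᵥ g with hs
  have hAu : IsUnit A.det := (Matrix.isUnit_iff_isUnit_det A).1 hA.isUnit
  have hAg : ∀ i, ∑ k, A i k * g k = b i := fun i => by
    have : A *ᵥ g = b := by
      rw [hg, Matrix.mulVec_mulVec, Matrix.mul_nonsing_inv _ hAu, Matrix.one_mulVec]
    exact congrFun this i
  have hbA : ∀ j, ∑ k, b k * A⁻¹ k j = g j := fun j => by
    have : b ᵥ* A⁻¹ = g := by
      rw [hg, ← Matrix.vecMul_transpose, Matrix.transpose_nonsing_inv,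
        ← Matrix.conjTranspose_eq_transpose_of_trivial, hA.isHermitian.eq]
    exact congrFun this j
  have hAA : ∀ i j, ∑ k, A i k * A⁻¹ k j = (1 : Matrix (Fin d) (Fin d) ℝ) i j := fun i j => by
    rw [← Matrix.mul_apply, Matrix.mul_nonsing_inv _ hAu]
  have hbg : ∑ k, b k * g k = c - s := by rw [hs]; simp [dotProduct]
  -- The block inverse, with `g = A⁻¹ b` and `s` the Schur complement; it is verified by multiplying
  -- out.
  have hinv : (border A b c)⁻¹ = Matrix.fromBlocks (A⁻¹ + s⁻¹ • Matrix.vecMulVec g g)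
      (Matrix.replicateCol (Fin 1) (-s⁻¹ • g)) (Matrix.replicateRow (Fin 1) (-s⁻¹ • g))
      (Matrix.of fun _ _ => s⁻¹) := by
    refine Matrix.inv_eq_right_inv ?_
    rw [border, Matrix.fromBlocks_multiply, ← Matrix.fromBlocks_one]
    have e1 : ∀ i j, ∑ k, A i k * (A⁻¹ k j + s⁻¹ * (g k * g j))
        = (1 : Matrix (Fin d) (Fin d) ℝ) i j + s⁻¹ * g j * b i := fun i j => by
      simp_rw [← hAg i, mul_add, Finset.sum_add_distrib, hAA, Finset.mul_sum]
      congr 1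
      exact Finset.sum_congr rfl fun k _ => by ring
    have e2 : ∀ j, ∑ k, b k * (A⁻¹ k j + s⁻¹ * (g k * g j)) = g j + s⁻¹ * g j * (c - s) :=
      fun j => by
      simp_rw [← hbg, mul_add, Finset.sum_add_distrib, hbA, Finset.mul_sum]
      congr 1
      exact Finset.sum_congr rfl fun k _ => by ring
    have e3 : ∀ i, ∑ k, A i k * (s⁻¹ * g k) = s⁻¹ * b i := fun i => by
      rw [← hAg i, Finset.mul_sum]
      exact Finset.sum_congr rfl fun k _ => by ring
    have e4 : ∑ k, b k * (s⁻¹ * g k) = s⁻¹ * (c - s) := by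
      rw [← hbg, Finset.mul_sum]
      exact Finset.sum_congr rfl fun k _ => by ring
    congr 1
    · ext i j
      simp [Matrix.mul_apply, Matrix.vecMulVec_apply, e1]
      ring
    · ext i j
      simp [Matrix.mul_apply, e3]
      ring
    · ext i j
      simp [Matrix.mul_apply, Matrix.vecMulVec_apply, e2]
      field_simp
      ring
    · ext i j
      rw [Subsingleton.elim i j]
      simp [Matrix.mul_apply, e4]
      field_simp
      ring
  have htr : ∀ (M₁ : Matrix (Fin d) (Fin d) ℝ) (M₂ : Matrix (Fin d) (Fin 1) ℝ)
      (M₃ : Matrix (Fin 1) (Fin d) ℝ) (M₄ : Matrix (Fin 1) (Fin 1) ℝ),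
      (Matrix.fromBlocks M₁ M₂ M₃ M₄).trace = M₁.trace + M₄.trace := fun M₁ M₂ M₃ M₄ => by
    simp [Matrix.trace]
  rw [hinv, border, Matrix.fromBlocks_multiply, htr, Matrix.mul_add,
    Matrix.trace_add, Matrix.trace_add, Matrix.trace_add, add_assoc]
  have t1 : (P * s⁻¹ • Matrix.vecMulVec g g).trace = s⁻¹ * g ⬝ᵥ (P *ᵥ g) := by
    simp only [Matrix.trace, Matrix.diag, Matrix.mul_apply, Matrix.smul_apply,
      Matrix.vecMulVec_apply, dotProduct, Matrix.mulVec, Finset.mul_sum, smul_eq_mul]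
    exact Finset.sum_congr rfl fun i _ => Finset.sum_congr rfl fun k _ => by ring
  have t2 : (Matrix.replicateCol (Fin 1) ψ * Matrix.replicateRow (Fin 1) (-s⁻¹ • g)).trace
      = -s⁻¹ * g ⬝ᵥ ψ := by
    simp only [Matrix.trace, Matrix.diag, Matrix.mul_apply, dotProduct, Finset.mul_sum]
    simp
    exact Finset.sum_congr rfl fun i _ => by ring
  have t3 : (Matrix.replicateRow (Fin 1) ψ * Matrix.replicateCol (Fin 1) (-s⁻¹ • g)).trace
      = -s⁻¹ * g ⬝ᵥ ψ := by
    simp only [Matrix.trace, Matrix.diag, Matrix.mul_apply, dotProduct, Finset.mul_sum]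
    simp
    exact Finset.sum_congr rfl fun i _ => by ring
  have t4 : ((Matrix.of fun _ _ => ω : Matrix (Fin 1) (Fin 1) ℝ)
      * Matrix.of fun _ _ => s⁻¹).trace = ω * s⁻¹ := by
    simp [Matrix.trace, Matrix.mul_apply]
  rw [t1, t2, t3, t4]
  ring

/-- Completing the square in the last column. -/
lemma quadratic_complete_square {P : Matrix (Fin d) (Fin d) ℝ} (hA : A.PosDef) (hP : P.PosDef)
    (b ψ : Fin d → ℝ) (ω : ℝ) :
    (A⁻¹ *ᵥ b) ⬝ᵥ (P *ᵥ (A⁻¹ *ᵥ b)) - 2 * (A⁻¹ *ᵥ b) ⬝ᵥ ψ + ω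
      = (b - A *ᵥ (P⁻¹ *ᵥ ψ)) ⬝ᵥ ((A⁻¹ * P * A⁻¹) *ᵥ (b - A *ᵥ (P⁻¹ *ᵥ ψ)))
        + (ω - ψ ⬝ᵥ (P⁻¹ *ᵥ ψ)) := by
  have hAu : IsUnit A.det := (Matrix.isUnit_iff_isUnit_det A).1 hA.isUnit
  have hPu : IsUnit P.det := (Matrix.isUnit_iff_isUnit_det P).1 hP.isUnit
  have hAs : (A⁻¹)ᵀ = A⁻¹ := by
    rw [← Matrix.conjTranspose_eq_transpose_of_trivial, hA.inv.isHermitian.eq]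
  have hPs : Pᵀ = P := by
    rw [← Matrix.conjTranspose_eq_transpose_of_trivial, hP.isHermitian.eq]
  set g := A⁻¹ *ᵥ b with hg
  set g₀ := P⁻¹ *ᵥ ψ with hg₀
  have h1 : A⁻¹ *ᵥ (b - A *ᵥ g₀) = g - g₀ := by
    rw [Matrix.mulVec_sub, Matrix.mulVec_mulVec, Matrix.nonsing_inv_mul _ hAu, Matrix.one_mulVec]
  have h2 : P *ᵥ g₀ = ψ := by
    rw [hg₀, Matrix.mulVec_mulVec, Matrix.mul_nonsing_inv _ hPu, Matrix.one_mulVec]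
  rw [← Matrix.mulVec_mulVec, ← Matrix.mulVec_mulVec, h1, Matrix.dotProduct_mulVec _ A⁻¹,
    ← Matrix.mulVec_transpose, hAs, h1, Matrix.mulVec_sub, h2, sub_dotProduct, dotProduct_sub,
    dotProduct_sub, Matrix.dotProduct_mulVec g₀ P, ← Matrix.mulVec_transpose, hPs, h2,
    dotProduct_comm ψ g, dotProduct_comm ψ g₀]
  ring

/-! ### Measurability of the positive definite cone and of matrix operations -/

lemma continuous_symMat (d : ℕ) : Continuous (symMat : (Upper d → ℝ) → Matrix (Fin d) (Fin d) ℝ) :=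
  continuous_matrix fun _ _ => continuous_apply _

lemma isHermitian_symMat {d : ℕ} (v : Upper d → ℝ) : (symMat v).IsHermitian := by
  ext i j
  simp [symMat, min_comm, max_comm]

/-- Positive definite means positive semidefinite, a closed condition, and nonsingular, an open one.
-/
lemma measurableSet_posDef {d : ℕ} : MeasurableSet {v : Upper d → ℝ | (symMat v).PosDef} := by
  have : {v : Upper d → ℝ | (symMat v).PosDef}
      = (⋂ x : Fin d → ℝ, {v | 0 ≤ x ⬝ᵥ (symMat v *ᵥ x)}) ∩ {v | (symMat v).det ≠ 0} := by
    ext v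
    simp only [mem_ofPred_eq, mem_inter_iff, mem_iInter]
    constructor
    · exact fun h => ⟨fun x => by simpa using h.posSemidef.dotProduct_mulVec_nonneg x,
        h.det_pos.ne'⟩
    · rintro ⟨h1, h2⟩
      have : (symMat v).PosSemidef :=
        .of_dotProduct_mulVec_nonneg (isHermitian_symMat v) fun x => by simpa using h1 x
      exact this.posDef_iff_det_ne_zero.2 h2
  rw [this]
  have hc := continuous_symMat d
  refine MeasurableSet.inter (isClosed_iInter fun x => ?_).measurableSet ?_
  · exact isClosed_le continuous_const (by fun_prop)
  · exact (isOpen_ne_fun (by fun_prop) continuous_const).measurableSet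

/-- A matrix-valued function has measurable entries. -/
def MeasurableEntries {α : Type*} [MeasurableSpace α] {ι κ : Type*} (M : α → Matrix ι κ ℝ) : Prop :=
  ∀ i j, Measurable fun x => M x i j

namespace MeasurableEntries

variable {α : Type*} [MeasurableSpace α] {ι κ μ : Type*}

lemma const (N : Matrix ι κ ℝ) : MeasurableEntries fun _ : α => N := fun _ _ => measurable_const

lemma comp {β : Type*} [MeasurableSpace β] {M : β → Matrix ι κ ℝ} (hM : MeasurableEntries M)
    {f : α → β} (hf : Measurable f) : MeasurableEntries fun x => M (f x) :=
  fun i j => (hM i j).comp hf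

lemma transpose {M : α → Matrix ι κ ℝ} (hM : MeasurableEntries M) :
    MeasurableEntries fun x => (M x)ᵀ := fun i j => hM j i

lemma sub {M N : α → Matrix ι κ ℝ} (hM : MeasurableEntries M) (hN : MeasurableEntries N) :
    MeasurableEntries fun x => M x - N x := fun i j => (hM i j).sub (hN i j)

lemma mul [Fintype κ] {M : α → Matrix ι κ ℝ} {N : α → Matrix κ μ ℝ} (hM : MeasurableEntries M)
    (hN : MeasurableEntries N) : MeasurableEntries fun x => M x * N x := fun i j => by
  simp only [Matrix.mul_apply]
  exact Finset.measurable_sum _ fun k _ => (hM _ _).mul (hN _ _)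

lemma trace [Fintype ι] {M : α → Matrix ι ι ℝ} (hM : MeasurableEntries M) :
    Measurable fun x => (M x).trace := by
  simp only [Matrix.trace, Matrix.diag]
  exact Finset.measurable_sum _ fun k _ => hM _ _

variable [Fintype ι] [DecidableEq ι] {M : α → Matrix ι ι ℝ}

lemma det (hM : MeasurableEntries M) : Measurable fun x => (M x).det := by
  simp only [Matrix.det_apply]
  refine Finset.measurable_sum _ fun σ _ => Measurable.const_smul ?_ _
  exact Finset.measurable_prod _ fun i _ => hM _ _

/-- The inverse is the adjugate times the inverse determinant. This formula also holds at singular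
matrices, where both sides are 0, so invertibility is not required. -/
lemma inv (hM : MeasurableEntries M) : MeasurableEntries fun x => (M x)⁻¹ := fun i j => by
  simp only [Matrix.inv_def, Matrix.smul_apply, Ring.inverse_eq_inv', smul_eq_mul,
    Matrix.adjugate_apply]
  refine hM.det.inv.mul (det fun k l => ?_)
  by_cases h : k = j
  · subst h; simp
  · simpa [Matrix.updateRow_ne h] using hM k l

end MeasurableEntries

lemma measurableEntries_symMat {d : ℕ} :
    MeasurableEntries (symMat : (Upper d → ℝ) → Matrix (Fin d) (Fin d) ℝ) :=
  fun _ _ => measurable_pi_apply _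

/-! ### The inverse Wishart integral -/

/-- The unnormalized inverse Wishart density with scale `Ψ⁻¹`, set to zero off the positive definite
matrices. -/
def wishartKernel {d : ℕ} (ν : ℝ) (Ψ S : Matrix (Fin d) (Fin d) ℝ) : ℝ≥0∞ :=
  ENNReal.ofReal (S.det ^ (-((ν + d + 1) / 2)) * Real.exp (-(1 / 2) * (Ψ * S⁻¹).trace))

/-- The normalizing constant of the inverse Wishart distribution. -/
def wishartConst (d : ℕ) (ν : ℝ) : ℝ :=
  (2 : ℝ) ^ (ν * d / 2) * Real.pi ^ ((d : ℝ) * (d - 1) / 4) *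
    ∏ i ∈ Finset.Icc 1 d, Real.Gamma ((ν + 1 - (i : ℝ)) / 2)

lemma wishartConst_pos {d : ℕ} {ν : ℝ} (hν : (d : ℝ) - 1 < ν) : 0 < wishartConst d ν := by
  refine mul_pos (by positivity) (Finset.prod_pos fun i hi => Real.Gamma_pos_of_pos ?_)
  have : (i : ℝ) ≤ d := by exact_mod_cast (Finset.mem_Icc.1 hi).2
  linarith

/-- The extra factor is what one column contributes: `(2π)^(d/2)` from the Gaussian integral over
its off-diagonal entries, and `2^(ν/2) Γ(ν/2)` from the inverse Gamma integral over its Schur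
complement. -/
lemma wishartConst_succ (d : ℕ) (ν : ℝ) :
    wishartConst (d + 1) ν
      = (2 * Real.pi) ^ ((d : ℝ) / 2) * 2 ^ (ν / 2) * Real.Gamma (ν / 2)
        * wishartConst d (ν - 1) := by
  have hprod : ∏ i ∈ Finset.Icc 1 (d + 1), Real.Gamma ((ν + 1 - (i : ℝ)) / 2)
      = Real.Gamma (ν / 2) * ∏ i ∈ Finset.Icc 1 d, Real.Gamma ((ν - 1 + 1 - (i : ℝ)) / 2) := by
    induction d with
    | zero => simp
    | succ d ih =>
      rw [Finset.prod_Icc_succ_top (by omega), ih, Finset.prod_Icc_succ_top (by omega), mul_assoc]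
      congr 4
      push_cast
      ring
  rw [wishartConst, wishartConst, hprod, Real.mul_rpow (by norm_num) Real.pi_pos.le]
  have e1 : (2 : ℝ) ^ (ν * ((d + 1 : ℕ) : ℝ) / 2)
      = 2 ^ ((d : ℝ) / 2) * 2 ^ (ν / 2) * 2 ^ ((ν - 1) * d / 2) := by
    rw [← Real.rpow_add (by norm_num), ← Real.rpow_add (by norm_num)]
    congr 1
    push_cast
    ring
  have e2 : Real.pi ^ (((d + 1 : ℕ) : ℝ) * (((d + 1 : ℕ) : ℝ) - 1) / 4)
      = Real.pi ^ ((d : ℝ) / 2) * Real.pi ^ ((d : ℝ) * (d - 1) / 4) := by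
    rw [← Real.rpow_add Real.pi_pos]
    congr 1
    push_cast
    ring
  rw [e1, e2]
  ring

lemma measurable_wishartKernel {d : ℕ} (ν : ℝ) (Ψ : Matrix (Fin d) (Fin d) ℝ) :
    Measurable fun v : Upper d → ℝ => wishartKernel ν Ψ (symMat v) := by
  have h1 : Measurable fun v : Upper d → ℝ => (symMat v).det :=
    measurableEntries_symMat.det
  have h2 : Measurable fun v : Upper d → ℝ => (Ψ * (symMat v)⁻¹).trace :=
    ((MeasurableEntries.const Ψ).mul measurableEntries_symMat.inv).trace
  unfold wishartKernel
  fun_prop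

/-- Integrating out the last column of a positive definite matrix. -/
lemma lintegral_wishartKernel_border {d : ℕ} {ν : ℝ} (hν : 0 < ν)
    {A P : Matrix (Fin d) (Fin d) ℝ} (hA : A.PosDef) (hP : P.PosDef) (ψ : Fin d → ℝ) {ω : ℝ}
    (hω : 0 < ω - ψ ⬝ᵥ (P⁻¹ *ᵥ ψ)) :
    ∫⁻ b : Fin d → ℝ, ∫⁻ c : ℝ, (Ioi (0 : ℝ)).indicator (fun _ => ENNReal.ofReal
        ((border A b c).det ^ (-((ν + (d + 1 : ℕ) + 1) / 2)) *
          Real.exp (-(1 / 2) * (border P ψ ω * (border A b c)⁻¹).trace)))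
          (c - b ⬝ᵥ (A⁻¹ *ᵥ b))
      = ENNReal.ofReal ((2 * Real.pi) ^ ((d : ℝ) / 2) * P.det ^ (-(1 / 2) : ℝ)
          * (((ω - ψ ⬝ᵥ (P⁻¹ *ᵥ ψ)) / 2) ^ (-(ν / 2)) * Real.Gamma (ν / 2)))
          * wishartKernel (ν - 1) P A := by
  have hAd := hA.det_pos
  have hPd := hP.det_pos
  set ω' := ω - ψ ⬝ᵥ (P⁻¹ *ᵥ ψ) with hω'
  set q : ℝ := (ν + (d + 1 : ℕ) + 1) / 2 with hq
  set θ := A *ᵥ (P⁻¹ *ᵥ ψ) with hθ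
  set H := A⁻¹ * P * A⁻¹ with hH
  set T := Real.exp (-(1 / 2) * (P * A⁻¹).trace) with hT
  have hT0 : 0 < T := Real.exp_pos _
  have hAs : (A⁻¹)ᴴ = A⁻¹ := hA.inv.isHermitian.eq
  have hHpos : H.PosDef := by
    have := hP.mul_mul_conjTranspose_same (B := A⁻¹)
      (Matrix.vecMul_injective_of_isUnit hA.inv.isUnit)
    rwa [hAs] at this
  have hHdet : H.det = P.det / A.det ^ 2 := by
    rw [hH, Matrix.det_mul, Matrix.det_mul, Matrix.det_nonsing_inv, Ring.inverse_eq_inv']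
    field_simp
  -- In terms of the Schur complement `s`, the integrand is an inverse Gamma kernel in `s` times a
  -- Gaussian in `b` with mean `θ` and precision `s⁻¹ H`.
  set G : (Fin d → ℝ) → ℝ → ℝ≥0∞ := fun b s => ENNReal.ofReal (A.det ^ (-q) * T * s ^ (-q)
      * Real.exp (-(ω' / 2 / s))) * ENNReal.ofReal (Real.exp (-(1 / 2) *
        ((b - θ) ⬝ᵥ ((s⁻¹ • H) *ᵥ (b - θ))))) with hG
  have hpt : ∀ (b : Fin d → ℝ) (s : ℝ), (Ioi (0 : ℝ)).indicator (fun _ => ENNReal.ofReal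
        ((border A b (s + b ⬝ᵥ (A⁻¹ *ᵥ b))).det ^ (-q) *
          Real.exp (-(1 / 2) * (border P ψ ω * (border A b (s + b ⬝ᵥ (A⁻¹ *ᵥ b)))⁻¹).trace))) s
      = (Ioi (0 : ℝ)).indicator (G b) s := by
    intro b s
    by_cases hs : 0 < s
    · rw [indicator_of_mem (by exact hs), indicator_of_mem (by exact hs)]
      rw [det_border hA, trace_border_mul_inv hA _ _ (by simpa using hs),
        quadratic_complete_square hA hP, add_sub_cancel_right]
      simp only [hG]
      rw [← ENNReal.ofReal_mul (by positivity), Real.mul_rpow hAd.le hs.le]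
      congr 1
      rw [show A.det ^ (-q) * T * s ^ (-q) * Real.exp (-(ω' / 2 / s)) * Real.exp (-(1 / 2) *
        ((b - θ) ⬝ᵥ ((s⁻¹ • H) *ᵥ (b - θ)))) = A.det ^ (-q) * s ^ (-q) * (T *
          Real.exp (-(ω' / 2 / s)) * Real.exp (-(1 / 2) *
        ((b - θ) ⬝ᵥ ((s⁻¹ • H) *ᵥ (b - θ))))) by ring, hT, ← Real.exp_add, ← Real.exp_add,
        Matrix.smul_mulVec, dotProduct_smul, smul_eq_mul]
      congr 2
      field_simp
      ring
    · rw [indicator_of_notMem (by exact hs), indicator_of_notMem (by exact hs)]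
  have hGm : Measurable (Function.uncurry G) := by
    simp only [hG, Function.uncurry_def, dotProduct, Matrix.mulVec, Matrix.smul_apply, smul_eq_mul]
    fun_prop
  -- The Gaussian integral contributes `s^(d/2)` and one power of `det A`; the latter lowers the
  -- degrees of freedom from `ν` to `ν - 1` in the remaining kernel.
  have hGs : ∀ s, 0 < s → ∫⁻ b, G b s = ENNReal.ofReal (A.det ^ (-q + 1) * T
      * ((2 * Real.pi) ^ ((d : ℝ) / 2) * P.det ^ (-(1 / 2) : ℝ)))
      * ENNReal.ofReal (s ^ (-(ν / 2 + 1)) * Real.exp (-(ω' / 2 / s))) := by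
    intro s hs
    have hsH : (s⁻¹ • H).PosDef := hHpos.smul (inv_pos.2 hs)
    simp only [hG]
    rw [lintegral_const_mul _ (by simp only [dotProduct, Matrix.mulVec]; fun_prop),
      lintegral_gaussian hsH, ← ENNReal.ofReal_mul (by positivity),
      ← ENNReal.ofReal_mul (by positivity)]
    congr 1
    rw [Matrix.det_smul, hHdet, Fintype.card_fin]
    have e1 : ((s⁻¹) ^ d * (P.det / A.det ^ 2)) ^ (-(1 / 2) : ℝ)
        = s ^ ((d : ℝ) / 2) * (P.det ^ (-(1 / 2) : ℝ) * A.det) := by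
      rw [Real.mul_rpow (by positivity) (by positivity), Real.div_rpow hPd.le (by positivity),
        inv_pow, Real.inv_rpow (by positivity), ← Real.rpow_neg (by positivity), neg_neg,
        ← Real.rpow_natCast_mul hs.le, Real.rpow_neg (x := A.det ^ 2) (by positivity),
        ← Real.sqrt_eq_rpow, Real.sqrt_sq hAd.le, div_inv_eq_mul]
      congr 2
      ring
    have e2 : s ^ (-q) * s ^ ((d : ℝ) / 2) = s ^ (-(ν / 2 + 1)) := by
      rw [← Real.rpow_add hs]
      congr 1
      rw [hq]
      push_cast
      ring
    rw [e1, ← e2, Real.rpow_add hAd, Real.rpow_one]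
    ring
  calc _ = ∫⁻ b : Fin d → ℝ, ∫⁻ s : ℝ, (Ioi (0 : ℝ)).indicator (G b) s := by
        refine lintegral_congr fun b => ?_
        -- Translating the corner entry `c` makes the Schur complement the integration variable.
        rw [← lintegral_add_right_eq_self _ (b ⬝ᵥ (A⁻¹ *ᵥ b))]
        refine lintegral_congr fun s => ?_
        rw [add_sub_cancel_right, hpt]
    _ = ∫⁻ b : Fin d → ℝ, ∫⁻ s in Ioi (0 : ℝ), G b s := by
        simp_rw [lintegral_indicator measurableSet_Ioi]
    _ = ∫⁻ s in Ioi (0 : ℝ), ∫⁻ b : Fin d → ℝ, G b s :=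
        lintegral_lintegral_swap hGm.aemeasurable
    _ = ∫⁻ s in Ioi (0 : ℝ), ENNReal.ofReal (A.det ^ (-q + 1) * T
          * ((2 * Real.pi) ^ ((d : ℝ) / 2) * P.det ^ (-(1 / 2) : ℝ)))
          * ENNReal.ofReal (s ^ (-(ν / 2 + 1)) * Real.exp (-(ω' / 2 / s))) :=
        setLIntegral_congr_fun measurableSet_Ioi fun s hs => hGs s hs
    _ = _ := by
        have hg : 0 < Real.Gamma (ν / 2) := Real.Gamma_pos_of_pos (by positivity)
        rw [lintegral_const_mul _ (by fun_prop), lintegral_inverse_gamma (by positivity)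
          (by positivity), ← ENNReal.ofReal_mul (by positivity), wishartKernel,
          ← ENNReal.ofReal_mul (by positivity)]
        congr 1
        have : -q + 1 = -((ν - 1 + d + 1) / 2) := by rw [hq]; push_cast; ring
        rw [this]
        ring

/-- The inverse Wishart integral. -/
theorem lintegral_wishartKernel (d : ℕ) : ∀ {ν : ℝ}, (d : ℝ) - 1 < ν →
    ∀ {Ψ : Matrix (Fin d) (Fin d) ℝ}, Ψ.PosDef →
    ∫⁻ v : Upper d → ℝ in {v | (symMat v).PosDef}, wishartKernel ν Ψ (symMat v)
      = ENNReal.ofReal (wishartConst d ν * Ψ.det ^ (-(ν / 2))) := by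
  induction d with
  | zero =>
    intro ν hν Ψ hΨ
    -- For `d = 0` there are no free entries: the space is one point, and the empty matrix is
    -- positive definite.
    have : {v : Upper 0 → ℝ | (symMat v).PosDef} = univ := by
      refine eq_univ_of_forall fun v => ?_
      rw [mem_ofPred_eq, Subsingleton.elim (symMat v) 1]
      exact Matrix.PosDef.one
    rw [this, Measure.restrict_univ, volume_pi, lintegral_unique]
    simp [wishartKernel, wishartConst, Matrix.trace]
  | succ d ih =>
    intro ν hν Ψ hΨ
    push_cast at hν
    have hν0 : 0 < ν := by have : (0 : ℝ) ≤ d := by positivity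
                           linarith
    obtain ⟨P, ψ, ω, hPe⟩ := exists_eq_border hΨ.isHermitian
    have hbord : (border P ψ ω).PosDef := by
      have := hΨ.submatrix (e := finSumFinEquiv) (Equiv.injective _)
      rwa [hPe, Matrix.submatrix_submatrix, Equiv.symm_comp_self, Matrix.submatrix_id_id] at this
    obtain ⟨hP, hω⟩ := (posDef_border_iff ψ ω).1 hbord
    have hPd := hP.det_pos
    have hΨd : Ψ.det = P.det * (ω - ψ ⬝ᵥ (P⁻¹ *ᵥ ψ)) := by
      rw [hPe, Matrix.det_submatrix_equiv_self, det_border hP]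
    have hpd : ∀ v : Upper d → ℝ, ∀ b c, (symMat (borderUpper v b c)).PosDef ↔
        (symMat v).PosDef ∧ 0 < c - b ⬝ᵥ ((symMat v)⁻¹ *ᵥ b) := by
      intro v b c
      rw [← posDef_border_iff, symMat_borderUpper]
      constructor
      · intro h
        have := h.submatrix (e := finSumFinEquiv) (Equiv.injective _)
        rwa [Matrix.submatrix_submatrix, Equiv.symm_comp_self, Matrix.submatrix_id_id] at this
      · exact fun h => h.submatrix (Equiv.injective _)
    have hm := (measurable_wishartKernel ν Ψ).indicator (measurableSet_posDef (d := d + 1))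
    have hm' : Measurable fun q : (Upper d → ℝ) × (Fin d → ℝ) × ℝ =>
        {v | (symMat v).PosDef}.indicator (fun v => wishartKernel ν Ψ (symMat v))
          (borderUpper q.1 q.2.1 q.2.2) := hm.comp (measurePreserving_borderUpper d).measurable
    rw [← lintegral_indicator measurableSet_posDef,
      ← (measurePreserving_borderUpper d).lintegral_comp hm, Measure.volume_eq_prod,
      lintegral_prod _ hm'.aemeasurable]
    -- The indicator of the larger cone factors into that of the leading block and positivity of the
    -- Schur complement; the former survives, ready for the induction hypothesis with `ν - 1`.
    have hinner : ∀ v : Upper d → ℝ, ∫⁻ q : (Fin d → ℝ) × ℝ,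
        {v | (symMat v).PosDef}.indicator (fun v => wishartKernel ν Ψ (symMat v))
          (borderUpper v q.1 q.2)
        = {v | (symMat v).PosDef}.indicator (fun v => ENNReal.ofReal
          ((2 * Real.pi) ^ ((d : ℝ) / 2) * P.det ^ (-(1 / 2) : ℝ)
          * (((ω - ψ ⬝ᵥ (P⁻¹ *ᵥ ψ)) / 2) ^ (-(ν / 2)) * Real.Gamma (ν / 2)))
          * wishartKernel (ν - 1) P (symMat v)) v := by
      intro v
      have hmv : Measurable fun q : (Fin d → ℝ) × ℝ =>
          {v | (symMat v).PosDef}.indicator (fun v => wishartKernel ν Ψ (symMat v))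
          (borderUpper v q.1 q.2) :=
        hm'.comp measurable_prodMk_left
      rw [Measure.volume_eq_prod, lintegral_prod _ hmv.aemeasurable]
      by_cases hv : (symMat v).PosDef
      · rw [indicator_of_mem (by exact hv), ← lintegral_wishartKernel_border hν0 hv hP ψ hω]
        refine lintegral_congr fun b => lintegral_congr fun c => ?_
        simp only [indicator, mem_ofPred_eq, hpd, hv, true_and, mem_Ioi]
        congr 1
        rw [wishartKernel, symMat_borderUpper, hPe, Matrix.det_submatrix_equiv_self,
          Matrix.inv_submatrix_equiv, Matrix.submatrix_mul_equiv]
        congr 4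
        exact Equiv.sum_comp finSumFinEquiv.symm
          fun i => (border P ψ ω * (border (symMat v) b c)⁻¹) i i
      · simp [indicator, hpd, hv]
    simp only
    simp_rw [hinner]
    rw [lintegral_indicator measurableSet_posDef, lintegral_const_mul _ (measurable_wishartKernel _ _),
      ih (by linarith) hP, ← ENNReal.ofReal_mul, wishartConst_succ, hΨd]
    · congr 1
      rw [Real.mul_rpow hPd.le hω.le, Real.div_rpow hω.le (by norm_num),
        Real.rpow_neg (x := 2) (by norm_num), div_inv_eq_mul,
        show -(ν / 2) = -(1 / 2) + -((ν - 1) / 2) by ring, Real.rpow_add hPd]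
      ring_nf
    · have hg : 0 < Real.Gamma (ν / 2) := Real.Gamma_pos_of_pos (by positivity)
      positivity

/-! ### Weighted Gram matrices and rank-one updates -/

section GramMatrix

variable {n : ℕ} {ι : Type*} [Fintype ι]

lemma posDef_gram {M : Matrix (Fin n) ι ℝ} (hM : Function.Injective M.mulVec) {z : Fin n → ℝ}
    (hz : ∀ i, 0 < z i) : (Mᵀ * Qinv z * M).PosDef := by
  have hD : (Qinv z).PosDef := Matrix.PosDef.diagonal hz
  have := hD.conjTranspose_mul_mul_same hM
  rwa [Matrix.conjTranspose_eq_transpose_of_trivial] at this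

lemma gram_apply {κ μ : Type*} (M : Matrix (Fin n) κ ℝ) (N : Matrix (Fin n) μ ℝ) (z : Fin n → ℝ)
    (k : κ) (l : μ) : (Mᵀ * Qinv z * N) k l = ∑ i, z i * (M i k * N i l) := by
  rw [Matrix.mul_apply]
  simp only [Qinv, Matrix.mul_diagonal, Matrix.transpose_apply]
  exact Finset.sum_congr rfl fun i _ => by ring

lemma gram_add_single {κ : Type*} (M : Matrix (Fin n) κ ℝ) (z : Fin n → ℝ) (i : Fin n) (t : ℝ) :
    Mᵀ * Qinv (z + Pi.single i t) * M
      = Mᵀ * Qinv z * M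
        + Matrix.replicateCol (Fin 1) (fun k => t * M i k) * Matrix.replicateRow (Fin 1) (M.row i) := by
  ext k l
  rw [Matrix.add_apply, gram_apply, gram_apply]
  simp only [Matrix.mul_apply, Pi.add_apply, add_mul, Finset.sum_add_distrib]
  congr 1
  rw [Finset.sum_eq_single i]
  · simp [mul_assoc]
  · intro j _ hj; simp [hj]
  · simp

lemma quadForm_gram (M : Matrix (Fin n) ι ℝ) (z : Fin n → ℝ) (w : ι → ℝ) :
    w ⬝ᵥ ((Mᵀ * Qinv z * M) *ᵥ w) = ∑ j, z j * (M j ⬝ᵥ w) ^ 2 := by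
  rw [← Matrix.mulVec_mulVec, ← Matrix.mulVec_mulVec, Matrix.dotProduct_mulVec,
    Matrix.vecMul_transpose]
  simp only [dotProduct, Qinv, Matrix.mulVec_diagonal]
  refine Finset.sum_congr rfl fun j _ => ?_
  simp only [Matrix.mulVec, dotProduct]
  ring

variable [DecidableEq ι]

/-- Increasing one weight of a Gram matrix. -/
lemma det_gram_add_single_bounds {M : Matrix (Fin n) ι ℝ} (hM : Function.Injective M.mulVec)
    {z : Fin n → ℝ} (hz : ∀ i, 0 < z i) (i : Fin n) {t : ℝ} (ht : 0 ≤ t) :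
    (Mᵀ * Qinv z * M).det ≤ (Mᵀ * Qinv (z + Pi.single i t) * M).det ∧
    (Mᵀ * Qinv (z + Pi.single i t) * M).det ≤ (1 + t / z i) * (Mᵀ * Qinv z * M).det := by
  have hK := posDef_gram hM hz
  set K := Mᵀ * Qinv z * M with hKdef
  have hKu : IsUnit K.det := (Matrix.isUnit_iff_isUnit_det K).1 hK.isUnit
  set w := K⁻¹ *ᵥ M i with hw
  set c := M i ⬝ᵥ w with hc
  have hKw : K *ᵥ w = M i := by
    rw [hw, Matrix.mulVec_mulVec, Matrix.mul_nonsing_inv _ hKu, Matrix.one_mulVec]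
  have hq : c = ∑ j, z j * (M j ⬝ᵥ w) ^ 2 := by
    rw [← quadForm_gram, ← hKdef, hKw, dotProduct_comm]
  have hc0 : 0 ≤ c := by
    rw [hq]
    exact Finset.sum_nonneg fun j _ => mul_nonneg (hz j).le (sq_nonneg _)
  -- Here `c = Mᵢᵀ K⁻¹ Mᵢ` is the quadratic form of `K` at `w`, hence a sum of nonnegative terms;
  -- its `i`-th term is `zᵢ c²`, which forces `c ≤ 1 / zᵢ`.
  have hcz : z i * c ^ 2 ≤ c := by
    conv_rhs => rw [hq]
    exact Finset.single_le_sum (f := fun j => z j * (M j ⬝ᵥ w) ^ 2)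
      (fun j _ => mul_nonneg (hz j).le (sq_nonneg _)) (Finset.mem_univ i)
  have hc1 : c ≤ 1 / z i := by
    rw [le_div_iff₀ (hz i)]
    by_contra! hcon
    have : 0 < c := by
      by_contra! h0
      have : c = 0 := le_antisymm h0 hc0
      rw [this] at hcon
      linarith
    nlinarith
  -- The matrix determinant lemma for the rank-one update.
  have hdet : (Mᵀ * Qinv (z + Pi.single i t) * M).det = K.det * (1 + t * c) := by
    rw [gram_add_single]
    refine (Matrix.det_add_mul (Matrix.replicateCol (Fin 1) fun k => t * M i k)
      (Matrix.replicateRow (Fin 1) (M.row i)) hKu).trans ?_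
    congr 1
    rw [Matrix.det_unique, Matrix.add_apply, Matrix.one_apply_eq, Matrix.mul_assoc]
    congr 1
    simp only [Matrix.mul_apply, Matrix.replicateRow_apply, Matrix.replicateCol_apply, Matrix.row_apply,
      hc, hw, dotProduct, Matrix.mulVec, Finset.mul_sum]
    exact Finset.sum_congr rfl fun j _ => Finset.sum_congr rfl fun k _ => by ring
  rw [hdet]
  have hKd := hK.det_pos
  constructor
  · have := mul_nonneg ht hc0
    nlinarith
  · rw [mul_comm]
    have : t * c ≤ t * (1 / z i) := by gcongr
    rw [mul_one_div] at this
    gcongr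

end GramMatrix

/-! ### Weighted least squares -/

section Algebra

variable {n p d : ℕ} {X : Matrix (Fin n) (Fin p) ℝ} {y : Matrix (Fin n) (Fin d) ℝ}

lemma mulVec_injective_of_rank {ι : Type*} [Fintype ι] [DecidableEq ι] {M : Matrix (Fin n) ι ℝ}
    (hr : M.rank = Fintype.card ι) : Function.Injective M.mulVec := by
  rw [Matrix.mulVec_injective_iff, linearIndependent_iff_card_eq_finrank_span, ← hr,
    Matrix.rank_eq_finrank_span_cols]
  rfl

/-- The residual sum of squares `yᵀ Q⁻¹ y - μᵀ Ω⁻¹ μ`. -/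
def rss (X : Matrix (Fin n) (Fin p) ℝ) (y : Matrix (Fin n) (Fin d) ℝ) (z : Fin n → ℝ) :
    Matrix (Fin d) (Fin d) ℝ :=
  yᵀ * Qinv z * y - (mu X y z)ᵀ * (Om X z)⁻¹ * mu X y z

lemma injective_left (hr : (Matrix.fromCols X y).rank = p + d) :
    Function.Injective X.mulVec := by
  have h := mulVec_injective_of_rank (M := Matrix.fromCols X y) (by simpa using hr)
  intro v w hvw
  have := @h (Sum.elim v 0) (Sum.elim w 0) (by
    simpa [Matrix.fromCols_mulVec] using hvw)
  funext i
  exact congrFun this (Sum.inl i)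

lemma gram_fromCols (z : Fin n → ℝ) :
    (Matrix.fromCols X y)ᵀ * Qinv z * Matrix.fromCols X y
      = Matrix.fromBlocks (Xᵀ * Qinv z * X) (Xᵀ * Qinv z * y) ((Xᵀ * Qinv z * y)ᵀ)
        (yᵀ * Qinv z * y) := by
  have : (Xᵀ * Qinv z * y)ᵀ = yᵀ * Qinv z * X := by
    rw [Matrix.transpose_mul, Matrix.transpose_mul, Matrix.transpose_transpose, Qinv,
      Matrix.diagonal_transpose, Matrix.mul_assoc]
  rw [this, Matrix.transpose_fromCols, Matrix.fromRows_mul, Matrix.fromRows_mul_fromCols]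

lemma posDef_gram_left (hr : (Matrix.fromCols X y).rank = p + d) {z : Fin n → ℝ}
    (hz : ∀ i, 0 < z i) : (Xᵀ * Qinv z * X).PosDef := posDef_gram (injective_left hr) hz

lemma isUnit_det_gram_left (hr : (Matrix.fromCols X y).rank = p + d) {z : Fin n → ℝ}
    (hz : ∀ i, 0 < z i) : IsUnit (Xᵀ * Qinv z * X).det :=
  (Matrix.isUnit_iff_isUnit_det _).1 (posDef_gram_left hr hz).isUnit

lemma inv_Om (hr : (Matrix.fromCols X y).rank = p + d) {z : Fin n → ℝ}
    (hz : ∀ i, 0 < z i) : (Om X z)⁻¹ = Xᵀ * Qinv z * X :=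
  Matrix.nonsing_inv_nonsing_inv _ (isUnit_det_gram_left hr hz)

lemma gram_mul_mu (hr : (Matrix.fromCols X y).rank = p + d) {z : Fin n → ℝ}
    (hz : ∀ i, 0 < z i) : (Xᵀ * Qinv z * X) * mu X y z = Xᵀ * Qinv z * y := by
  rw [mu, ← Matrix.mul_assoc, ← Matrix.mul_assoc, ← Matrix.mul_assoc,
    Matrix.mul_nonsing_inv _ (isUnit_det_gram_left hr hz), Matrix.one_mul]

/-- Identifies `rss` as the Schur complement of `XᵀQ⁻¹X` in the Gram matrix of `(X : y)`; its
positive definiteness and determinant follow from those of the full Gram matrix. -/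
lemma rss_eq_schur (hr : (Matrix.fromCols X y).rank = p + d) {z : Fin n → ℝ}
    (hz : ∀ i, 0 < z i) : rss X y z = yᵀ * Qinv z * y
    - (Xᵀ * Qinv z * y)ᵀ * (Xᵀ * Qinv z * X)⁻¹ * (Xᵀ * Qinv z * y) := by
  have hK := posDef_gram_left hr hz
  have hKs : ((Xᵀ * Qinv z * X)⁻¹)ᵀ = (Xᵀ * Qinv z * X)⁻¹ := by
    rw [← Matrix.conjTranspose_eq_transpose_of_trivial, hK.inv.isHermitian.eq]
  have hmu : mu X y z = (Xᵀ * Qinv z * X)⁻¹ * (Xᵀ * Qinv z * y) := by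
    simp only [mu, Matrix.mul_assoc]
  rw [rss, inv_Om hr hz, Matrix.mul_assoc _ _ (mu X y z), gram_mul_mu hr hz, hmu,
    Matrix.transpose_mul, hKs]

lemma det_gram_fromCols (hr : (Matrix.fromCols X y).rank = p + d) {z : Fin n → ℝ}
    (hz : ∀ i, 0 < z i) :
    ((Matrix.fromCols X y)ᵀ * Qinv z * Matrix.fromCols X y).det
      = (Xᵀ * Qinv z * X).det * (rss X y z).det := by
  have := (posDef_gram_left hr hz).isUnit.invertible
  rw [gram_fromCols, Matrix.det_fromBlocks₁₁, Matrix.invOf_eq_nonsing_inv, rss_eq_schur hr hz]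

lemma posDef_rss (hr : (Matrix.fromCols X y).rank = p + d) {z : Fin n → ℝ}
    (hz : ∀ i, 0 < z i) : (rss X y z).PosDef := by
  have hK := posDef_gram_left hr hz
  have := hK.isUnit.invertible
  have hG := posDef_gram (mulVec_injective_of_rank (M := Matrix.fromCols X y) (by simpa using hr)) hz
  have hpsd : (rss X y z).PosSemidef := by
    have h1 := hG.posSemidef
    rw [gram_fromCols, ← Matrix.conjTranspose_eq_transpose_of_trivial (Xᵀ * Qinv z * y),
      Matrix.PosDef.fromBlocks₁₁ _ _ hK, Matrix.conjTranspose_eq_transpose_of_trivial] at h1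
    rwa [rss_eq_schur hr hz]
  rw [hpsd.posDef_iff_det_ne_zero]
  have h2 := hG.det_pos
  rw [det_gram_fromCols hr hz] at h2
  exact (pos_iff_pos_of_mul_pos h2).1 hK.det_pos |>.ne'

/-- Pythagoras for the weighted inner product: the normal equations `gram_mul_mu` kill the cross
terms. -/
lemma residual_gram (hr : (Matrix.fromCols X y).rank = p + d) {z : Fin n → ℝ}
    (hz : ∀ i, 0 < z i) (β : Matrix (Fin p) (Fin d) ℝ) :
    (y - X * β)ᵀ * Qinv z * (y - X * β)
      = (β - mu X y z)ᵀ * (Om X z)⁻¹ * (β - mu X y z) + rss X y z := by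
  have hK := posDef_gram_left hr hz
  have hmu := gram_mul_mu hr hz
  have hKs : (Xᵀ * Qinv z * X)ᵀ = Xᵀ * Qinv z * X := by
    rw [← Matrix.conjTranspose_eq_transpose_of_trivial, hK.isHermitian.eq]
  have hmuT : (mu X y z)ᵀ * (Xᵀ * Qinv z * X) = yᵀ * Qinv z * X := by
    rw [← hKs, ← Matrix.transpose_mul, hmu, Matrix.transpose_mul, Matrix.transpose_mul,
      Matrix.transpose_transpose, Qinv, Matrix.diagonal_transpose, Matrix.mul_assoc]
  rw [rss, inv_Om hr hz]
  simp only [Matrix.transpose_sub, Matrix.transpose_mul, Matrix.sub_mul, Matrix.mul_sub]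
  rw [hmuT, Matrix.mul_assoc βᵀ _ (mu X y z), hmu]
  simp only [Matrix.mul_assoc]
  abel

end Algebra

/-! ### Residuals as traces -/

section Resid

variable {n p d : ℕ} {X : Matrix (Fin n) (Fin p) ℝ} {y : Matrix (Fin n) (Fin d) ℝ}

lemma resid_eq (β : Matrix (Fin p) (Fin d) ℝ) (S : Matrix (Fin d) (Fin d) ℝ) (i : Fin n) :
    resid X y β S i = (y - X * β) i ⬝ᵥ (S⁻¹ *ᵥ (y - X * β) i) := by
  have : y i - βᵀ *ᵥ X i = (y - X * β) i := by
    ext j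
    simp [Matrix.mulVec, dotProduct, Matrix.mul_apply, mul_comm]
  rw [resid, this]

lemma resid_nonneg (β : Matrix (Fin p) (Fin d) ℝ) {S : Matrix (Fin d) (Fin d) ℝ} (hS : S.PosDef)
    (i : Fin n) : 0 ≤ resid X y β S i := by
  simpa [resid] using hS.inv.posSemidef.dotProduct_mulVec_nonneg (y i - βᵀ *ᵥ X i)

lemma sum_mul_resid (z : Fin n → ℝ) (β : Matrix (Fin p) (Fin d) ℝ)
    (S : Matrix (Fin d) (Fin d) ℝ) :
    ∑ i, z i * resid X y β S i = ((y - X * β)ᵀ * Qinv z * (y - X * β) * S⁻¹ᵀ).trace := by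
  simp_rw [resid_eq]
  set R := y - X * β
  simp only [Matrix.trace, Matrix.diag]
  simp_rw [Matrix.mul_apply (M := Rᵀ * Qinv z * R), gram_apply]
  simp only [Matrix.transpose_apply, dotProduct, Matrix.mulVec, Finset.mul_sum, Finset.sum_mul]
  rw [Finset.sum_comm]
  refine Finset.sum_congr rfl fun j _ => ?_
  rw [Finset.sum_comm]
  refine Finset.sum_congr rfl fun k _ => Finset.sum_congr rfl fun i _ => ?_
  ring

/-- The first term is the exponent of the matrix normal law of step 3, the second that of the
inverse Wishart law of step 2. -/
lemma sum_mul_resid_eq (hr : (Matrix.fromCols X y).rank = p + d) {z : Fin n → ℝ}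
    (hz : ∀ i, 0 < z i) (β : Matrix (Fin p) (Fin d) ℝ) {S : Matrix (Fin d) (Fin d) ℝ}
    (hS : S.PosDef) :
    ∑ i, z i * resid X y β S i
      = ((Om X z)⁻¹ * (β - mu X y z) * S⁻¹ * (β - mu X y z)ᵀ).trace
        + (rss X y z * S⁻¹).trace := by
  have hSs : (S⁻¹)ᵀ = S⁻¹ := by
    rw [← Matrix.conjTranspose_eq_transpose_of_trivial, hS.inv.isHermitian.eq]
  rw [sum_mul_resid, residual_gram hr hz, hSs, Matrix.add_mul, Matrix.trace_add]
  congr 1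
  rw [Matrix.trace_mul_comm (_ * _ * _)]
  simp only [Matrix.mul_assoc]
  rw [Matrix.trace_mul_comm (S⁻¹)]
  simp only [Matrix.mul_assoc]
  rw [Matrix.trace_mul_comm]
  simp only [Matrix.mul_assoc]

end Resid

/-! ### Coordinates on the state space -/

section StateSpace

/-- The state space of the chain: the upper entries of `Σ`, and `β`. -/
abbrev State (p d : ℕ) : Type := (Upper d → ℝ) × (Fin p → Fin d → ℝ)

/-- Lebesgue measure on the pairs `(Σ, β)` with `Σ` positive definite. -/
def stateMeasure (p d : ℕ) : Measure (State p d) :=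
  (volume.restrict {v : Upper d → ℝ | (symMat v).PosDef}).prod volume

instance (p d : ℕ) : SigmaFinite (stateMeasure p d) := by
  unfold stateMeasure; infer_instance

variable {p d : ℕ}

lemma stateInt_eq_lintegral
    {F : Matrix (Fin p) (Fin d) ℝ → Matrix (Fin d) (Fin d) ℝ → ℝ≥0∞}
    (hF : Measurable fun q : State p d => F (Matrix.of q.2) (symMat q.1)) :
    stateInt F = ∫⁻ q, F (Matrix.of q.2) (symMat q.1) ∂stateMeasure p d := by
  rw [stateMeasure, lintegral_prod _ hF.aemeasurable, stateInt]

lemma ae_posDef_stateMeasure : ∀ᵐ q ∂stateMeasure p d, (symMat q.1).PosDef := by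
  have h : ∀ᵐ v ∂(volume.restrict {v : Upper d → ℝ | (symMat v).PosDef}), (symMat v).PosDef :=
    ae_restrict_mem measurableSet_posDef
  exact Measure.quasiMeasurePreserving_fst.ae h

lemma symMat_eq_of_isHermitian {S : Matrix (Fin d) (Fin d) ℝ} (hS : S.IsHermitian) :
    symMat (fun ij : Upper d => S ij.1.1 ij.1.2) = S := by
  ext i j
  rcases le_total i j with h | h
  · simp [symMat, h]
  · simp only [symMat, Matrix.of_apply, min_eq_right h, max_eq_left h]
    simpa using hS.apply i j

end StateSpace

/-! ### The conditional law of the state given the latent variables -/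

section Conditional

variable {n p d : ℕ} (X : Matrix (Fin n) (Fin p) ℝ) (y : Matrix (Fin n) (Fin d) ℝ) (a : ℝ)

/-- The density of the new state `(β, Σ)` given the latent `z`. -/
def condDensity (z : Fin n → ℝ) (β : Matrix (Fin p) (Fin d) ℝ) (S : Matrix (Fin d) (Fin d) ℝ) :
    ℝ≥0∞ :=
  step3 X y z S β * step2 X y a z S

/-- The joint kernel `|Σ|^{-(n + 2a)/2} exp(-½ ∑ zᵢ rᵢ(β, Σ))`. -/
def condKernel (z : Fin n → ℝ) (β : Matrix (Fin p) (Fin d) ℝ) (S : Matrix (Fin d) (Fin d) ℝ) :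
    ℝ≥0∞ :=
  ENNReal.ofReal (S.det ^ (-(((n : ℝ) + 2 * a) / 2)) *
    Real.exp (-(1 / 2) * ∑ i, z i * resid X y β S i))

/-- The integral of `condKernel` over the state space. -/
def condConst (z : Fin n → ℝ) : ℝ :=
  (2 * Real.pi) ^ ((p : ℝ) * d / 2) * wishartConst d ((n : ℝ) - p + 2 * a - d - 1) *
    ((Xᵀ * Qinv z * X).det ^ (-((d : ℝ) / 2)) *
      (rss X y z).det ^ (-(((n : ℝ) - p + 2 * a - d - 1) / 2)))

variable {X y a}

lemma condConst_pos (hr : (Matrix.fromCols X y).rank = p + d)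
    (hn : (d : ℝ) - 1 < (n : ℝ) - p + 2 * a - d - 1) {z : Fin n → ℝ} (hz : ∀ i, 0 < z i) :
    0 < condConst X y a z := by
  have h1 := (posDef_gram_left hr hz).det_pos
  have h2 := (posDef_rss hr hz).det_pos
  have h3 := wishartConst_pos hn
  unfold condConst
  positivity

lemma step2_eq (hr : (Matrix.fromCols X y).rank = p + d)
    (hn : (d : ℝ) - 1 < (n : ℝ) - p + 2 * a - d - 1) {z : Fin n → ℝ} (hz : ∀ i, 0 < z i)
    {S : Matrix (Fin d) (Fin d) ℝ} (hS : S.PosDef) :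
    step2 X y a z S = ENNReal.ofReal (wishartConst d ((n : ℝ) - p + 2 * a - d - 1) *
        (rss X y z).det ^ (-(((n : ℝ) - p + 2 * a - d - 1) / 2)))⁻¹
      * wishartKernel ((n : ℝ) - p + 2 * a - d - 1) (rss X y z) S := by
  have hR := posDef_rss hr hz
  have hRd := hR.det_pos
  have hC := wishartConst_pos hn
  have hRu : IsUnit (rss X y z).det := hRd.ne'.isUnit
  rw [step2, ← rss, wishartKernel, ← ENNReal.ofReal_mul (by positivity)]
  congr 1
  rw [invWishartDensity, if_pos hS, Matrix.nonsing_inv_nonsing_inv _ hRu, Matrix.det_nonsing_inv,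
    Ring.inverse_eq_inv', Real.inv_rpow hRd.le, ← Real.rpow_neg hRd.le, wishartConst, div_eq_inv_mul]
  congr 2
  ring

lemma lintegral_condDensity (hr : (Matrix.fromCols X y).rank = p + d)
    (hn : (d : ℝ) - 1 < (n : ℝ) - p + 2 * a - d - 1) {z : Fin n → ℝ} (hz : ∀ i, 0 < z i) :
    stateInt (condDensity X y a z) = 1 := by
  have hK := posDef_gram_left hr hz
  have hR := posDef_rss hr hz
  have hRd := hR.det_pos
  have hC := wishartConst_pos hn
  have h1 : stateInt (condDensity X y a z)
      = ∫⁻ v : Upper d → ℝ in {v | (symMat v).PosDef}, step2 X y a z (symMat v) := by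
    refine setLIntegral_congr_fun measurableSet_posDef fun v hv => ?_
    simp only [condDensity, step3]
    have hm : Measurable fun b : Fin p → Fin d → ℝ => ENNReal.ofReal
        (matrixNormalDensity (mu X y z) (Om X z) (symMat v) (Matrix.of b)) := by
      have : Measurable fun b : Fin p → Fin d → ℝ => ((Om X z)⁻¹ * (Matrix.of b - mu X y z) *
          (symMat v)⁻¹ * (Matrix.of b - mu X y z)ᵀ).trace := by
        have hb : MeasurableEntries fun b : Fin p → Fin d → ℝ => Matrix.of b - mu X y z :=
          MeasurableEntries.sub (fun i j => by simp only [Matrix.of_apply]; fun_prop) (.const _)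
        exact ((((MeasurableEntries.const (Om X z)⁻¹).mul hb).mul (.const (symMat v)⁻¹)).mul
          hb.transpose).trace
      unfold matrixNormalDensity
      fun_prop
    rw [lintegral_mul_const _ hm, lintegral_matrixNormalDensity (A := Om X z) _ hK.inv hv, one_mul]
  rw [h1, setLIntegral_congr_fun measurableSet_posDef fun v hv => step2_eq hr hn hz hv,
    lintegral_const_mul _ (measurable_wishartKernel _ _), lintegral_wishartKernel d hn hR,
    ← ENNReal.ofReal_mul (by positivity), inv_mul_cancel₀ (by positivity), ENNReal.ofReal_one]

/-- The factor `|Σ|^{-p/2}` of the matrix normal density and the inverse Wishart power of `|Σ|`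
combine to the exponent `-(n + 2a)/2`. -/
lemma condKernel_eq (hr : (Matrix.fromCols X y).rank = p + d)
    (hn : (d : ℝ) - 1 < (n : ℝ) - p + 2 * a - d - 1) {z : Fin n → ℝ} (hz : ∀ i, 0 < z i)
    (β : Matrix (Fin p) (Fin d) ℝ) {S : Matrix (Fin d) (Fin d) ℝ} (hS : S.PosDef) :
    condKernel X y a z β S = ENNReal.ofReal (condConst X y a z) * condDensity X y a z β S := by
  have hK := posDef_gram_left hr hz
  have hR := posDef_rss hr hz
  have hKd := hK.det_pos
  have hRd := hR.det_pos
  have hSd := hS.det_pos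
  have hC := wishartConst_pos hn
  have hcc := condConst_pos hr hn hz
  have hOd : (Om X z).det = (Xᵀ * Qinv z * X).det⁻¹ := by
    rw [Om, Matrix.det_nonsing_inv, Ring.inverse_eq_inv']
  rw [condDensity, step2_eq hr hn hz hS, wishartKernel, step3, condKernel,
    ← ENNReal.ofReal_mul (by positivity), ← ENNReal.ofReal_mul, ← ENNReal.ofReal_mul hcc.le]
  · congr 1
    rw [sum_mul_resid_eq hr hz β hS, matrixNormalDensity, hOd, condConst, mul_add, Real.exp_add,
      Real.inv_rpow hKd.le, Real.rpow_neg hKd.le]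
    have e1 : S.det ^ (-(((n : ℝ) + 2 * a) / 2)) = (S.det ^ ((p : ℝ) / 2))⁻¹
        * S.det ^ (-(((n : ℝ) - p + 2 * a - d - 1 + d + 1) / 2)) := by
      rw [← Real.rpow_neg hSd.le, ← Real.rpow_add hSd]
      congr 1
      ring
    rw [e1]
    field_simp
  · unfold matrixNormalDensity
    rw [hOd]
    positivity

lemma lintegral_condKernel (hr : (Matrix.fromCols X y).rank = p + d)
    (hn : (d : ℝ) - 1 < (n : ℝ) - p + 2 * a - d - 1) {z : Fin n → ℝ} (hz : ∀ i, 0 < z i)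
    (hm : Measurable fun q : State p d => condDensity X y a z (Matrix.of q.2) (symMat q.1)) :
    ∫⁻ q, condKernel X y a z (Matrix.of q.2) (symMat q.1) ∂stateMeasure p d
      = ENNReal.ofReal (condConst X y a z) := by
  rw [lintegral_congr_ae (g := fun q => ENNReal.ofReal (condConst X y a z) *
    condDensity X y a z (Matrix.of q.2) (symMat q.1))]
  · rw [lintegral_const_mul _ hm, ← stateInt_eq_lintegral hm, lintegral_condDensity hr hn hz,
      mul_one]
  · filter_upwards [ae_posDef_stateMeasure] with q hq
    exact condKernel_eq hr hn hz _ hq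

/-- Consequently `condConst (z + t eᵢ) / condConst z` is the Laplace transform at `t` of `rᵢ / 2`
under the conditional law. -/
lemma condKernel_add_single (z : Fin n → ℝ) (i : Fin n) (t : ℝ) (β : Matrix (Fin p) (Fin d) ℝ)
    {S : Matrix (Fin d) (Fin d) ℝ} (hS : S.PosDef) :
    condKernel X y a (z + Pi.single i t) β S
      = condKernel X y a z β S * ENNReal.ofReal (Real.exp (-(t * (resid X y β S i / 2)))) := by
  have hSd := hS.det_pos
  rw [condKernel, condKernel, ← ENNReal.ofReal_mul (by positivity), mul_assoc, ← Real.exp_add]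
  congr 3
  simp only [Pi.add_apply, add_mul, Finset.sum_add_distrib]
  rw [Finset.sum_eq_single (f := fun j => (Pi.single i t : Fin n → ℝ) j * resid X y β S j) i]
  · simp; ring
  · intro j _ hj; simp [hj]
  · simp

lemma condConst_add_single_ge (hr : (Matrix.fromCols X y).rank = p + d)
    (hn : (d : ℝ) - 1 < (n : ℝ) - p + 2 * a - d - 1) (hd : 0 < d) {z : Fin n → ℝ}
    (hz : ∀ i, 0 < z i) (i : Fin n) {t : ℝ} (ht : 0 ≤ t) :
    (1 - ((n : ℝ) - p + 2 * a - 1) / (2 * z i) * t) * condConst X y a z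
      ≤ condConst X y a (z + Pi.single i t) := by
  have hz' : ∀ j, 0 < (z + Pi.single i t : Fin n → ℝ) j := by
    intro j
    rcases eq_or_ne j i with rfl | h
    · simpa using add_pos_of_pos_of_nonneg (hz j) ht
    · simpa [h] using hz j
  set ν : ℝ := (n : ℝ) - p + 2 * a - d - 1 with hν
  have hd1 : (1 : ℝ) ≤ d := by exact_mod_cast hd
  have hν0 : 0 < ν := by linarith
  have hK := (posDef_gram_left hr hz).det_pos
  have hK' := (posDef_gram_left hr hz').det_pos
  have hR := (posDef_rss hr hz).det_pos
  have hR' := (posDef_rss hr hz').det_pos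
  obtain ⟨k1, k2⟩ := det_gram_add_single_bounds (injective_left hr) hz i ht
  obtain ⟨-, g2⟩ := det_gram_add_single_bounds
    (mulVec_injective_of_rank (M := Matrix.fromCols X y) (by simpa using hr)) hz i ht
  rw [det_gram_fromCols hr hz, det_gram_fromCols hr hz'] at g2
  have hx : 0 ≤ t / z i := div_nonneg ht (hz i).le
  -- `det rss` is the quotient of the full Gram determinant, which grows by at most `1 + t / zᵢ`, by
  -- that of `X`, which does not decrease.
  have r2 : (rss X y (z + Pi.single i t)).det ≤ (1 + t / z i) * (rss X y z).det := by
    have h1 : (Xᵀ * Qinv z * X).det * (rss X y (z + Pi.single i t)).det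
        ≤ (Xᵀ * Qinv z * X).det * ((1 + t / z i) * (rss X y z).det) := by
      calc _ ≤ (Xᵀ * Qinv (z + Pi.single i t) * X).det * (rss X y (z + Pi.single i t)).det := by
            gcongr
        _ ≤ _ := g2
        _ = _ := by ring
    exact le_of_mul_le_mul_left h1 hK
  have hC := wishartConst_pos hn
  -- The total exponent is `d + ν = n - p + 2a - 1`; Bernoulli's inequality follows from `log (1 +
  -- x) ≤ x` and `1 + x ≤ exp x`.
  have hpow : 1 - ((n : ℝ) - p + 2 * a - 1) / (2 * z i) * t
      ≤ (1 + t / z i) ^ (-((d : ℝ) / 2)) * (1 + t / z i) ^ (-(ν / 2)) := by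
    have h1x : 0 < 1 + t / z i := by linarith
    rw [← Real.rpow_add h1x, Real.rpow_def_of_pos h1x]
    have hlog : Real.log (1 + t / z i) ≤ t / z i := by
      have := Real.log_le_sub_one_of_pos h1x
      linarith
    have hα : 0 ≤ ((d : ℝ) + ν) / 2 := by positivity
    have h3 := Real.add_one_le_exp (Real.log (1 + t / z i) * (-((d : ℝ) / 2) + -(ν / 2)))
    have h4 : Real.log (1 + t / z i) * (((d : ℝ) + ν) / 2) ≤ t / z i * (((d : ℝ) + ν) / 2) := by
      gcongr
    have h5 : ((n : ℝ) - p + 2 * a - 1) / (2 * z i) * t = t / z i * (((d : ℝ) + ν) / 2) := by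
      rw [hν]
      have := (hz i).ne'
      field_simp
      ring
    rw [h5]
    linarith
  have e1 : (1 + t / z i) ^ (-((d : ℝ) / 2)) * (Xᵀ * Qinv z * X).det ^ (-((d : ℝ) / 2))
      ≤ (Xᵀ * Qinv (z + Pi.single i t) * X).det ^ (-((d : ℝ) / 2)) := by
    rw [← Real.mul_rpow (by linarith) hK.le]
    exact Real.rpow_le_rpow_of_nonpos hK' k2 (by linarith)
  have e2 : (1 + t / z i) ^ (-(ν / 2)) * (rss X y z).det ^ (-(ν / 2))
      ≤ (rss X y (z + Pi.single i t)).det ^ (-(ν / 2)) := by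
    rw [← Real.mul_rpow (by linarith) hR.le]
    exact Real.rpow_le_rpow_of_nonpos hR' r2 (by linarith)
  unfold condConst
  rw [← hν]
  calc _ ≤ ((1 + t / z i) ^ (-((d : ℝ) / 2)) * (1 + t / z i) ^ (-(ν / 2))) *
        ((2 * Real.pi) ^ ((p : ℝ) * d / 2) * wishartConst d ν *
          ((Xᵀ * Qinv z * X).det ^ (-((d : ℝ) / 2)) * (rss X y z).det ^ (-(ν / 2)))) := by
        gcongr
    _ = (2 * Real.pi) ^ ((p : ℝ) * d / 2) * wishartConst d ν *
          (((1 + t / z i) ^ (-((d : ℝ) / 2)) * (Xᵀ * Qinv z * X).det ^ (-((d : ℝ) / 2))) *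
            ((1 + t / z i) ^ (-(ν / 2)) * (rss X y z).det ^ (-(ν / 2)))) := by ring
    _ ≤ _ := by
        have h0 : 0 < 1 + t / z i := by linarith
        gcongr

end Conditional

/-! ### From Laplace transforms to means -/

/-- A bound on the Laplace transform near zero bounds the mean. -/
lemma lintegral_mul_le_of_laplace {E : Type*} [MeasurableSpace E] {τ : Measure E}
    {f : E → ℝ≥0∞} (hf : Measurable f) (hf1 : ∫⁻ x, f x ∂τ = 1) {r : E → ℝ} (hr : Measurable r)
    (hr0 : ∀ᵐ x ∂τ, 0 ≤ r x) {α : ℝ} (hα : 0 ≤ α)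
    (hL : ∀ t : ℝ, 0 < t →
      ENNReal.ofReal (1 - α * t) ≤ ∫⁻ x, f x * ENNReal.ofReal (Real.exp (-(t * r x))) ∂τ) :
    ∫⁻ x, f x * ENNReal.ofReal (r x) ∂τ ≤ ENNReal.ofReal α := by
  have hstep : ∀ t : ℝ, 0 < t →
      ∫⁻ x, f x * ENNReal.ofReal ((1 - Real.exp (-(t * r x))) / t) ∂τ ≤ ENNReal.ofReal α := by
    intro t ht
    have h1 : (∫⁻ x, f x * ENNReal.ofReal (1 - Real.exp (-(t * r x))) ∂τ)
        + ∫⁻ x, f x * ENNReal.ofReal (Real.exp (-(t * r x))) ∂τ = 1 := by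
      rw [← lintegral_add_left (by fun_prop), ← hf1]
      refine lintegral_congr_ae ?_
      filter_upwards [hr0] with x hx
      rw [← mul_add, ← ENNReal.ofReal_add _ (Real.exp_pos _).le, sub_add_cancel, ENNReal.ofReal_one,
        mul_one]
      rw [sub_nonneg, Real.exp_le_one_iff]
      have := mul_nonneg ht.le hx
      linarith
    have h2 : ∫⁻ x, f x * ENNReal.ofReal (1 - Real.exp (-(t * r x))) ∂τ
        ≤ ENNReal.ofReal (α * t) := by
      -- When `α t > 1` the hypothesis is void, since `ENNReal.ofReal` truncates at 0, but the left
      -- side is at most 1 anyway.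
      by_cases hc : α * t ≤ 1
      · have h3 := hL t ht
        have h4 : (∫⁻ x, f x * ENNReal.ofReal (1 - Real.exp (-(t * r x))) ∂τ)
            + ENNReal.ofReal (1 - α * t) ≤ ENNReal.ofReal (α * t) + ENNReal.ofReal (1 - α * t) := by
          rw [← ENNReal.ofReal_add (by positivity) (by linarith), add_sub_cancel,
            ENNReal.ofReal_one, ← h1]
          gcongr
        exact (ENNReal.add_le_add_iff_right ENNReal.ofReal_ne_top).1 h4
      · refine (le_self_add.trans h1.le).trans ?_
        rw [← ENNReal.ofReal_one]
        exact ENNReal.ofReal_le_ofReal (not_le.1 hc).le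
    have h5 : ∀ x, f x * ENNReal.ofReal ((1 - Real.exp (-(t * r x))) / t)
        = f x * ENNReal.ofReal (1 - Real.exp (-(t * r x))) * (ENNReal.ofReal t)⁻¹ := by
      intro x
      rw [ENNReal.ofReal_div_of_pos ht, div_eq_mul_inv, mul_assoc]
    simp_rw [h5]
    rw [lintegral_mul_const _ (by fun_prop), ← div_eq_mul_inv,
      ENNReal.div_le_iff (by simpa using ht) ENNReal.ofReal_ne_top, ← ENNReal.ofReal_mul hα]
    exact h2
  -- Along `t = 1 / (k + 1)` the quotients `(1 - exp (-t r)) / t` tend to `r`, and Fatou's lemma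
  -- passes the bound to the limit.
  set t : ℕ → ℝ := fun k => 1 / ((k : ℝ) + 1) with ht
  have htpos : ∀ k, 0 < t k := fun k => by positivity
  have htlim : Filter.Tendsto t Filter.atTop (nhds 0) := tendsto_one_div_add_atTop_nhds_zero_nat
  have hlim : ∀ x, Filter.Tendsto
      (fun k => f x * ENNReal.ofReal ((1 - Real.exp (-(t k * r x))) / t k)) Filter.atTop
      (nhds (f x * ENNReal.ofReal (r x))) := by
    intro x
    have hder : HasDerivAt (fun s : ℝ => -Real.exp (-(s * r x))) (r x) 0 := by
      have h1 : HasDerivAt (fun s : ℝ => -(s * r x)) (-(1 * r x)) 0 :=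
        ((hasDerivAt_id (0 : ℝ)).mul_const (r x)).neg
      have h2 : HasDerivAt (fun s : ℝ => -Real.exp (-(s * r x)))
          (-(Real.exp (-(0 * r x)) * -(1 * r x))) 0 := h1.exp.neg
      rwa [show -(Real.exp (-(0 * r x)) * -(1 * r x)) = r x by simp] at h2
    have hslope := (hasDerivAt_iff_tendsto_slope_zero.1 hder).comp
      (tendsto_nhdsWithin_iff.2 ⟨htlim, Filter.Eventually.of_forall fun k => (htpos k).ne'⟩)
    have hcongr : Filter.Tendsto (fun k => (1 - Real.exp (-(t k * r x))) / t k) Filter.atTop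
        (nhds (r x)) := by
      refine hslope.congr fun k => ?_
      simp only [Function.comp, zero_add, zero_mul, neg_zero, Real.exp_zero, smul_eq_mul]
      ring
    have h3 := (ENNReal.continuous_ofReal.tendsto _).comp hcongr
    -- Multiplication by `f x`, possibly `∞`, is not continuous at 0; when `r x ≤ 0` all terms of
    -- the sequence vanish instead.
    by_cases hrx : r x ≤ 0
    · have hz : ∀ k, ENNReal.ofReal ((1 - Real.exp (-(t k * r x))) / t k) = 0 := by
        intro k
        rw [ENNReal.ofReal_eq_zero]
        refine div_nonpos_of_nonpos_of_nonneg ?_ (htpos k).le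
        rw [sub_nonpos, Real.one_le_exp_iff]
        have := mul_nonpos_of_nonneg_of_nonpos (htpos k).le hrx
        linarith
      simp only [hz, ENNReal.ofReal_eq_zero.2 hrx]
      exact tendsto_const_nhds
    · refine ENNReal.Tendsto.const_mul h3 (Or.inl ?_)
      simpa using hrx
  calc ∫⁻ x, f x * ENNReal.ofReal (r x) ∂τ
      = ∫⁻ x, Filter.liminf (fun k => f x * ENNReal.ofReal ((1 - Real.exp (-(t k * r x))) / t k))
          Filter.atTop ∂τ := lintegral_congr fun x => (hlim x).liminf_eq.symm
    _ ≤ Filter.liminf (fun k => ∫⁻ x, f x * ENNReal.ofReal ((1 - Real.exp (-(t k * r x))) / t k) ∂τ)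
          Filter.atTop := lintegral_liminf_le fun k => by fun_prop
    _ ≤ Filter.liminf (fun _ : ℕ => ENNReal.ofReal α) Filter.atTop :=
        Filter.liminf_le_liminf (Filter.Eventually.of_forall fun k => hstep _ (htpos k))
    _ = ENNReal.ofReal α := Filter.liminf_const _

/-! ### Joint measurability of the sampling densities -/

section Measurability

variable {n p d : ℕ} (X : Matrix (Fin n) (Fin p) ℝ) (y : Matrix (Fin n) (Fin d) ℝ) (a : ℝ)

lemma measurableEntries_Qinv : MeasurableEntries fun z : Fin n → ℝ => Qinv z := fun i j => by
  simp only [Qinv, Matrix.diagonal_apply]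
  split_ifs <;> fun_prop

lemma measurableEntries_Om : MeasurableEntries fun z : Fin n → ℝ => Om X z :=
  (((MeasurableEntries.const Xᵀ).mul measurableEntries_Qinv).mul (.const X)).inv

lemma measurableEntries_mu : MeasurableEntries fun z : Fin n → ℝ => mu X y z :=
  (((measurableEntries_Om X).mul (.const Xᵀ)).mul measurableEntries_Qinv).mul (.const y)

lemma measurableEntries_rss : MeasurableEntries fun z : Fin n → ℝ => rss X y z :=
  (((MeasurableEntries.const yᵀ).mul measurableEntries_Qinv).mul (.const y)).sub
    (((measurableEntries_mu X y).transpose.mul (measurableEntries_Om X).inv).mul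
      (measurableEntries_mu X y))

lemma measurable_resid (i : Fin n) :
    Measurable fun q : State p d => resid X y (Matrix.of q.2) (symMat q.1) i := by
  have hinv : MeasurableEntries fun q : State p d => (symMat q.1)⁻¹ :=
    (measurableEntries_symMat.comp measurable_fst).inv
  have hinv' : ∀ j k, Measurable fun q : State p d => (symMat q.1)⁻¹ j k := hinv
  have hv : ∀ j, Measurable fun q : State p d => (y i - (Matrix.of q.2)ᵀ *ᵥ X i) j := fun j => by
    simp only [dotProduct, Matrix.mulVec, Pi.sub_apply, Matrix.transpose_apply, Matrix.of_apply]
    exact measurable_const.sub (Finset.measurable_sum _ fun k _ =>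
      ((measurable_pi_apply j).comp ((measurable_pi_apply k).comp measurable_snd)).mul_const _)
  have : Measurable fun q : State p d => ∑ j, (y i - (Matrix.of q.2)ᵀ *ᵥ X i) j *
      ∑ k, (symMat q.1)⁻¹ j k * (y i - (Matrix.of q.2)ᵀ *ᵥ X i) k :=
    Finset.measurable_sum _ fun j _ => (hv j).mul (Finset.measurable_sum _ fun k _ => (hinv' j k).mul (hv k))
  exact this

lemma step2_eq_rss (z : Fin n → ℝ) (S : Matrix (Fin d) (Fin d) ℝ) : step2 X y a z S
    = ENNReal.ofReal (invWishartDensity ((n : ℝ) - p + 2 * a - d - 1) (rss X y z)⁻¹ S) := rfl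

lemma measurableEntries_sigma {α : Type*} [MeasurableSpace α] :
    MeasurableEntries fun q : α × State p d => symMat q.2.1 :=
  measurableEntries_symMat.comp (measurable_fst.comp measurable_snd)

lemma measurable_step2 : Measurable fun q : (Fin n → ℝ) × State p d =>
    step2 X y a q.1 (symMat q.2.1) := by
  have hS := measurableEntries_sigma (p := p) (d := d) (α := Fin n → ℝ)
  have hR : MeasurableEntries fun q : (Fin n → ℝ) × State p d => rss X y q.1 :=
    (measurableEntries_rss X y).comp measurable_fst
  have h1 := hS.det
  have h2 := hR.inv.det
  have h3 := (hR.inv.inv.mul hS.inv).trace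
  simp only [step2_eq_rss, invWishartDensity]
  refine ENNReal.measurable_ofReal.comp (Measurable.ite ?_ (by fun_prop) measurable_const)
  exact measurableSet_posDef.preimage (by fun_prop : Measurable fun q : (Fin n → ℝ) × State p d =>
    q.2.1)

lemma measurable_step3 : Measurable fun q : (Fin n → ℝ) × State p d =>
    step3 X y q.1 (symMat q.2.1) (Matrix.of q.2.2) := by
  have hS := measurableEntries_sigma (p := p) (d := d) (α := Fin n → ℝ)
  have hO : MeasurableEntries fun q : (Fin n → ℝ) × State p d => Om X q.1 :=
    (measurableEntries_Om X).comp measurable_fst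
  have hb : MeasurableEntries fun q : (Fin n → ℝ) × State p d => Matrix.of q.2.2 :=
    fun i j => by simp only [Matrix.of_apply]; fun_prop
  have hB : MeasurableEntries fun q : (Fin n → ℝ) × State p d => Matrix.of q.2.2 - mu X y q.1 :=
    hb.sub ((measurableEntries_mu X y).comp measurable_fst)
  have h1 := hS.det
  have h2 := hO.det
  have h3 := (((hO.inv.mul hB).mul hS.inv).mul hB.transpose).trace
  simp only [step3, matrixNormalDensity]
  exact ENNReal.measurable_ofReal.comp (Measurable.div
    (Real.measurable_exp.comp (h3.const_mul _)) (by fun_prop))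

lemma measurable_condDensity : Measurable fun q : (Fin n → ℝ) × State p d =>
    condDensity X y a q.1 (Matrix.of q.2.2) (symMat q.2.1) :=
  (measurable_step3 X y).mul (measurable_step2 X y a)

lemma measurable_condDensity_right (z : Fin n → ℝ) : Measurable fun q : State p d =>
    condDensity X y a z (Matrix.of q.2) (symMat q.1) := by
  have := (measurable_condDensity X y a).comp
    (measurable_prodMk_left : Measurable fun q : State p d => (z, q))
  exact this

lemma measurable_condDensity_left (q : State p d) : Measurable fun z : Fin n → ℝ =>
    condDensity X y a z (Matrix.of q.2) (symMat q.1) := by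
  have := (measurable_condDensity X y a).comp
    (measurable_prodMk_right : Measurable fun z : Fin n → ℝ => (z, q))
  exact this

lemma measurable_condKernel : Measurable fun q : (Fin n → ℝ) × State p d =>
    condKernel X y a q.1 (Matrix.of q.2.2) (symMat q.2.1) := by
  have h1 := (measurableEntries_sigma (p := p) (d := d) (α := Fin n → ℝ)).det
  have h2 : ∀ i, Measurable fun q : (Fin n → ℝ) × State p d =>
      resid X y (Matrix.of q.2.2) (symMat q.2.1) i :=
    fun i => (measurable_resid X y i).comp measurable_snd
  unfold condKernel
  fun_prop

end Measurability

/-! ### Conditional means of the residuals -/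

section Conditional

variable {n p d : ℕ} {X : Matrix (Fin n) (Fin p) ℝ} {y : Matrix (Fin n) (Fin d) ℝ} {a : ℝ}

lemma lintegral_condDensity' (hr : (Matrix.fromCols X y).rank = p + d)
    (hn : (d : ℝ) - 1 < (n : ℝ) - p + 2 * a - d - 1) {z : Fin n → ℝ} (hz : ∀ i, 0 < z i) :
    ∫⁻ q, condDensity X y a z (Matrix.of q.2) (symMat q.1) ∂stateMeasure p d = 1 := by
  rw [← stateInt_eq_lintegral (measurable_condDensity_right X y a z),
    lintegral_condDensity hr hn hz]

/-- The conditional mean of a residual given the latent variables. -/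
lemma lintegral_condDensity_mul_resid (hr : (Matrix.fromCols X y).rank = p + d)
    (hn : (d : ℝ) - 1 < (n : ℝ) - p + 2 * a - d - 1) (hd : 0 < d) {z : Fin n → ℝ}
    (hz : ∀ i, 0 < z i) (i : Fin n) :
    ∫⁻ q, condDensity X y a z (Matrix.of q.2) (symMat q.1) *
        ENNReal.ofReal (resid X y (Matrix.of q.2) (symMat q.1) i) ∂stateMeasure p d
      ≤ ENNReal.ofReal (((n : ℝ) - p + 2 * a - 1) / z i) := by
  have hd1 : (1 : ℝ) ≤ d := by exact_mod_cast hd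
  have hzi := hz i
  have hc := condConst_pos hr hn hz
  have hN : 0 < (n : ℝ) - p + 2 * a - 1 := by linarith
  have hm := measurable_condDensity_right X y a z
  have hrm := measurable_resid X y i
  have hL := lintegral_mul_le_of_laplace hm (lintegral_condDensity' hr hn hz) (hrm.div_const 2)
    (ae_posDef_stateMeasure.mono fun q hq => div_nonneg (resid_nonneg _ hq i) zero_le_two)
    (α := ((n : ℝ) - p + 2 * a - 1) / (2 * z i)) (by positivity) (by
      intro t ht
      have hz' : ∀ j, 0 < (z + Pi.single i t : Fin n → ℝ) j := by
        intro j
        rcases eq_or_ne j i with rfl | h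
        · simpa using add_pos (hz j) ht
        · simpa [h] using hz j
      rw [← ENNReal.mul_le_mul_iff_right (a := ENNReal.ofReal (condConst X y a z))
        (by simpa using hc) ENNReal.ofReal_ne_top, ← lintegral_const_mul _ (by fun_prop),
        ← ENNReal.ofReal_mul hc.le, mul_comm (condConst X y a z)]
      refine (ENNReal.ofReal_le_ofReal (condConst_add_single_ge hr hn hd hz i ht.le)).trans_eq ?_
      rw [← lintegral_condKernel hr hn hz' (measurable_condDensity_right X y a _)]
      refine lintegral_congr_ae ?_
      filter_upwards [ae_posDef_stateMeasure] with q hq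
      rw [condKernel_add_single _ _ _ _ hq, condKernel_eq hr hn hz _ hq, mul_assoc])
  have h2 : ∀ q : State p d, condDensity X y a z (Matrix.of q.2) (symMat q.1) *
        ENNReal.ofReal (resid X y (Matrix.of q.2) (symMat q.1) i)
      = 2 * (condDensity X y a z (Matrix.of q.2) (symMat q.1) *
        ENNReal.ofReal (resid X y (Matrix.of q.2) (symMat q.1) i / 2)) := by
    intro q
    rw [mul_left_comm, ← ENNReal.ofReal_ofNat, ← ENNReal.ofReal_mul zero_le_two]
    congr 2
    ring
  simp_rw [h2]
  rw [lintegral_const_mul _ (by fun_prop)]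
  refine (mul_le_mul_right hL 2).trans_eq ?_
  rw [← ENNReal.ofReal_ofNat, ← ENNReal.ofReal_mul zero_le_two]
  congr 1
  field_simp

end Conditional

/-! ### The mixing density and the latent law -/

section Mixing

variable {d : ℕ} {h : ℝ → ℝ}

lemma measurable_mixInt (hh : Measurable h) (q : ℝ) : Measurable (mixInt h q) := by
  have : Measurable fun su : ℝ × ℝ =>
      ENNReal.ofReal (su.2 ^ q * Real.exp (-(su.1 * su.2 / 2)) * h su.2) := by fun_prop
  exact this.lintegral_prod_right'

lemma measurable_psi (hh : Measurable h) : Measurable fun su : ℝ × ℝ => psi d h su.1 su.2 := by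
  have := measurable_mixInt hh ((d : ℝ) / 2)
  unfold psi
  fun_prop

lemma measurable_psi_right (hh : Measurable h) (s : ℝ) : Measurable (psi d h s) := by
  unfold psi
  fun_prop

lemma mixInt_ne_zero (hh : IsMixingDensity h) (q s : ℝ) : mixInt h q s ≠ 0 := by
  intro h0
  have hm := hh.measurable
  rw [mixInt, lintegral_eq_zero_iff (by fun_prop)] at h0
  have : ∫⁻ u in Ioi (0 : ℝ), ENNReal.ofReal (h u) = 0 := by
    rw [lintegral_eq_zero_iff (by fun_prop)]
    filter_upwards [h0, ae_restrict_mem measurableSet_Ioi] with u hu (hu0 : 0 < u)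
    simp only [Pi.zero_apply, ENNReal.ofReal_eq_zero] at hu ⊢
    by_contra! hcon
    have : 0 < u ^ q * Real.exp (-(s * u / 2)) * h u := by positivity
    linarith
  rw [hh.lintegral_eq_one] at this
  exact one_ne_zero this

lemma mixInt_anti (hh : IsMixingDensity h) (q : ℝ) : Antitone (mixInt h q) := by
  intro s t hst
  refine setLIntegral_mono' measurableSet_Ioi fun u (hu : 0 < u) => ?_
  have := hh.nonneg u hu
  gcongr

/-- It suffices to take `s = 0`: on `(0, 1]` the power is at most 1 and `h` has mass at most 1, and
on `(1, ∞)` this is `ConditionM`. -/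
lemma mixInt_ne_top (hh : IsMixingDensity h) (hM : ConditionM d h) {s : ℝ} (hs : 0 ≤ s) :
    mixInt h ((d : ℝ) / 2) s ≠ ∞ := by
  refine ne_top_of_le_ne_top ?_ (mixInt_anti hh _ hs)
  rw [mixInt, ← Ioc_union_Ioi_eq_Ioi zero_le_one,
    lintegral_union measurableSet_Ioi (Ioc_disjoint_Ioi le_rfl)]
  refine ENNReal.add_ne_top.2 ⟨?_, ?_⟩
  · refine ne_top_of_le_ne_top ENNReal.one_ne_top ?_
    rw [← hh.lintegral_eq_one]
    refine le_trans (setLIntegral_mono' measurableSet_Ioc fun u hu => ?_)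
      (lintegral_mono_set Ioc_subset_Ioi_self)
    refine ENNReal.ofReal_le_ofReal ?_
    have h1 := hh.nonneg u hu.1
    have h2 : u ^ ((d : ℝ) / 2) ≤ 1 := Real.rpow_le_one hu.1.le hu.2 (by positivity)
    simp only [zero_mul, zero_div, neg_zero, Real.exp_zero, mul_one]
    exact mul_le_of_le_one_left h1 h2
  · simpa using hM.ne

lemma lintegral_psi (hh : IsMixingDensity h) (hM : ConditionM d h) {s : ℝ} (hs : 0 ≤ s) :
    ∫⁻ u in Ioi (0 : ℝ), psi d h s u = 1 := by
  have hm := hh.measurable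
  simp only [psi]
  rw [lintegral_const_mul _ (by fun_prop)]
  exact ENNReal.inv_mul_cancel (mixInt_ne_zero hh _ _) (mixInt_ne_top hh hM hs)

/-- The ratio in the growth hypothesis is thus the mean of `1 / zᵢ` in step 1 when the residual is
`s`. -/
lemma lintegral_psi_mul_inv (hh : IsMixingDensity h) (s : ℝ) :
    ∫⁻ u in Ioi (0 : ℝ), psi d h s u * ENNReal.ofReal u⁻¹
      = mixInt h (((d : ℝ) - 2) / 2) s / mixInt h ((d : ℝ) / 2) s := by
  have hm := hh.measurable
  simp only [psi, mul_assoc]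
  rw [lintegral_const_mul _ (by fun_prop), ENNReal.div_eq_inv_mul]
  congr 1
  refine setLIntegral_congr_fun measurableSet_Ioi fun u (hu : 0 < u) => ?_
  have h1 := hh.nonneg u hu
  rw [← ENNReal.ofReal_mul (by positivity)]
  congr 1
  rw [show ((d : ℝ) - 2) / 2 = (d : ℝ) / 2 - 1 by ring, Real.rpow_sub_one hu.ne']
  ring

/-- `ψ(·; s) ≥ c ψ(·; R)` for `s ≤ R`. -/
lemma psi_ge (hh : IsMixingDensity h) (hM : ConditionM d h) {s R : ℝ} (hs : 0 ≤ s) (hsR : s ≤ R)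
    {u : ℝ} (hu : 0 < u) :
    (mixInt h ((d : ℝ) / 2) R / mixInt h ((d : ℝ) / 2) 0) * psi d h R u ≤ psi d h s u := by
  have h1 := hh.nonneg u hu
  have hR := mixInt_ne_top hh hM (hs.trans hsR)
  rw [psi, psi, ENNReal.div_eq_inv_mul, mul_assoc, ← mul_assoc (mixInt h _ R),
    ENNReal.mul_inv_cancel (mixInt_ne_zero hh _ _) hR, one_mul]
  -- For `s ≤ R` the exponential is larger at `s`, and the normalizing integral at `s` is at most
  -- that at 0.
  gcongr
  exact mixInt_anti hh _ hs

lemma lintegral_orthant_prod {n : ℕ} {f : Fin n → ℝ → ℝ≥0∞} (hf : ∀ i, Measurable (f i)) :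
    ∫⁻ z : Fin n → ℝ in Set.pi univ (fun _ => Ioi (0 : ℝ)), ∏ i, f i (z i)
      = ∏ i, ∫⁻ u in Ioi (0 : ℝ), f i u := by
  rw [volume_pi, Measure.restrict_pi_pi, lintegral_fintype_prod_eq_prod f hf]

lemma measurableSet_orthant (n : ℕ) :
    MeasurableSet (Set.pi univ (fun _ => Ioi (0 : ℝ)) : Set (Fin n → ℝ)) :=
  MeasurableSet.univ_pi fun _ => measurableSet_Ioi

end Mixing

/-! ### Drift and minorization for the chain -/

section Chain

variable {n p d : ℕ} (X : Matrix (Fin n) (Fin p) ℝ) (y : Matrix (Fin n) (Fin d) ℝ) (a : ℝ)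
  (h : ℝ → ℝ)

/-- The transition density in terms of the coordinates of the state space. -/
def kernel (q₀ q : State p d) : ℝ≥0∞ :=
  trans X y a h (Matrix.of q₀.2) (symMat q₀.1) (Matrix.of q.2) (symMat q.1)

/-- The unnormalized posterior density in the coordinates of the state space. -/
def target (q : State p d) : ℝ≥0∞ :=
  likelihood X y h (Matrix.of q.2) (symMat q.1) * prior a (symMat q.1)

/-- The sum of the residuals, the drift function of the chain. -/
def totalResid (q : State p d) : ℝ≥0 :=
  ∑ i, (resid X y (Matrix.of q.2) (symMat q.1) i).toNNReal

variable {h}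

lemma measurable_totalResid : Measurable (totalResid X y) :=
  Finset.measurable_sum _ fun i _ => (measurable_resid X y i).real_toNNReal

lemma measurable_step1 (hh : Measurable h) : Measurable fun r : State p d × (Fin n → ℝ) =>
    step1 X y h (Matrix.of r.1.2) (symMat r.1.1) r.2 := by
  have h1 : ∀ i, Measurable fun r : State p d × (Fin n → ℝ) =>
      psi d h (resid X y (Matrix.of r.1.2) (symMat r.1.1) i) (r.2 i) := fun i => by
    have h2 : Measurable fun r : State p d × (Fin n → ℝ) =>
        resid X y (Matrix.of r.1.2) (symMat r.1.1) i := (measurable_resid X y i).comp measurable_fst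
    have h3 : Measurable fun r : State p d × (Fin n → ℝ) => r.2 i :=
      (measurable_pi_apply i).comp measurable_snd
    have := (measurable_psi (d := d) hh).comp (h2.prodMk h3)
    exact this
  exact Finset.measurable_prod _ fun i _ => h1 i

lemma measurable_step1_right (hh : Measurable h) (q : State p d) : Measurable fun z : Fin n → ℝ =>
    step1 X y h (Matrix.of q.2) (symMat q.1) z := by
  have := (measurable_step1 X y hh).comp
    (measurable_prodMk_left : Measurable fun z : Fin n → ℝ => (q, z))
  exact this

lemma measurable_step1_left (hh : Measurable h) (z : Fin n → ℝ) : Measurable fun q : State p d =>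
    step1 X y h (Matrix.of q.2) (symMat q.1) z := by
  have := (measurable_step1 X y hh).comp
    (measurable_prodMk_right : Measurable fun q : State p d => (q, z))
  exact this

lemma measurable_kernel (hh : Measurable h) :
    Measurable (Function.uncurry (kernel (p := p) X y a h)) := by
  have h1 : Measurable fun r : (State p d × State p d) × (Fin n → ℝ) =>
      condDensity X y a r.2 (Matrix.of r.1.2.2) (symMat r.1.2.1) := by
    have := (measurable_condDensity X y a).comp
      (measurable_snd.prodMk (measurable_snd.comp measurable_fst) :
        Measurable fun r : (State p d × State p d) × (Fin n → ℝ) => (r.2, r.1.2))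
    exact this
  have h2 : Measurable fun r : (State p d × State p d) × (Fin n → ℝ) =>
      step1 X y h (Matrix.of r.1.1.2) (symMat r.1.1.1) r.2 := by
    have := (measurable_step1 X y hh).comp
      ((measurable_fst.comp measurable_fst).prodMk measurable_snd :
        Measurable fun r : (State p d × State p d) × (Fin n → ℝ) => (r.1.1, r.2))
    exact this
  exact (h1.mul h2).lintegral_prod_right'

lemma measurable_kernel_right (hh : Measurable h) (q₀ : State p d) :
    Measurable (kernel X y a h q₀) := by
  have := (measurable_kernel X y a hh).comp
    (measurable_prodMk_left : Measurable fun q : State p d => (q₀, q))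
  exact this

lemma measurable_target (hh : Measurable h) : Measurable (target (p := p) X y a h) := by
  have hS : Measurable fun q : State p d => (symMat q.1).det :=
    (measurableEntries_symMat.comp measurable_fst).det
  have hp : Measurable fun q : State p d => prior a (symMat q.1) := by
    unfold prior
    refine Measurable.ite ?_ (by fun_prop) measurable_const
    exact measurableSet_posDef.preimage (measurable_fst : Measurable fun q : State p d => q.1)
  have hl : Measurable fun q : State p d => likelihood X y h (Matrix.of q.2) (symMat q.1) := by
    refine Finset.measurable_prod _ fun i _ => ?_
    have h1 : Measurable fun r : State p d × ℝ => (symMat r.1.1).det := hS.comp measurable_fst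
    have h2 : Measurable fun r : State p d × ℝ => resid X y (Matrix.of r.1.2) (symMat r.1.1) i :=
      (measurable_resid X y i).comp measurable_fst
    have h3 : Measurable fun r : State p d × ℝ => h r.2 := hh.comp measurable_snd
    have h4 : Measurable fun r : State p d × ℝ => r.2 := measurable_snd
    have : Measurable fun r : State p d × ℝ => ENNReal.ofReal
        (r.2 ^ ((d : ℝ) / 2) / ((2 * Real.pi) ^ ((d : ℝ) / 2) * (symMat r.1.1).det ^ ((1 : ℝ) / 2))
          * Real.exp (-(r.2 / 2) * resid X y (Matrix.of r.1.2) (symMat r.1.1) i) * h r.2) := by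
      refine ENNReal.measurable_ofReal.comp (((h4.pow_const _).div
        ((h1.pow_const _).const_mul _)).mul (Real.measurable_exp.comp ?_) |>.mul h3)
      exact ((h4.div_const 2).neg).mul h2
    exact this.lintegral_prod_right'
  exact hl.mul hp

lemma lintegral_kernel_mul (hh : Measurable h) (q₀ : State p d) {V : State p d → ℝ≥0∞}
    (hV : Measurable V) :
    ∫⁻ q, kernel X y a h q₀ q * V q ∂stateMeasure p d
      = ∫⁻ z : Fin n → ℝ in Set.pi univ (fun _ => Ioi (0 : ℝ)),
        (∫⁻ q, condDensity X y a z (Matrix.of q.2) (symMat q.1) * V q ∂stateMeasure p d) *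
          step1 X y h (Matrix.of q₀.2) (symMat q₀.1) z := by
  have h1 : Measurable fun r : State p d × (Fin n → ℝ) =>
      condDensity X y a r.2 (Matrix.of r.1.2) (symMat r.1.1) := by
    have := (measurable_condDensity X y a).comp
      (measurable_swap : Measurable fun r : State p d × (Fin n → ℝ) => r.swap)
    exact this
  have h2 : Measurable fun r : State p d × (Fin n → ℝ) =>
      step1 X y h (Matrix.of q₀.2) (symMat q₀.1) r.2 :=
    (measurable_step1_right X y hh q₀).comp measurable_snd
  have h3 : Measurable fun r : State p d × (Fin n → ℝ) => V r.1 := hV.comp measurable_fst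
  calc ∫⁻ q, kernel X y a h q₀ q * V q ∂stateMeasure p d
      = ∫⁻ q, (∫⁻ z : Fin n → ℝ in Set.pi univ (fun _ => Ioi (0 : ℝ)),
          condDensity X y a z (Matrix.of q.2) (symMat q.1) *
          step1 X y h (Matrix.of q₀.2) (symMat q₀.1) z * V q) ∂stateMeasure p d := by
        refine lintegral_congr fun q => ?_
        rw [lintegral_mul_const _
          ((measurable_condDensity_left X y a q).fun_mul (measurable_step1_right X y hh q₀))]
        rfl
    _ = _ := by
        rw [lintegral_lintegral_swap ((h1.mul h2).mul h3).aemeasurable]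
        refine lintegral_congr fun z => ?_
        rw [← lintegral_mul_const _ ((measurable_condDensity_right X y a z).fun_mul hV)]
        refine lintegral_congr fun q => ?_
        ring

variable {X y a}

lemma lintegral_step1 (hh : IsMixingDensity h) (hM : ConditionM d h) {q : State p d}
    (hq : (symMat q.1).PosDef) :
    ∫⁻ z in Set.pi univ (fun _ => Ioi (0 : ℝ)), step1 X y h (Matrix.of q.2) (symMat q.1) z = 1 := by
  have hm : ∀ i, Measurable fun u => psi d h (resid X y (Matrix.of q.2) (symMat q.1) i) u :=
    fun i => measurable_psi_right hh.measurable _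
  unfold step1
  rw [lintegral_orthant_prod hm]
  exact Finset.prod_eq_one fun i _ => lintegral_psi hh hM (resid_nonneg _ hq i)

lemma lintegral_kernel (hr : (Matrix.fromCols X y).rank = p + d)
    (hn : (d : ℝ) - 1 < (n : ℝ) - p + 2 * a - d - 1) (hh : IsMixingDensity h)
    (hM : ConditionM d h) {q₀ : State p d} (hq₀ : (symMat q₀.1).PosDef) :
    ∫⁻ q, kernel X y a h q₀ q ∂stateMeasure p d = 1 := by
  have h1 := lintegral_kernel_mul X y a hh.measurable q₀ (V := fun _ => 1) measurable_const
  simp only [mul_one] at h1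
  rw [h1, ← lintegral_step1 (X := X) (y := y) hh hM hq₀]
  refine setLIntegral_congr_fun (measurableSet_orthant n) fun z hz => ?_
  rw [lintegral_condDensity' hr hn (fun i => hz i trivial), one_mul]

lemma lintegral_kernel_mul_resid (hr : (Matrix.fromCols X y).rank = p + d)
    (hn : (d : ℝ) - 1 < (n : ℝ) - p + 2 * a - d - 1) (hd : 0 < d) (hh : IsMixingDensity h)
    (hM : ConditionM d h) {q₀ : State p d} (hq₀ : (symMat q₀.1).PosDef) (i : Fin n) :
    ∫⁻ q, kernel X y a h q₀ q * ENNReal.ofReal (resid X y (Matrix.of q.2) (symMat q.1) i)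
        ∂stateMeasure p d
      ≤ ENNReal.ofReal ((n : ℝ) - p + 2 * a - 1) *
        (mixInt h (((d : ℝ) - 2) / 2) (resid X y (Matrix.of q₀.2) (symMat q₀.1) i) /
          mixInt h ((d : ℝ) / 2) (resid X y (Matrix.of q₀.2) (symMat q₀.1) i)) := by
  have hd1 : (1 : ℝ) ≤ d := by exact_mod_cast hd
  have hN : 0 ≤ (n : ℝ) - p + 2 * a - 1 := by linarith
  rw [lintegral_kernel_mul X y a hh.measurable q₀ (measurable_resid X y i).ennreal_ofReal]
  set r : Fin n → ℝ := resid X y (Matrix.of q₀.2) (symMat q₀.1) with hrdef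
  -- Only the `i`-th factor carries `1 / zᵢ`; the others integrate to 1 over the orthant.
  set g : Fin n → ℝ → ℝ≥0∞ := fun j u =>
    psi d h (r j) u * (if j = i then ENNReal.ofReal u⁻¹ else 1) with hg
  have hpsi : ∀ j, Measurable fun u => psi d h (r j) u :=
    fun j => measurable_psi_right hh.measurable _
  have hgm : ∀ j, Measurable (g j) := fun j => by
    refine (hpsi j).mul ?_
    split_ifs
    · fun_prop
    · exact measurable_const
  calc _ ≤ ∫⁻ z in Set.pi univ (fun _ => Ioi (0 : ℝ)),
        ENNReal.ofReal ((n : ℝ) - p + 2 * a - 1) * ∏ j, g j (z j) := by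
        refine setLIntegral_mono' (measurableSet_orthant n) fun z hz => ?_
        have hz' : ∀ i, 0 < z i := fun i => hz i trivial
        refine (mul_le_mul_left (lintegral_condDensity_mul_resid hr hn hd hz' i) _).trans_eq ?_
        rw [div_eq_mul_inv, ENNReal.ofReal_mul hN, mul_assoc]
        congr 1
        simp only [hg, Finset.prod_mul_distrib, Finset.prod_ite_eq', Finset.mem_univ, if_true]
        rw [mul_comm]
        rfl
    _ = ENNReal.ofReal ((n : ℝ) - p + 2 * a - 1) * ∏ j, ∫⁻ u in Ioi (0 : ℝ), g j u := by
        have hgp : Measurable fun z : Fin n → ℝ => ∏ j, g j (z j) :=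
          Finset.measurable_prod _ fun j _ => (hgm j).comp (measurable_pi_apply j)
        rw [lintegral_const_mul _ hgp, lintegral_orthant_prod hgm]
    _ = _ := by
        congr 1
        rw [Finset.prod_eq_single i]
        · simp only [hg, if_true]
          exact lintegral_psi_mul_inv hh _
        · intro j _ hj
          simp only [hg, hj, if_false, mul_one]
          exact lintegral_psi hh hM (resid_nonneg _ hq₀ j)
        · simp

lemma coe_totalResid (q : State p d) : (totalResid X y q : ℝ≥0∞)
    = ∑ i, ENNReal.ofReal (resid X y (Matrix.of q.2) (symMat q.1) i) := by
  simp [totalResid, ENNReal.ofReal]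

/-- The drift condition. -/
lemma lintegral_kernel_mul_totalResid (hr : (Matrix.fromCols X y).rank = p + d)
    (hn : (d : ℝ) - 1 < (n : ℝ) - p + 2 * a - d - 1) (hd : 0 < d) (hh : IsMixingDensity h)
    (hM : ConditionM d h) {lam L : ℝ} (hlam0 : 0 ≤ lam)
    (hkey : ∀ s : ℝ, 0 ≤ s → mixInt h (((d : ℝ) - 2) / 2) s / mixInt h ((d : ℝ) / 2) s
      ≤ ENNReal.ofReal (lam * s + L)) {q₀ : State p d} (hq₀ : (symMat q₀.1).PosDef) :
    ∫⁻ q, kernel X y a h q₀ q * totalResid X y q ∂stateMeasure p d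
      ≤ (((n : ℝ) - p + 2 * a - 1) * lam).toNNReal * totalResid X y q₀
        + (n * (((n : ℝ) - p + 2 * a - 1) * |L|).toNNReal : ℝ≥0) := by
  have hd1 : (1 : ℝ) ≤ d := by exact_mod_cast hd
  have hN : 0 ≤ (n : ℝ) - p + 2 * a - 1 := by linarith
  have hk : Measurable fun q => kernel X y a h q₀ q :=
    measurable_kernel_right X y a hh.measurable q₀
  simp only [coe_totalResid, Finset.mul_sum]
  rw [lintegral_finsetSum _ fun i _ => hk.fun_mul (measurable_resid X y i).ennreal_ofReal]
  -- `L` may be negative, so each coordinate is charged `N |L|`, which keeps the additive constant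
  -- nonnegative.
  have hK : ((n * (((n : ℝ) - p + 2 * a - 1) * |L|).toNNReal : ℝ≥0) : ℝ≥0∞)
      = ∑ _i : Fin n, ENNReal.ofReal (((n : ℝ) - p + 2 * a - 1) * |L|) := by
    simp [ENNReal.ofReal]
  rw [hK, ← Finset.sum_add_distrib]
  refine Finset.sum_le_sum fun i _ => ?_
  have hri := resid_nonneg (X := X) (y := y) (Matrix.of q₀.2) hq₀ i
  refine (lintegral_kernel_mul_resid hr hn hd hh hM hq₀ i).trans ?_
  refine (mul_le_mul_right (hkey _ hri) _).trans ?_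
  rw [← ENNReal.ofReal_mul hN]
  change _ ≤ ENNReal.ofReal _ * _ + _
  rw [← ENNReal.ofReal_mul (by positivity), ← ENNReal.ofReal_add (by positivity) (by positivity)]
  refine ENNReal.ofReal_le_ofReal ?_
  have := mul_le_mul_of_nonneg_left (le_abs_self L) hN
  linarith

/-- The minorization condition on the sublevel sets of `totalResid`. -/
lemma exists_minorization (hr : (Matrix.fromCols X y).rank = p + d)
    (hn : (d : ℝ) - 1 < (n : ℝ) - p + 2 * a - d - 1) (hh : IsMixingDensity h)
    (hM : ConditionM d h) (R : ℝ≥0) :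
    ∃ ε : ℝ≥0, 0 < ε ∧ ∃ f : State p d → ℝ≥0∞, Measurable f ∧ ∫⁻ q, f q ∂stateMeasure p d = 1 ∧
      ∀ q₀ : State p d, (symMat q₀.1).PosDef → totalResid X y q₀ ≤ R →
        ∀ q, ε * f q ≤ kernel X y a h q₀ q := by
  -- The constant from `psi_ge`, one factor for each latent variable. The minorizing density is that
  -- of the state after drawing the `zᵢ` independently from `ψ(·; R)`.
  set c := mixInt h ((d : ℝ) / 2) R / mixInt h ((d : ℝ) / 2) 0 with hc
  have hc0 : c ≠ 0 := ENNReal.div_ne_zero.2 ⟨mixInt_ne_zero hh _ _, mixInt_ne_top hh hM le_rfl⟩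
  have hct : c ≠ ∞ := ENNReal.div_ne_top (mixInt_ne_top hh hM R.2) (mixInt_ne_zero hh _ _)
  have hpsi : Measurable fun u => psi d h R u :=
    measurable_psi_right hh.measurable _
  have hw : Measurable fun z : Fin n → ℝ => ∏ i, psi d h R (z i) :=
    Finset.measurable_prod _ fun i _ => hpsi.comp (measurable_pi_apply i)
  have hC : Measurable fun r : State p d × (Fin n → ℝ) =>
      condDensity X y a r.2 (Matrix.of r.1.2) (symMat r.1.1) := by
    have := (measurable_condDensity X y a).comp
      (measurable_swap : Measurable fun r : State p d × (Fin n → ℝ) => r.swap)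
    exact this
  have hF : Measurable fun r : State p d × (Fin n → ℝ) =>
      condDensity X y a r.2 (Matrix.of r.1.2) (symMat r.1.1) * ∏ i, psi d h R (r.2 i) :=
    hC.mul (hw.comp measurable_snd)
  refine ⟨(c ^ n).toNNReal, ENNReal.toNNReal_pos (pow_ne_zero n hc0) (ENNReal.pow_ne_top hct),
    fun q => ∫⁻ z in Set.pi univ (fun _ => Ioi (0 : ℝ)),
      condDensity X y a z (Matrix.of q.2) (symMat q.1) * ∏ i, psi d h R (z i),
    hF.lintegral_prod_right', ?_, fun q₀ hq₀ hR q => ?_⟩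
  · rw [lintegral_lintegral_swap hF.aemeasurable]
    calc _ = ∫⁻ z in Set.pi univ (fun _ => Ioi (0 : ℝ)), ∏ i : Fin n, psi d h R (z i) := by
          refine setLIntegral_congr_fun (measurableSet_orthant n) fun z hz => ?_
          rw [lintegral_mul_const _ (measurable_condDensity_right X y a z),
            lintegral_condDensity' hr hn (fun i => hz i trivial), one_mul]
      _ = 1 := by
          rw [lintegral_orthant_prod fun _ => hpsi]
          exact Finset.prod_eq_one fun i _ => lintegral_psi hh hM R.2
  · beta_reduce
    rw [ENNReal.coe_toNNReal (ENNReal.pow_ne_top hct), ← lintegral_const_mul _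
      ((measurable_condDensity_left X y a q).fun_mul hw)]
    refine setLIntegral_mono' (measurableSet_orthant n) fun z hz => ?_
    rw [mul_left_comm]
    refine mul_le_mul_right ?_ _
    have : c ^ n * ∏ i, psi d h R (z i) = ∏ i, c * psi d h R (z i) := by
      simp [Finset.prod_mul_distrib]
    rw [this]
    refine Finset.prod_le_prod' fun i _ => psi_ge hh hM (resid_nonneg _ hq₀ i) ?_ (hz i trivial)
    have h1 : (resid X y (Matrix.of q₀.2) (symMat q₀.1) i).toNNReal ≤ R :=
      (Finset.single_le_sum (f := fun i => (resid X y (Matrix.of q₀.2) (symMat q₀.1) i).toNNReal)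
        (fun _ _ => zero_le) (Finset.mem_univ i)).trans hR
    exact Real.toNNReal_le_iff_le_coe.1 h1

end Chain

/-! ### Invariance of the posterior -/

section Posterior

variable {n p d : ℕ} {X : Matrix (Fin n) (Fin p) ℝ} {y : Matrix (Fin n) (Fin d) ℝ} {a : ℝ}
  {h : ℝ → ℝ}

lemma transIter_eq_kerIter (hh : Measurable h) (m : ℕ) (q₀ q : State p d) :
    transIter X y a h m (Matrix.of q₀.2) (symMat q₀.1) (Matrix.of q.2) (symMat q.1)
      = kerIter (stateMeasure p d) (kernel X y a h) m q₀ q := by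
  induction m generalizing q₀ q with
  | zero => rfl
  | succ m ih =>
    have hk := measurable_kernel_right X y a hh q₀
    have hi : Measurable fun w => kerIter (stateMeasure p d) (kernel X y a h) m w q := by
      have := (measurable_kerIter (τ := stateMeasure p d) (measurable_kernel X y a hh) m).comp
        (measurable_prodMk_right : Measurable fun w : State p d => (w, q))
      exact this
    have hki : Measurable fun w : State p d =>
        trans X y a h (Matrix.of q₀.2) (symMat q₀.1) (Matrix.of w.2) (symMat w.1) *
          transIter X y a h m (Matrix.of w.2) (symMat w.1) (Matrix.of q.2) (symMat q.1) := by
      simp only [ih]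
      exact hk.fun_mul hi
    have h1 := stateInt_eq_lintegral (F := fun β₁ S₁ =>
      trans X y a h (Matrix.of q₀.2) (symMat q₀.1) β₁ S₁ *
          transIter X y a h m β₁ S₁ (Matrix.of q.2) (symMat q.1)) hki
    refine h1.trans (lintegral_congr fun w => ?_)
    rw [ih]
    rfl

lemma likelihood_eq (hh : Measurable h) (β : Matrix (Fin p) (Fin d) ℝ)
    {S : Matrix (Fin d) (Fin d) ℝ} (hS : S.PosDef) :
    likelihood X y h β S
      = ∏ i, (ENNReal.ofReal ((2 * Real.pi) ^ ((d : ℝ) / 2) * S.det ^ ((1 : ℝ) / 2))⁻¹ *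
        mixInt h ((d : ℝ) / 2) (resid X y β S i)) := by
  have hSd := hS.det_pos
  refine Finset.prod_congr rfl fun i _ => ?_
  rw [mixInt, ← lintegral_const_mul _ (by fun_prop)]
  refine lintegral_congr fun u => ?_
  rw [← ENNReal.ofReal_mul (by positivity)]
  congr 1
  rw [show -(u / 2) * resid X y β S i = -(resid X y β S i * u / 2) by ring]
  ring

/-- Pointwise finiteness is what `lintegral_lt_top_of_invariant` needs to conclude that the
posterior is proper. -/
lemma target_ne_top (hh : IsMixingDensity h) (hM : ConditionM d h) (q : State p d) :
    target X y a h q ≠ ∞ := by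
  unfold target
  by_cases hq : (symMat q.1).PosDef
  · rw [likelihood_eq hh.measurable _ hq, prior, if_pos hq]
    refine ENNReal.mul_ne_top (ENNReal.prod_ne_top fun i _ => ?_) ENNReal.ofReal_ne_top
    exact ENNReal.mul_ne_top ENNReal.ofReal_ne_top (mixInt_ne_top hh hM (resid_nonneg _ hq i))
  · simp [prior, hq]

lemma target_ne_zero (hh : IsMixingDensity h) {q : State p d} (hq : (symMat q.1).PosDef) :
    target X y a h q ≠ 0 := by
  have hSd := hq.det_pos
  rw [target, likelihood_eq hh.measurable _ hq, prior, if_pos hq]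
  refine mul_ne_zero (Finset.prod_ne_zero_iff.2 fun i _ => mul_ne_zero ?_ (mixInt_ne_zero hh _ _))
    ?_
  · rw [Ne, ENNReal.ofReal_eq_zero, not_le]
    positivity
  · rw [Ne, ENNReal.ofReal_eq_zero, not_le]
    positivity

/-- The joint density of the parameters and the latent variables, up to a constant. -/
lemma target_mul_step1 (hh : IsMixingDensity h) (hM : ConditionM d h) {q : State p d}
    (hq : (symMat q.1).PosDef) {z : Fin n → ℝ} (hz : ∀ i, 0 < z i) :
    target X y a h q * step1 X y h (Matrix.of q.2) (symMat q.1) z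
      = condKernel X y a z (Matrix.of q.2) (symMat q.1) *
        ∏ i, ENNReal.ofReal (((2 * Real.pi) ^ ((d : ℝ) / 2))⁻¹ *
          (z i ^ ((d : ℝ) / 2) * h (z i))) := by
  have hSd := hq.det_pos
  set S := symMat q.1
  set β : Matrix (Fin p) (Fin d) ℝ := Matrix.of q.2
  have hz0 : ∀ i, 0 ≤ h (z i) := fun i => hh.nonneg _ (hz i)
  have hz1 : ∀ i, 0 ≤ z i ^ ((d : ℝ) / 2) := fun i => Real.rpow_nonneg (hz i).le _
  have h1 : likelihood X y h β S * step1 X y h β S z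
      = ∏ i, ENNReal.ofReal (((2 * Real.pi) ^ ((d : ℝ) / 2))⁻¹ * (z i ^ ((d : ℝ) / 2) * h (z i)) *
        ((S.det ^ ((1 : ℝ) / 2))⁻¹ * Real.exp (-(1 / 2) * (z i * resid X y β S i)))) := by
    rw [likelihood_eq hh.measurable β hq, step1, ← Finset.prod_mul_distrib]
    refine Finset.prod_congr rfl fun i _ => ?_
    rw [psi, mul_assoc, ← mul_assoc (mixInt h _ _), ENNReal.mul_inv_cancel (mixInt_ne_zero hh _ _)
      (mixInt_ne_top hh hM (resid_nonneg _ hq i)), one_mul, ← ENNReal.ofReal_mul (by positivity)]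
    congr 1
    rw [show -(1 / 2) * (z i * resid X y β S i) = -(resid X y β S i * z i / 2) by ring, mul_inv]
    ring
  rw [target, mul_right_comm, h1, prior, if_pos hq,
    ← ENNReal.ofReal_prod_of_nonneg fun i _ => by have := hz0 i; have := hz1 i; positivity,
    ← ENNReal.ofReal_prod_of_nonneg fun i _ => by have := hz0 i; have := hz1 i; positivity,
    ← ENNReal.ofReal_mul (Finset.prod_nonneg fun i _ => by
      have := hz0 i; have := hz1 i; positivity), condKernel, ← ENNReal.ofReal_mul (by positivity)]
  congr 1
  -- Each of the `n` likelihood factors brings `|Σ|^{-1/2}`, and the prior brings `|Σ|^{-a}`.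
  have e1 : S.det ^ (-(((n : ℝ) + 2 * a) / 2))
      = ((S.det ^ ((1 : ℝ) / 2))⁻¹) ^ n * S.det ^ (-a) := by
    rw [← Real.rpow_neg hSd.le, ← Real.rpow_natCast, ← Real.rpow_mul hSd.le, ← Real.rpow_add hSd]
    congr 1
    ring
  change _ * S.det ^ (-a) = _
  simp only [Finset.prod_mul_distrib, Finset.prod_const, Finset.card_univ, Fintype.card_fin,
    ← Real.exp_sum, ← Finset.mul_sum, e1]
  ring

/-- The posterior is invariant. -/
lemma lintegral_target_mul_kernel (hr : (Matrix.fromCols X y).rank = p + d)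
    (hn : (d : ℝ) - 1 < (n : ℝ) - p + 2 * a - d - 1) (hh : IsMixingDensity h)
    (hM : ConditionM d h) {q : State p d} (hq : (symMat q.1).PosDef) :
    ∫⁻ x, target X y a h x * kernel X y a h x q ∂stateMeasure p d = target X y a h q := by
  have hh' := hh.measurable
  have hf := measurable_target (p := p) X y a hh'
  set O : Set (Fin n → ℝ) := Set.pi univ (fun _ => Ioi (0 : ℝ))
  set w : (Fin n → ℝ) → ℝ≥0∞ := fun z => ∏ i, ENNReal.ofReal (((2 * Real.pi) ^ ((d : ℝ) / 2))⁻¹ *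
    (z i ^ ((d : ℝ) / 2) * h (z i)))
  have hC := measurable_condDensity_left X y a q
  have hFm : Measurable fun r : State p d × (Fin n → ℝ) =>
      condDensity X y a r.2 (Matrix.of q.2) (symMat q.1) * (target X y a h r.1 *
        step1 X y h (Matrix.of r.1.2) (symMat r.1.1) r.2) :=
    (hC.comp measurable_snd).fun_mul ((hf.comp measurable_fst).fun_mul (measurable_step1 X y hh'))
  calc ∫⁻ x, target X y a h x * kernel X y a h x q ∂stateMeasure p d
      = ∫⁻ x, (∫⁻ z in O, condDensity X y a z (Matrix.of q.2) (symMat q.1) *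
          (target X y a h x * step1 X y h (Matrix.of x.2) (symMat x.1) z)) ∂stateMeasure p d := by
        refine lintegral_congr fun x => ?_
        have h1 : kernel X y a h x q = ∫⁻ z in O, condDensity X y a z (Matrix.of q.2) (symMat q.1) *
          step1 X y h (Matrix.of x.2) (symMat x.1) z := rfl
        rw [h1, ← lintegral_const_mul _ (hC.fun_mul (measurable_step1_right X y hh' x))]
        exact lintegral_congr fun z => mul_left_comm _ _ _
    _ = ∫⁻ z in O, (∫⁻ x, condDensity X y a z (Matrix.of q.2) (symMat q.1) *
          (target X y a h x * step1 X y h (Matrix.of x.2) (symMat x.1) z) ∂stateMeasure p d) :=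
        lintegral_lintegral_swap hFm.aemeasurable
    _ = ∫⁻ z in O, target X y a h q * step1 X y h (Matrix.of q.2) (symMat q.1) z := by
        refine setLIntegral_congr_fun (measurableSet_orthant n) fun z hz => ?_
        have hz' : ∀ i, 0 < z i := fun i => hz i trivial
        have hCz := measurable_condDensity_right X y a z
        have hK : Measurable fun x : State p d =>
            condKernel X y a z (Matrix.of x.2) (symMat x.1) := by
          have := (measurable_condKernel X y a).comp
            (measurable_prodMk_left : Measurable fun x : State p d => (z, x))
          exact this
        -- The marginal of the joint density in `z`; multiplied by the conditional density of `q`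
        -- given `z` it restores the joint density at `(q, z)`.
        have h2 : ∫⁻ x, target X y a h x * step1 X y h (Matrix.of x.2) (symMat x.1) z
            ∂stateMeasure p d = ENNReal.ofReal (condConst X y a z) * w z := by
          rw [← lintegral_condKernel hr hn hz' hCz, ← lintegral_mul_const _ hK]
          refine lintegral_congr_ae ?_
          filter_upwards [ae_posDef_stateMeasure] with x hx
          exact target_mul_step1 hh hM hx hz'
        rw [lintegral_const_mul _ (hf.fun_mul (measurable_step1_left X y hh' z)), h2,
          target_mul_step1 hh hM hq hz', condKernel_eq hr hn hz' _ hq]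
        ring
    _ = target X y a h q := by
        rw [lintegral_const_mul _ (measurable_step1_right X y hh' q), lintegral_step1 hh hM hq,
          mul_one]

lemma lintegral_target_ne_zero (hr : (Matrix.fromCols X y).rank = p + d)
    (hn : (d : ℝ) - 1 < (n : ℝ) - p + 2 * a - d - 1) (hh : IsMixingDensity h) :
    ∫⁻ q, target X y a h q ∂stateMeasure p d ≠ 0 := by
  intro h0
  rw [lintegral_eq_zero_iff (measurable_target X y a hh.measurable)] at h0
  have h1 : ∀ᵐ _q ∂stateMeasure p d, False := by
    filter_upwards [h0, ae_posDef_stateMeasure] with q hq hS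
    exact target_ne_zero hh hS hq
  have h2 : stateMeasure p d = 0 := by simpa using h1
  -- The state measure is nonzero because it carries a probability density, here the conditional one
  -- at `z = 1`.
  have h3 := lintegral_condDensity' (a := a) hr hn (z := fun _ => 1) (fun _ => one_pos)
  rw [h2, lintegral_zero_measure] at h3
  exact zero_ne_one h3

/-- `toReal` sends `∞` to 0, which does no harm: if exactly one argument is infinite the right side
is `∞`, and if both are the left side is 0. -/
lemma ofReal_abs_toReal_sub_le (b c : ℝ≥0∞) :
    ENNReal.ofReal |b.toReal - c.toReal| ≤ (b - c) + (c - b) := by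
  rcases eq_or_ne b ∞ with rfl | hb
  · rcases eq_or_ne c ∞ with rfl | hc
    · simp
    · simp [ENNReal.top_sub hc]
  rcases eq_or_ne c ∞ with rfl | hc
  · simp [ENNReal.top_sub hb]
  lift b to ℝ≥0 using hb
  lift c to ℝ≥0 using hc
  rw [ENNReal.coe_toReal, ENNReal.coe_toReal, ← ENNReal.coe_sub, ← ENNReal.coe_sub,
    ← ENNReal.coe_add, ← ENNReal.ofReal_coe_nnreal]
  refine ENNReal.ofReal_le_ofReal ?_
  rw [NNReal.coe_add, NNReal.coe_sub_def, NNReal.coe_sub_def]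
  exact abs_le'.2 ⟨le_add_of_le_of_nonneg (le_max_left _ _) (le_max_right _ _),
    le_add_of_nonneg_of_le (le_max_right _ _) ((neg_sub _ _).le.trans (le_max_left _ _))⟩

end Posterior

/-! ### Assembly -/

/-- Drift and minorization give geometric ergodicity of the data augmentation chain. -/
theorem geometricallyErgodic_of_mixInt_le (n p d : ℕ) (hd : 0 < d)
    (X : Matrix (Fin n) (Fin p) ℝ) (y : Matrix (Fin n) (Fin d) ℝ) (a : ℝ)
    (hN1 : (Matrix.fromCols X y).rank = p + d)
    (hN2 : (n : ℝ) > p + 2 * d - 2 * a)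
    (h : ℝ → ℝ) (hh : IsMixingDensity h) (hM : ConditionM d h)
    (lam L : ℝ) (hlam0 : 0 ≤ lam) (hlam1 : lam < 1 / ((n : ℝ) - p + 2 * a - 1))
    (hkey : ∀ s : ℝ, 0 ≤ s →
      mixInt h (((d : ℝ) - 2) / 2) s / mixInt h ((d : ℝ) / 2) s
        ≤ ENNReal.ofReal (lam * s + L)) :
    GeometricallyErgodic X y a h := by
  have hd1 : (1 : ℝ) ≤ d := by exact_mod_cast hd
  -- With `ν = n - p + 2a - d - 1` this is `ν > d - 1`, the range in which the inverse Wishart law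
  -- exists.
  have hn : (d : ℝ) - 1 < (n : ℝ) - p + 2 * a - d - 1 := by linarith
  have hN : 0 < (n : ℝ) - p + 2 * a - 1 := by linarith
  have hγ : (((n : ℝ) - p + 2 * a - 1) * lam).toNNReal < 1 := by
    rw [Real.toNNReal_lt_one, mul_comm]
    exact (lt_div_iff₀ hN).1 hlam1
  have hk := measurable_kernel (p := p) X y a hh.measurable
  have hf := measurable_target (p := p) X y a hh.measurable
  have hs : ∀ᵐ q ∂stateMeasure p d, q ∈ {q : State p d | (symMat q.1).PosDef} :=
    ae_posDef_stateMeasure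
  have hk1 : ∀ q₀ ∈ {q : State p d | (symMat q.1).PosDef},
      ∫⁻ q, kernel X y a h q₀ q ∂stateMeasure p d = 1 :=
    fun q₀ hq₀ => lintegral_kernel hN1 hn hh hM hq₀
  have hV := measurable_totalResid (p := p) X y
  have hdrift : ∀ q₀ ∈ {q : State p d | (symMat q.1).PosDef},
      ∫⁻ q, kernel X y a h q₀ q * totalResid X y q ∂stateMeasure p d
        ≤ (((n : ℝ) - p + 2 * a - 1) * lam).toNNReal * totalResid X y q₀
          + (n * (((n : ℝ) - p + 2 * a - 1) * |L|).toNNReal : ℝ≥0) :=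
    fun q₀ hq₀ => lintegral_kernel_mul_totalResid hN1 hn hd hh hM hlam0 hkey hq₀
  have hmin := exists_minorization (a := a) hN1 hn hh hM
  have hinv : ∀ᵐ q ∂stateMeasure p d,
      ∫⁻ x, target X y a h x * kernel X y a h x q ∂stateMeasure p d = target X y a h q :=
    ae_posDef_stateMeasure.mono fun q hq => lintegral_target_mul_kernel hN1 hn hh hM hq
  have hfin := lintegral_lt_top_of_invariant hk hs hk1 hV hγ hdrift hmin hf
    (target_ne_top hh hM) hinv
  obtain ⟨M, ρ, hρ, hbound⟩ := exists_geometric_bound hk hs hk1 hV hγ hdrift hmin hf hfin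
    (lintegral_target_ne_zero hN1 hn hh) hinv
  have hmarg : marginal X y a h = ∫⁻ q, target X y a h q ∂stateMeasure p d :=
    stateInt_eq_lintegral hf
  refine ⟨hmarg ▸ hfin, fun β S => M (fun ij => S ij.1.1 ij.1.2, fun i j => β i j), ρ, hρ,
    fun m β₀ S₀ hS₀ => ?_⟩
  have hsym : symMat (fun ij : Upper d => S₀ ij.1.1 ij.1.2) = S₀ :=
    symMat_eq_of_isHermitian hS₀.isHermitian
  set q₀ : State p d := (fun ij => S₀ ij.1.1 ij.1.2, fun i j => β₀ i j) with hq₀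
  have hiter : ∀ q : State p d, transIter X y a h m β₀ S₀ (Matrix.of q.2) (symMat q.1)
      = kerIter (stateMeasure p d) (kernel X y a h) m q₀ q := fun q => by
    rw [← transIter_eq_kerIter hh.measurable, hsym]
    rfl
  have hpost : ∀ q : State p d, posterior X y a h (Matrix.of q.2) (symMat q.1)
      = target X y a h q / ∫⁻ x, target X y a h x ∂stateMeasure p d := fun q => by
    rw [← hmarg]
    rfl
  have hkm : Measurable fun q => kerIter (stateMeasure p d) (kernel X y a h) m q₀ q :=
    (measurable_kerIter hk m).of_uncurry_left
  rw [stateInt_eq_lintegral]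
  · refine le_trans (lintegral_mono fun q => ?_) (hbound m q₀ (by simpa [hq₀, hsym] using hS₀))
    rw [hiter, hpost]
    exact ofReal_abs_toReal_sub_le _ _
  · simp only [hiter, hpost]
    exact ((hkm.ennreal_toReal.sub (hf.div_const _).ennreal_toReal).abs).ennreal_ofReal

end DAReg

end

theorem proposition1 (n p d : ℕ) (hd : 0 < d)
    (X : Matrix (Fin n) (Fin p) ℝ) (y : Matrix (Fin n) (Fin d) ℝ) (a : ℝ)
    (hN1 : (Matrix.fromCols X y).rank = p + d)
    (hN2 : (n : ℝ) > p + 2 * d - 2 * a)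
    (h : ℝ → ℝ) (hh : DAReg.IsMixingDensity h) (hM : DAReg.ConditionM d h)
    (lam L : ℝ) (hlam0 : 0 ≤ lam) (hlam1 : lam < 1 / ((n : ℝ) - p + 2 * a - 1))
    (hkey : ∀ s : ℝ, 0 ≤ s →
      DAReg.mixInt h (((d : ℝ) - 2) / 2) s / DAReg.mixInt h ((d : ℝ) / 2) s
        ≤ ENNReal.ofReal (lam * s + L)) :
    DAReg.GeometricallyErgodic X y a h :=
  DAReg.geometricallyErgodic_of_mixInt_le n p d hd X y a hN1 hN2 h hh hM lam L hlam0 hlam1 hkey
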